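/- **Setting.** Let $\mu$ be a probability measure on $\mathbb R$ with $\int |h|\,d\mu(h)<\infty$, let $h\sim\mu$, and let $\theta>0$. In the random-field Curie–Weiss model of size $n\ge 1$ the fields $\mathbf h=(h_1,\dots,h_n)$ are i.i.d. with law $\mu$ and, given $\mathbf h$, the spins $\sigma\in\{-1,1\}^n$ have law $$\mathbb P(\sigma\mid \mathbf h)\ \propto\ \exp\Big(\tfrac{\theta}{2n}\big(\textstyle\sum_{i}\sigma_i\big)^2+\sum_i h_i\sigma_i\Big).$$ $\mathbb E$ denotes expectation over both $\mathbf h$ and $\sigma$, and $m=\frac1n\sum_i\sigma_i$. Put $$\mathcal H(x)=\tfrac{x^2}{2}-\mathbb E\log\cosh(\sqrt\theta x+h),\quad a(x)=\mathbb E\tanh(\sqrt\theta x+h),\quad s(x)=\mathbb E\,\mathrm{sech}^2(\sqrt\theta x+h),\quad \mathcal V(x)=\frac{1-\theta s(x)^2-a(x)^2}{(1-\theta s(x))^2}.$$ **1. High temperature.** Suppose $\mathcal H$ has a unique global minimizer $x^*$ and $\theta s(x^*)<1$. Then $x^*=\sqrt\theta\,a(x^*)$; with $X_n=n^{-1/2}\sum_{i=1}^n(\sigma_i-a(x^*))$,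 for every $t\in\mathbb R$, $\mathbb E e^{tX_n}\to e^{\mathcal V(x^*)t^2/2}$; and $X_n$ is sub-Gaussian uniformly in $n$: there is $K>0$ with $\mathbb E\exp(|X_n|^2/K^2)\le 2$ for all $n\ge1$. **2. Low temperature.** Suppose $\mu$ is symmetric about $0$, the global minimizers of $\mathcal H$ are exactly $x^*$ and $-x^*$ for some $x^*>0$, and $\theta s(x^*)<1$. Let $\varepsilon\in\{1,-1\}$. Then $\varepsilon x^*=\sqrt\theta\,a(\varepsilon x^*)$; with $X_n=n^{-1/2}\sum_i(\sigma_i-a(\varepsilon x^*))$, for every $t\in\mathbb R$, $$\mathbb E_{\mathbf h}\big[\,\mathbb E[e^{tX_n}\mid \mathbf h,\ \varepsilon m>0]\,\big]\to e^{\mathcal V(\varepsilon x^*)t^2/2},$$ and there is $K>0$ with $\mathbb E_{\mathbf h}\big[\mathbb E[\exp(|X_n|^2/K^2)\mid\mathbf h,\ \varepsilon m>0]\big]\le2$ for all $n\ge1$. (The sign is conditioned on in the Gibbs measure with the field fixed; the field is averaged afterwards.) **3. Critical temperature.** Suppose $\mu$ is not a point mass and $\mathcal H$ has a unique global minimizer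 $x^*$, of flatness $\tau$ for an integer $\tau\ge 2$, i.e. $\mathcal H^{(2\tau)}(x^*)>0$ and $$\mathcal H(x)=\mathcal H(x^*)+\tfrac{1}{(2\tau)!}\mathcal H^{(2\tau)}(x^*)(x-x^*)^{2\tau}+O\big((x-x^*)^{2\tau+1}\big)\qquad (x\to x^*).$$ Then, with $T=\tanh(\sqrt\theta x^*+h)$ and $S(\cdot,\cdot)$ the Stirling numbers of the second kind, $$\mathcal H^{(2\tau)}(x^*)=2^{2\tau-1}\theta^\tau\,\mathbb E\Big[(1+T)\sum_{k=0}^{2\tau-1}\frac{k!}{2^k}S(2\tau-1,k)(T-1)^k\Big].$$ Let $X_n=n^{-\frac{4\tau-3}{4\tau-2}}\sum_{i=1}^n(\sigma_i-\mathbb E\sigma_i)$ and $$v=\frac{((2\tau-1)!)^2\,\theta^{2\tau}\,\mathrm{Var}(T)\,s(x^*)^{4\tau-2}}{(\mathcal H^{(2\tau)}(x^*))^2},\qquad p(x)=\frac{(2\tau-1)x^{2\tau-2}}{\sqrt{2\pi v}}\exp\Big(-\frac{x^{4\tau-2}}{2v}\Big).$$ Then $X_n$ converges in distribution to the law with density $p$;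 for every $t\in\mathbb R$, $\mathbb E e^{tX_n}\to\int_{\mathbb R}e^{tx}p(x)\,dx$; and there is $K>0$ with $\mathbb E\exp\big((|X_n|/K)^{4\tau-2}\big)\le2$ for all $n\ge1$ (sub-Weibull of order $4\tau-2$, uniformly in $n$). -/

import Mathlib

open MeasureTheory Filter Topology Asymptotics

noncomputable section

namespace RFCW

/-- Spin configurations `σ ∈ {-1, 1}^n`. -/
abbrev Config (n : ℕ) : Type := Fin n → ℤˣ

/-- The spin `σ_i` as a real number. -/
def spin {n : ℕ} (σ : Config n) (i : Fin n) : ℝ := ((σ i : ℤ) : ℝ)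

/-- The sum of all spins. -/
def totalSpin {n : ℕ} (σ : Config n) : ℝ := ∑ i, spin σ i

/-- Unnormalized Gibbs weight `exp (θ/(2n) (∑ σ_i)² + ∑ h_i σ_i)`. -/
def weight {n : ℕ} (θ : ℝ) (h : Fin n → ℝ) (σ : Config n) : ℝ :=
  Real.exp (θ / (2 * n) * totalSpin σ ^ 2 + ∑ i, h i * spin σ i)

/-- Expectation of `f` under the Gibbs measure with external field `h`, conditioned on `σ ∈ A`
(the field is frozen). For `A = Finset.univ` this is the unconditional Gibbs expectation. -/
def gibbs {n : ℕ} (θ : ℝ) (h : Fin n → ℝ) (A : Finset (Config n)) (f : Config n → ℝ) : ℝ :=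
  (∑ σ ∈ A, weight θ h σ * f σ) / ∑ σ ∈ A, weight θ h σ

/-- Expectation over the i.i.d. field `h_1, …, h_n ∼ μ` of the Gibbs expectation given `h` and
given `σ ∈ A`. For `A = Finset.univ` this is the expectation in the random-field Curie–Weiss
model. -/
def expect (μ : Measure ℝ) (θ : ℝ) {n : ℕ} (A : Finset (Config n)) (f : Config n → ℝ) : ℝ :=
  ∫ h, gibbs θ h A f ∂(Measure.pi fun _ : Fin n => μ)

/-- Configurations whose magnetization has the sign of `ε`. -/
def signRegion (n : ℕ) (ε : ℝ) : Finset (Config n) :=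
  Finset.univ.filter fun σ => 0 < ε * totalSpin σ

/-- `H(x) = x²/2 - E log cosh (√θ x + h)`. -/
def H (μ : Measure ℝ) (θ x : ℝ) : ℝ :=
  x ^ 2 / 2 - ∫ h, Real.log (Real.cosh (√θ * x + h)) ∂μ

/-- `E tanh (√θ x + h)`. -/
def meanTanh (μ : Measure ℝ) (θ x : ℝ) : ℝ := ∫ h, Real.tanh (√θ * x + h) ∂μ

/-- `E sech² (√θ x + h)`. -/
def meanSechSq (μ : Measure ℝ) (θ x : ℝ) : ℝ := ∫ h, (Real.cosh (√θ * x + h) ^ 2)⁻¹ ∂μ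

/-- Asymptotic variance at a nondegenerate minimum `x` of `H`. -/
def gaussVar (μ : Measure ℝ) (θ x : ℝ) : ℝ :=
  (1 - θ * meanSechSq μ θ x ^ 2 - meanTanh μ θ x ^ 2) / (1 - θ * meanSechSq μ θ x) ^ 2

/-- `H` has flatness `τ` at `x₀`:
`H(x) = H(x₀) + H^{(2τ)}(x₀) (x - x₀)^{2τ} / (2τ)! + O((x - x₀)^{2τ+1})`, `H^{(2τ)}(x₀) > 0`. -/
def HasFlatness (μ : Measure ℝ) (θ x₀ : ℝ) (τ : ℕ) : Prop :=
  0 < iteratedDeriv (2 * τ) (H μ θ) x₀ ∧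
    (fun x => H μ θ x - H μ θ x₀
        - iteratedDeriv (2 * τ) (H μ θ) x₀ / (Nat.factorial (2 * τ)) * (x - x₀) ^ (2 * τ))
      =O[𝓝 x₀] fun x => (x - x₀) ^ (2 * τ + 1)

/-- The parameter `v` of the limit law at a minimum `x` of flatness `τ`. -/
def critVar (μ : Measure ℝ) (θ x : ℝ) (τ : ℕ) : ℝ :=
  (Nat.factorial (2 * τ - 1) : ℝ) ^ 2 * θ ^ (2 * τ)
      * ProbabilityTheory.variance (fun h => Real.tanh (√θ * x + h)) μ
      * meanSechSq μ θ x ^ (4 * τ - 2)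
    / iteratedDeriv (2 * τ) (H μ θ) x ^ 2

/-- The density `(2τ-1) x^{2τ-2} / √(2πv) · exp (-x^{4τ-2} / (2v))`. -/
def critDensity (τ : ℕ) (v x : ℝ) : ℝ :=
  (2 * τ - 1) * x ^ (2 * τ - 2) / √(2 * Real.pi * v) * Real.exp (-x ^ (4 * τ - 2) / (2 * v))

/-- `n^{-1/2} ∑ (σ_i - a)`. -/
def gaussScaled {n : ℕ} (a : ℝ) (σ : Config n) : ℝ :=
  (√(n : ℝ))⁻¹ * ∑ i, (spin σ i - a)

/-- `n^{-(4τ-3)/(4τ-2)} ∑ (σ_i - E σ_i)`. -/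
def critScaled (μ : Measure ℝ) (θ : ℝ) (τ : ℕ) {n : ℕ} (σ : Config n) : ℝ :=
  (n : ℝ) ^ (-((4 * τ - 3) / (4 * τ - 2)) : ℝ)
    * ∑ i, (spin σ i - expect μ θ Finset.univ fun σ' : Config n => spin σ' i)

end RFCW

end

set_option linter.unusedSectionVars false

namespace RFCW

/-! ### Calculus of `tanh` and `log cosh` -/

lemma inv_cosh_sq (z : ℝ) : (Real.cosh z ^ 2)⁻¹ = 1 - Real.tanh z ^ 2 := by
  have h := Real.cosh_pos z
  have h2 := Real.cosh_sq z
  rw [Real.tanh_eq_sinh_div_cosh]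
  field_simp
  linarith

lemma hasDerivAt_tanh (z : ℝ) : HasDerivAt Real.tanh (1 - Real.tanh z ^ 2) z := by
  have h := (Real.hasDerivAt_sinh z).div (Real.hasDerivAt_cosh z) (Real.cosh_pos z).ne'
  have e : Real.tanh = fun z => Real.sinh z / Real.cosh z :=
    funext Real.tanh_eq_sinh_div_cosh
  rw [e]
  refine h.congr_deriv ?_
  have h := Real.cosh_pos z
  field_simp

lemma continuous_tanh : Continuous Real.tanh :=
  continuous_iff_continuousAt.2 fun z => (hasDerivAt_tanh z).continuousAt

lemma abs_tanh_le_one (z : ℝ) : |Real.tanh z| ≤ 1 := (Real.abs_tanh_lt_one z).le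

lemma hasDerivAt_log_cosh (z : ℝ) :
    HasDerivAt (fun z => Real.log (Real.cosh z)) (Real.tanh z) z := by
  have h := (Real.hasDerivAt_cosh z).log (Real.cosh_pos z).ne'
  rwa [← Real.tanh_eq_sinh_div_cosh] at h

lemma abs_log_cosh_sub_le (y z : ℝ) :
    |Real.log (Real.cosh y) - Real.log (Real.cosh z)| ≤ |y - z| := by
  have := Convex.norm_image_sub_le_of_norm_hasDerivWithin_le (C := 1) (s := Set.univ)
    (f := fun z => Real.log (Real.cosh z)) (f' := Real.tanh) (x := z) (y := y)
    (fun x _ => (hasDerivAt_log_cosh x).hasDerivWithinAt)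
    (fun x _ => abs_tanh_le_one x) convex_univ trivial trivial
  simpa using this

lemma abs_log_cosh_le (z : ℝ) : |Real.log (Real.cosh z)| ≤ |z| := by
  simpa using abs_log_cosh_sub_le z 0

/-- The polynomial expressing the `k`-th derivative of `1 + tanh` through `tanh`. -/
noncomputable def tanhPoly : ℕ → Polynomial ℝ
  | 0 => 1 + Polynomial.X
  | k + 1 => (1 - Polynomial.X ^ 2) * (tanhPoly k).derivative

lemma hasDerivAt_eval_tanh (P : Polynomial ℝ) (z : ℝ) :
    HasDerivAt (fun z => P.eval (Real.tanh z))
      (((1 - Polynomial.X ^ 2) * P.derivative).eval (Real.tanh z)) z := by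
  refine ((P.hasDerivAt (Real.tanh z)).comp z (hasDerivAt_tanh z)).congr_deriv ?_
  simp; ring

lemma tanhPoly_eq (k : ℕ) : tanhPoly k = Polynomial.C ((-2) ^ k) * ((1 + Polynomial.X) *
    ∑ j ∈ Finset.range (k + 1), Polynomial.C ((Nat.factorial j : ℝ) / 2 ^ j *
      (Nat.stirlingSecond k j : ℝ)) * (Polynomial.X - 1) ^ j) := by
  induction k with
  | zero => simp [tanhPoly]
  | succ k ih =>
    rw [tanhPoly, ih]
    have e : ∀ j : ℕ, (1 - Polynomial.X ^ 2) * Polynomial.derivative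
        ((1 + Polynomial.X) * (Polynomial.X - 1 : Polynomial ℝ) ^ j) =
        -(1 + Polynomial.X) * (((j : Polynomial ℝ) + 1) * (Polynomial.X - 1) ^ (j + 1) +
          2 * (j : Polynomial ℝ) * (Polynomial.X - 1) ^ j) := by
      intro j
      rcases j with _ | j
      · simp; ring
      · simp only [Polynomial.derivative_mul, Polynomial.derivative_add, Polynomial.derivative_one,
          Polynomial.derivative_X, Polynomial.derivative_pow, Polynomial.derivative_sub]
        simp only [Nat.add_sub_cancel, map_natCast]
        push_cast
        ring
    have e2 : (1 - Polynomial.X ^ 2) * Polynomial.derivative (Polynomial.C ((-2 : ℝ) ^ k) *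
        ((1 + Polynomial.X) * ∑ j ∈ Finset.range (k + 1), Polynomial.C ((Nat.factorial j : ℝ) / 2 ^ j *
      (Nat.stirlingSecond k j : ℝ)) * (Polynomial.X - 1) ^ j)) =
      Polynomial.C ((-2 : ℝ) ^ k) * ∑ j ∈ Finset.range (k + 1), Polynomial.C ((Nat.factorial j : ℝ) /
        2 ^ j * (Nat.stirlingSecond k j : ℝ)) * (-(1 + Polynomial.X) * (((j : Polynomial ℝ) + 1) *
          (Polynomial.X - 1) ^ (j + 1) + 2 * (j : Polynomial ℝ) * (Polynomial.X - 1) ^ j)) := by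
      rw [Finset.mul_sum, Polynomial.derivative_C_mul, Polynomial.derivative_sum, Finset.mul_sum,
        Finset.mul_sum, Finset.mul_sum]
      refine Finset.sum_congr rfl fun j _ => ?_
      rw [← e j, mul_left_comm (1 + Polynomial.X), Polynomial.derivative_C_mul]
      ring
    rw [e2]
    have e3 : ∀ j : ℕ, Polynomial.C ((Nat.factorial j : ℝ) /
        2 ^ j * (Nat.stirlingSecond k j : ℝ)) * (-(1 + Polynomial.X) * (((j : Polynomial ℝ) + 1) *
          (Polynomial.X - 1) ^ (j + 1) + 2 * (j : Polynomial ℝ) * (Polynomial.X - 1) ^ j)) =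
        (Polynomial.C (-2 : ℝ) * (1 + Polynomial.X)) *
        (Polynomial.C ((Nat.factorial (j + 1) : ℝ) / 2 ^ (j + 1) * (Nat.stirlingSecond k j : ℝ)) *
          (Polynomial.X - 1) ^ (j + 1) +
         Polynomial.C ((Nat.factorial j : ℝ) / 2 ^ j * (j * Nat.stirlingSecond k j : ℝ)) *
          (Polynomial.X - 1) ^ j) := by
      intro j
      rw [Nat.factorial_succ]
      have : (Polynomial.C ((((j + 1) * j.factorial : ℕ) : ℝ) / 2 ^ (j + 1) *
          (Nat.stirlingSecond k j : ℝ)) : Polynomial ℝ) = Polynomial.C (1 / 2) *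
          (((j : Polynomial ℝ) + 1) * Polynomial.C ((Nat.factorial j : ℝ) / 2 ^ j *
          (Nat.stirlingSecond k j : ℝ))) := by
        have h1 : ((j : Polynomial ℝ) + 1) = Polynomial.C ((j : ℝ) + 1) := by simp
        rw [h1, ← Polynomial.C_mul, ← Polynomial.C_mul]
        congr 1
        push_cast
        rw [pow_succ]
        field_simp
      rw [this]
      have h2 : (Polynomial.C ((Nat.factorial j : ℝ) / 2 ^ j * (j * Nat.stirlingSecond k j : ℝ))
          : Polynomial ℝ) = (j : Polynomial ℝ) * Polynomial.C ((Nat.factorial j : ℝ) / 2 ^ j *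
          (Nat.stirlingSecond k j : ℝ)) := by
        have h1 : (j : Polynomial ℝ) = Polynomial.C (j : ℝ) := by simp
        rw [h1, ← Polynomial.C_mul]
        congr 1; ring
      rw [h2]
      have h3 : (Polynomial.C (-2 : ℝ)) = -2 := by rw [Polynomial.C_neg, map_ofNat]
      have h4 : (2 : Polynomial ℝ) * Polynomial.C (1 / 2 : ℝ) = 1 := by
        rw [show (2 : Polynomial ℝ) = Polynomial.C 2 from (map_ofNat Polynomial.C 2).symm, ← Polynomial.C_mul]; norm_num
      rw [h3]
      generalize Polynomial.C ((Nat.factorial j : ℝ) / 2 ^ j * (Nat.stirlingSecond k j : ℝ)) = c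
      generalize Polynomial.C (1 / 2 : ℝ) = d at h4
      linear_combination (c * (1 + Polynomial.X) * ((j : Polynomial ℝ) + 1) *
        (Polynomial.X - 1) ^ (j + 1)) * h4
    simp_rw [e3]
    rw [← Finset.mul_sum, pow_succ, Polynomial.C_mul, mul_assoc, mul_assoc]
    congr 3
    rw [Finset.sum_add_distrib, Finset.sum_range_succ' _ (k + 1)]
    have h5 := Finset.sum_range_succ' (fun j => (Polynomial.C ((Nat.factorial j : ℝ) / 2 ^ j *
      (j * Nat.stirlingSecond k j : ℝ)) * (Polynomial.X - 1) ^ j : Polynomial ℝ)) (k + 1)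
    rw [Finset.sum_range_succ, Nat.stirlingSecond_eq_zero_of_lt (Nat.lt_succ_self k)] at h5
    simp only [Nat.cast_zero, mul_zero, Polynomial.C_0, zero_mul, add_zero] at h5
    rw [h5, ← Finset.sum_add_distrib]
    simp only [Nat.stirlingSecond_succ_zero, Nat.cast_zero, mul_zero, Polynomial.C_0, zero_mul,
      add_zero]
    refine Finset.sum_congr rfl fun j _ => ?_
    rw [Nat.stirlingSecond_succ_succ, ← add_mul, ← Polynomial.C_add]
    congr 2
    push_cast
    ring

lemma exists_abs_eval_tanh_le (P : Polynomial ℝ) :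
    ∃ C : ℝ, ∀ z, |P.eval (Real.tanh z)| ≤ C := by
  obtain ⟨C, hC⟩ := (isCompact_Icc (a := (-1 : ℝ)) (b := 1)).exists_bound_of_continuousOn
    P.continuous.continuousOn
  exact ⟨C, fun z => hC _ (abs_le.1 (abs_tanh_le_one z))⟩

/-! ### Derivatives of `H` -/

/-- Differentiation under the integral sign for averages of shifted functions with bounded
derivative. -/
lemma hasDerivAt_integral_shift {μ : Measure ℝ} [IsFiniteMeasure μ] (c : ℝ) {φ φ' : ℝ → ℝ}
    {C : ℝ} (hφ : ∀ z, HasDerivAt φ (φ' z) z) (hφ' : Continuous φ') (hC : ∀ z, |φ' z| ≤ C)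
    (hΦi : ∀ y, Integrable (fun h => φ (c * y + h)) μ) (x : ℝ) :
    HasDerivAt (fun y => ∫ h, φ (c * y + h) ∂μ) (c * ∫ h, φ' (c * x + h) ∂μ) x := by
  have hcont : Continuous φ := continuous_iff_continuousAt.2 fun z => (hφ z).continuousAt
  have := hasDerivAt_integral_of_dominated_loc_of_deriv_le (μ := μ) (s := Set.univ)
    (F := fun y h => φ (c * y + h)) (F' := fun y h => c * φ' (c * y + h)) (x₀ := x)
    (bound := fun _ => |c| * C) Filter.univ_mem
    (Eventually.of_forall fun y => (by fun_prop : Continuous fun h => φ (c * y + h)).aestronglyMeasurable)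
    (hΦi x) (by fun_prop : Continuous fun h => c * φ' (c * x + h)).aestronglyMeasurable
    (Eventually.of_forall fun h y _ => by
      rw [Real.norm_eq_abs, abs_mul]; exact mul_le_mul_of_nonneg_left (hC _) (abs_nonneg _))
    (integrable_const _)
    (Eventually.of_forall fun h y _ => by
      have h1 : HasDerivAt (fun y => c * y + h) c y := by
        simpa using ((hasDerivAt_id y).const_mul c).add_const h
      exact ((hφ (c * y + h)).comp y h1).congr_deriv (by ring))
  simpa [integral_const_mul] using this.2

lemma integrable_of_continuous_bounded {α : Type*} [TopologicalSpace α] [MeasurableSpace α]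
    [OpensMeasurableSpace α] [SecondCountableTopology α] {μ : Measure α} [IsFiniteMeasure μ] {f : α → ℝ}
    (hf : Continuous f) {C : ℝ} (hC : ∀ x, |f x| ≤ C) : Integrable f μ :=
  Integrable.of_bound hf.aestronglyMeasurable C (Eventually.of_forall hC)

section Derivatives

variable {μ : Measure ℝ} {θ : ℝ}

lemma meanTanh_eq (x : ℝ) :
    meanTanh μ θ x = ∫ h, (Polynomial.X : Polynomial ℝ).eval (Real.tanh (√θ * x + h)) ∂μ := by
  simp [meanTanh]

lemma meanSechSq_eq (x : ℝ) :
    meanSechSq μ θ x =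
      ∫ h, (1 - Polynomial.X ^ 2 : Polynomial ℝ).eval (Real.tanh (√θ * x + h)) ∂μ := by
  simp [meanSechSq, inv_cosh_sq]

variable [IsProbabilityMeasure μ]

lemma integrable_eval_tanh (P : Polynomial ℝ) (c : ℝ) :
    Integrable (fun h => P.eval (Real.tanh (c + h))) μ := by
  obtain ⟨C, hC⟩ := exists_abs_eval_tanh_le P
  exact integrable_of_continuous_bounded
    (P.continuous.comp (continuous_tanh.comp (by fun_prop))) fun h => hC _

lemma hasDerivAt_integral_eval_tanh (P : Polynomial ℝ) (x : ℝ) :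
    HasDerivAt (fun y => ∫ h, P.eval (Real.tanh (√θ * y + h)) ∂μ)
      (√θ * ∫ h, ((1 - Polynomial.X ^ 2) * P.derivative).eval (Real.tanh (√θ * x + h)) ∂μ) x := by
  obtain ⟨C, hC⟩ := exists_abs_eval_tanh_le ((1 - Polynomial.X ^ 2) * P.derivative)
  exact hasDerivAt_integral_shift (√θ) (hasDerivAt_eval_tanh P)
    ((Polynomial.continuous _).comp continuous_tanh) hC (fun y => integrable_eval_tanh P _) x

lemma hasDerivAt_meanTanh (x : ℝ) :
    HasDerivAt (meanTanh μ θ) (√θ * meanSechSq μ θ x) x := by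
  have h := hasDerivAt_integral_eval_tanh (μ := μ) (θ := θ) Polynomial.X x
  rw [show meanTanh μ θ = _ from funext meanTanh_eq, meanSechSq_eq]
  simpa using h

lemma hasDerivAt_meanSechSq (x : ℝ) :
    HasDerivAt (meanSechSq μ θ) (√θ * ∫ h, (-2 * Real.tanh (√θ * x + h) *
      (1 - Real.tanh (√θ * x + h) ^ 2)) ∂μ) x := by
  have h := hasDerivAt_integral_eval_tanh (μ := μ) (θ := θ) (1 - Polynomial.X ^ 2) x
  rw [show meanSechSq μ θ = _ from funext meanSechSq_eq]
  refine h.congr_deriv ?_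
  congr 2
  ext h
  simp [Polynomial.derivative_pow]
  ring

lemma integrable_log_cosh (hμ : Integrable (fun h : ℝ => h) μ) (c : ℝ) :
    Integrable (fun h => Real.log (Real.cosh (c + h))) μ := by
  have hc : Continuous fun h => Real.log (Real.cosh (c + h)) :=
    (continuous_iff_continuousAt.2 fun z => (hasDerivAt_log_cosh z).continuousAt).comp
      (by fun_prop : Continuous fun h : ℝ => c + h)
  refine Integrable.mono' ((integrable_const |c|).add hμ.abs) hc.aestronglyMeasurable
    (Eventually.of_forall fun h => ?_)
  exact (abs_log_cosh_le _).trans (abs_add_le _ _)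

lemma hasDerivAt_H (hμ : Integrable (fun h : ℝ => h) μ) (x : ℝ) :
    HasDerivAt (H μ θ) (x - √θ * meanTanh μ θ x) x := by
  have h1 := hasDerivAt_integral_shift (μ := μ) (√θ) hasDerivAt_log_cosh continuous_tanh
    abs_tanh_le_one (fun y => integrable_log_cosh hμ _) x
  have h2 : HasDerivAt (fun x : ℝ => x ^ 2 / 2) x x :=
    ((hasDerivAt_pow 2 x).div_const 2).congr_deriv (by simp)
  exact h2.sub h1

lemma hasDerivAt_slope (x : ℝ) (hθ : 0 < θ) :
    HasDerivAt (fun x => x - √θ * meanTanh μ θ x) (1 - θ * meanSechSq μ θ x) x := by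
  refine ((hasDerivAt_id x).sub ((hasDerivAt_meanTanh x).const_mul (√θ))).congr_deriv ?_
  rw [← mul_assoc, Real.mul_self_sqrt hθ.le]

lemma hasDerivAt_curvature (x : ℝ) :
    ∃ d : ℝ, |d| ≤ |θ| * √θ * 2 ∧ HasDerivAt (fun x => 1 - θ * meanSechSq μ θ x) d x := by
  refine ⟨_, ?_, ((hasDerivAt_meanSechSq x).const_mul θ).const_sub 1⟩
  rw [abs_neg, abs_mul, abs_mul, abs_of_nonneg (Real.sqrt_nonneg θ), mul_assoc]
  gcongr
  rw [← Real.norm_eq_abs]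
  refine le_trans (norm_integral_le_of_norm_le_const (C := 2) (Eventually.of_forall fun h => ?_))
    (by simp)
  have h1 := abs_tanh_le_one (√θ * x + h)
  have h2 : |1 - Real.tanh (√θ * x + h) ^ 2| ≤ 1 := by
    rw [abs_le]
    have := Real.tanh_sq_lt_one (√θ * x + h)
    constructor <;> nlinarith [sq_nonneg (Real.tanh (√θ * x + h))]
  rw [Real.norm_eq_abs, abs_mul, abs_mul]
  norm_num
  nlinarith [abs_nonneg (Real.tanh (√θ * x + h)), abs_nonneg (1 - Real.tanh (√θ * x + h) ^ 2)]

lemma iteratedDeriv_H (hμ : Integrable (fun h : ℝ => h) μ) (hθ : 0 < θ) (k : ℕ) :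
    iteratedDeriv (k + 3) (H μ θ) = fun x =>
      -(√θ ^ (k + 3) * ∫ h, (tanhPoly (k + 2)).eval (Real.tanh (√θ * x + h)) ∂μ) := by
  induction k with
  | zero =>
    rw [iteratedDeriv_succ, iteratedDeriv_succ, iteratedDeriv_succ, iteratedDeriv_zero,
      show deriv (H μ θ) = _ from funext fun x => (hasDerivAt_H hμ x).deriv,
      show deriv (fun x => x - √θ * meanTanh μ θ x) = _ from
        funext fun x => (hasDerivAt_slope x hθ).deriv]
    ext x
    have h := hasDerivAt_integral_eval_tanh (μ := μ) (θ := θ) (1 - Polynomial.X ^ 2) x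
    have h' := (h.const_mul θ).const_sub 1
    have e : (fun x => 1 - θ * meanSechSq μ θ x) = fun x => 1 - θ *
      ∫ h, (1 - Polynomial.X ^ 2 : Polynomial ℝ).eval (Real.tanh (√θ * x + h)) ∂μ :=
      funext fun x => by rw [meanSechSq_eq]
    rw [e, h'.deriv]
    have e2 : tanhPoly (0 + 2) = (1 - Polynomial.X ^ 2) *
      Polynomial.derivative (1 - Polynomial.X ^ 2) := by
      simp [tanhPoly]
    rw [e2, ← mul_assoc, show √θ ^ (0 + 3) = θ * √θ by
      rw [zero_add, pow_succ, Real.sq_sqrt hθ.le]]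
  | succ k ih =>
    rw [iteratedDeriv_succ, ih]
    ext x
    have h := hasDerivAt_integral_eval_tanh (μ := μ) (θ := θ) (tanhPoly (k + 2)) x
    rw [deriv.fun_neg, (h.const_mul (√θ ^ (k + 3))).deriv, ← mul_assoc, ← pow_succ]
    rfl

lemma iteratedDeriv_H_stirling (hμ : Integrable (fun h : ℝ => h) μ) (hθ : 0 < θ) (x : ℝ) {τ : ℕ}
    (hτ : 2 ≤ τ) : iteratedDeriv (2 * τ) (H μ θ) x =
        2 ^ (2 * τ - 1) * θ ^ τ * ∫ h, (1 + Real.tanh (√θ * x + h)) *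
          ∑ k ∈ Finset.range (2 * τ), (Nat.factorial k : ℝ) / 2 ^ k *
            (Nat.stirlingSecond (2 * τ - 1) k : ℝ) * (Real.tanh (√θ * x + h) - 1) ^ k ∂μ := by
  obtain ⟨k, rfl⟩ := Nat.exists_eq_add_of_le hτ
  have h := iteratedDeriv_H (μ := μ) hμ hθ (2 * k + 1)
  rw [show 2 * (2 + k) = 2 * k + 1 + 3 by ring, h]
  simp only [tanhPoly_eq]
  rw [show 2 * k + 1 + 3 - 1 = 2 * k + 1 + 2 by omega]
  simp only [Polynomial.eval_mul, Polynomial.eval_C, Polynomial.eval_add, Polynomial.eval_one,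
    Polynomial.eval_X, Polynomial.eval_finsetSum, Polynomial.eval_pow, Polynomial.eval_sub]
  rw [integral_const_mul, show (-2 : ℝ) ^ (2 * k + 1 + 2) = - 2 ^ (2 * k + 1 + 2) from
    Odd.neg_pow ⟨k + 1, by ring⟩ 2, show √θ ^ (2 * k + 1 + 3) = θ ^ (2 + k) by
      rw [show 2 * k + 1 + 3 = 2 * (2 + k) by ring, pow_mul, Real.sq_sqrt hθ.le]]
  ring

lemma slope_eq_zero_of_isMin (hμ : Integrable (fun h : ℝ => h) μ) {x₀ : ℝ}
    (h : ∀ x, H μ θ x₀ ≤ H μ θ x) : x₀ = √θ * meanTanh μ θ x₀ :=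
  sub_eq_zero.1 <| IsLocalMin.hasDerivAt_eq_zero (Eventually.of_forall h) (hasDerivAt_H hμ x₀)

end Derivatives

/-! ### The shape of `H` near a minimum -/

lemma abs_sub_le_of_hasDerivAt {f f' : ℝ → ℝ} (hf : ∀ w, HasDerivAt f (f' w) w) {x y M : ℝ}
    (h : ∀ w, |w - x| ≤ |y - x| → |f' w| ≤ M) : |f y - f x| ≤ M * |y - x| := by
  have := Convex.norm_image_sub_le_of_norm_hasDerivWithin_le (C := M)
    (s := Metric.closedBall x |y - x|) (f := f) (f' := f') (x := x) (y := y)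
    (fun w _ => (hf w).hasDerivWithinAt)
    (fun w hw => h w (by simpa [Real.dist_eq] using hw)) (convex_closedBall _ _)
    (by simp) (by simp [Real.dist_eq])
  simpa using this

/-- A function with expansion `f x₁ + c (x - x₁) ^ (2 τ) + O((x - x₁) ^ (2 τ + 1))` whose minimum
over a closed set is attained only at `x₁` grows at least like `(x - x₁) ^ (2 τ)` on compacts. -/
lemma exists_pow_le_sub_of_expansion {f : ℝ → ℝ} (hf : Continuous f) {x₁ c : ℝ} {τ : ℕ}
    (hc : 0 < c)
    (hloc : (fun x => f x - f x₁ - c * (x - x₁) ^ (2 * τ)) =O[𝓝 x₁]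
      fun x => (x - x₁) ^ (2 * τ + 1))
    {S : Set ℝ} (hS : IsClosed S) (hmin : ∀ x ∈ S, x ≠ x₁ → f x₁ < f x) (B : ℝ) :
    ∃ c' : ℝ, 0 < c' ∧ ∀ x ∈ S, |x - x₁| ≤ B → c' * |x - x₁| ^ (2 * τ) ≤ f x - f x₁ := by
  obtain ⟨C, hCpos, hC⟩ := hloc.exists_pos
  obtain ⟨δ, hδ, hball⟩ := Metric.eventually_nhds_iff.1 hC.bound
  set ρ := min (δ / 2) (c / (2 * C)) with hρ
  have hρpos : 0 < ρ := by positivity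
  have near : ∀ x, |x - x₁| ≤ ρ → c / 2 * |x - x₁| ^ (2 * τ) ≤ f x - f x₁ := by
    intro x hx
    have h1 := hball (y := x) (by
      rw [Real.dist_eq]
      calc _ ≤ δ / 2 := hx.trans (min_le_left _ _)
        _ < δ := by linarith)
    rw [Real.norm_eq_abs, norm_pow, Real.norm_eq_abs, pow_succ] at h1
    have h2 : C * |x - x₁| ≤ c / 2 := by
      have := hx.trans (min_le_right _ _)
      rw [le_div_iff₀ (by positivity)] at this
      linarith
    have h3 : (x - x₁) ^ (2 * τ) = |x - x₁| ^ (2 * τ) := by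
      rw [Even.pow_abs ⟨τ, by ring⟩]
    have h4 := (abs_le.1 h1).1
    rw [h3] at h4
    have h5 : 0 ≤ |x - x₁| ^ (2 * τ) := by positivity
    nlinarith
  have hK : IsCompact (S ∩ {x | ρ ≤ |x - x₁|} ∩ Metric.closedBall x₁ B) :=
    (isCompact_closedBall _ _).inter_left
      (hS.inter (isClosed_le continuous_const (by fun_prop)))
  rcases (S ∩ {x | ρ ≤ |x - x₁|} ∩ Metric.closedBall x₁ B).eq_empty_or_nonempty with he | hne
  · refine ⟨c / 2, by positivity, fun x hxS hxB => near x ?_⟩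
    by_contra hx
    exact (Set.eq_empty_iff_forall_notMem.1 he x)
      ⟨⟨hxS, (not_le.1 hx).le⟩, by simpa [Real.dist_eq] using hxB⟩
  · obtain ⟨w, hw, hwmin⟩ := hK.exists_isMinOn hne hf.continuousOn
    have hη : 0 < f w - f x₁ := by
      refine sub_pos.2 (hmin w hw.1.1 fun h => ?_)
      have : ρ ≤ |w - x₁| := hw.1.2
      simp [h] at this
      linarith
    have hB : 0 ≤ B := (abs_nonneg _).trans (by simpa [Real.dist_eq] using hw.2)
    refine ⟨min (c / 2) ((f w - f x₁) / (B ^ (2 * τ) + 1)), by positivity, fun x hxS hxB => ?_⟩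
    rcases le_total |x - x₁| ρ with hx | hx
    · exact (mul_le_mul_of_nonneg_right (min_le_left _ _) (by positivity)).trans (near x hx)
    · have h1 : f w ≤ f x := hwmin ⟨⟨hxS, hx⟩, by simpa [Real.dist_eq] using hxB⟩
      have h2 : |x - x₁| ^ (2 * τ) ≤ B ^ (2 * τ) := by gcongr
      calc _ ≤ (f w - f x₁) / (B ^ (2 * τ) + 1) * (B ^ (2 * τ) + 1) := by
            gcongr
            · exact min_le_right _ _
            · linarith
        _ = f w - f x₁ := by field_simp
        _ ≤ _ := by linarith

section Shape

variable {μ : Measure ℝ} {θ : ℝ} [IsProbabilityMeasure μ]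

lemma continuous_H (hμ : Integrable (fun h : ℝ => h) μ) : Continuous (H μ θ) :=
  continuous_iff_continuousAt.2 fun x => (hasDerivAt_H hμ x).continuousAt

lemma meanSechSq_mem (x : ℝ) : 0 ≤ meanSechSq μ θ x ∧ meanSechSq μ θ x ≤ 1 := by
  refine ⟨integral_nonneg fun h => by positivity, ?_⟩
  have h1 : ∀ h, (Real.cosh (√θ * x + h) ^ 2)⁻¹ ≤ 1 := fun h => by
    rw [inv_cosh_sq]; nlinarith [sq_nonneg (Real.tanh (√θ * x + h))]
  have := integral_mono_of_nonneg (μ := μ) (f := fun h => (Real.cosh (√θ * x + h) ^ 2)⁻¹)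
    (g := fun _ => 1) (Eventually.of_forall fun h => by positivity) (integrable_const _)
    (Eventually.of_forall h1)
  simpa [meanSechSq] using this

lemma abs_H_sub_le (hμ : Integrable (fun h : ℝ => h) μ) (hθ : 0 < θ) {x₁ : ℝ}
    (hx : x₁ = √θ * meanTanh μ θ x₁) (y : ℝ) :
    |H μ θ y - H μ θ x₁| ≤ (1 + θ) * |y - x₁| ^ 2 := by
  have h1 : ∀ w, |w - √θ * meanTanh μ θ w| ≤ (1 + θ) * |w - x₁| := by
    intro w
    have := abs_sub_le_of_hasDerivAt (f := fun x => x - √θ * meanTanh μ θ x)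
      (fun w => hasDerivAt_slope w hθ) (x := x₁) (y := w) (M := 1 + θ) (fun w _ => by
        obtain ⟨h0, h1⟩ := meanSechSq_mem (μ := μ) (θ := θ) w
        rw [abs_le]; constructor <;> nlinarith)
    simpa [sub_eq_zero.2 hx] using this
  have := abs_sub_le_of_hasDerivAt (hasDerivAt_H (θ := θ) hμ) (x := x₁) (y := y)
    (M := (1 + θ) * |y - x₁|) (fun w hw => (h1 w).trans (by gcongr))
  rwa [mul_assoc, ← sq] at this

lemma abs_H_sub_quadratic_le (hμ : Integrable (fun h : ℝ => h) μ) (hθ : 0 < θ) {x₁ : ℝ}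
    (hx : x₁ = √θ * meanTanh μ θ x₁) (y : ℝ) :
    |H μ θ y - H μ θ x₁ - (1 - θ * meanSechSq μ θ x₁) / 2 * (y - x₁) ^ 2| ≤
      θ * √θ * 2 * |y - x₁| ^ 3 := by
  have h0 : ∀ w, |(1 - θ * meanSechSq μ θ w) - (1 - θ * meanSechSq μ θ x₁)| ≤
      θ * √θ * 2 * |w - x₁| := by
    intro w
    choose d hd hd' using hasDerivAt_curvature (μ := μ) (θ := θ)
    rw [abs_of_pos hθ] at hd
    exact abs_sub_le_of_hasDerivAt hd' fun w _ => hd w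
  have h1 : ∀ w, |w - √θ * meanTanh μ θ w - (1 - θ * meanSechSq μ θ x₁) * (w - x₁)| ≤
      θ * √θ * 2 * |w - x₁| ^ 2 := by
    intro w
    have := abs_sub_le_of_hasDerivAt
      (f := fun w => w - √θ * meanTanh μ θ w - (1 - θ * meanSechSq μ θ x₁) * (w - x₁))
      (fun w => (hasDerivAt_slope w hθ).sub
        (((hasDerivAt_id w).sub_const x₁).const_mul (1 - θ * meanSechSq μ θ x₁)))
      (x := x₁) (y := w) (M := θ * √θ * 2 * |w - x₁|) (fun v hv => by
        simp only [mul_one]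
        exact (h0 v).trans (by gcongr))
    simpa [sub_eq_zero.2 hx, mul_assoc, ← sq] using this
  have := abs_sub_le_of_hasDerivAt
    (f := fun w => H μ θ w - (1 - θ * meanSechSq μ θ x₁) / 2 * (w - x₁) ^ 2)
    (f' := fun w => w - √θ * meanTanh μ θ w - (1 - θ * meanSechSq μ θ x₁) * (w - x₁))
    (fun w => ((hasDerivAt_H (θ := θ) hμ w).sub
      ((((hasDerivAt_id w).sub_const x₁).pow 2).const_mul
        ((1 - θ * meanSechSq μ θ x₁) / 2))).congr_deriv (by simp; ring))
    (x := x₁) (y := y) (M := θ * √θ * 2 * |y - x₁| ^ 2) (fun v hv => by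
      exact (h1 v).trans (by gcongr))
  calc _ = |H μ θ y - (1 - θ * meanSechSq μ θ x₁) / 2 * (y - x₁) ^ 2 -
        (H μ θ x₁ - (1 - θ * meanSechSq μ θ x₁) / 2 * (x₁ - x₁) ^ 2)| := by congr 1; ring
    _ ≤ _ := this
    _ = _ := by ring

lemma H_expansion_of_nondegenerate (hμ : Integrable (fun h : ℝ => h) μ) (hθ : 0 < θ) {x₁ : ℝ}
    (hx : x₁ = √θ * meanTanh μ θ x₁) :
    (fun x => H μ θ x - H μ θ x₁ - (1 - θ * meanSechSq μ θ x₁) / 2 * (x - x₁) ^ (2 * 1)) =O[𝓝 x₁]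
      fun x => (x - x₁) ^ (2 * 1 + 1) :=
  IsBigO.of_bound (θ * √θ * 2) (Eventually.of_forall fun y => by
    simpa [norm_pow] using abs_H_sub_quadratic_le hμ hθ hx y)

lemma theta_mul_meanSechSq_eq_one (hμ : Integrable (fun h : ℝ => h) μ) (hθ : 0 < θ) {x₁ : ℝ}
    (hx : x₁ = √θ * meanTanh μ θ x₁) {τ : ℕ} (hτ : 2 ≤ τ) (hflat : HasFlatness μ θ x₁ τ) :
    θ * meanSechSq μ θ x₁ = 1 := by
  have t0 : Tendsto (fun x => x - x₁) (𝓝 x₁) (𝓝 0) := by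
    have : Continuous fun x : ℝ => x - x₁ := by fun_prop
    simpa using this.tendsto x₁
  have hpow : ∀ k, 3 ≤ k → (fun x => (x - x₁) ^ k) =O[𝓝 x₁] fun x => (x - x₁) ^ 3 := fun k hk =>
    IsBigO.of_bound 1 (by
      filter_upwards [Metric.ball_mem_nhds x₁ one_pos] with x hx
      rw [Metric.mem_ball, Real.dist_eq] at hx
      rw [norm_pow, norm_pow, one_mul, Real.norm_eq_abs]
      exact pow_le_pow_of_le_one (abs_nonneg _) hx.le hk)
  have h1 := H_expansion_of_nondegenerate hμ hθ hx
  have h2 := hflat.2.trans (hpow _ (by omega))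
  have h3 := ((hpow (2 * τ) (by omega)).const_mul_left
    (iteratedDeriv (2 * τ) (H μ θ) x₁ / (Nat.factorial (2 * τ)))).add h2
  have h4 := h3.sub h1
  obtain ⟨C, hC⟩ := h4.bound
  have h5 : ∀ᶠ x in 𝓝[>] x₁, |(1 - θ * meanSechSq μ θ x₁) / 2| ≤ C * (x - x₁) := by
    filter_upwards [nhdsWithin_le_nhds hC, self_mem_nhdsWithin] with x hx hx'
    have hpos : 0 < x - x₁ := sub_pos.2 hx'
    have e : ∀ a b c d : ℝ, a + (b - c - a) - (b - c - d) = d := fun a b c d => by ring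
    rw [e, norm_mul, norm_pow, norm_pow, Real.norm_of_nonneg hpos.le, Real.norm_eq_abs] at hx
    have h6 : |(1 - θ * meanSechSq μ θ x₁) / 2| * (x - x₁) ^ 2 ≤ C * (x - x₁) * (x - x₁) ^ 2 := by
      calc _ ≤ _ := hx
        _ = _ := by ring
    exact le_of_mul_le_mul_right h6 (by positivity)
  have h6 : Tendsto (fun x => C * (x - x₁)) (𝓝[>] x₁) (𝓝 0) := by
    simpa using (t0.const_mul C).mono_left nhdsWithin_le_nhds
  have h7 := ge_of_tendsto h6 h5
  have h8 := abs_eq_zero.1 (le_antisymm h7 (abs_nonneg _))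
  linarith

lemma variance_tanh_eq (x : ℝ) :
    ProbabilityTheory.variance (fun h => Real.tanh (√θ * x + h)) μ =
      1 - meanSechSq μ θ x - meanTanh μ θ x ^ 2 := by
  have hc : Continuous fun h => Real.tanh (√θ * x + h) := continuous_tanh.comp (by fun_prop)
  have hm : MemLp (fun h => Real.tanh (√θ * x + h)) 2 μ :=
    MemLp.of_bound hc.aestronglyMeasurable 1 (Eventually.of_forall fun h => abs_tanh_le_one _)
  rw [ProbabilityTheory.variance_eq_sub hm]
  have : meanSechSq μ θ x = 1 - ∫ h, Real.tanh (√θ * x + h) ^ 2 ∂μ := by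
    simp only [meanSechSq, inv_cosh_sq]
    rw [integral_sub (integrable_const _) hm.integrable_sq]
    simp
  rw [this]
  simp [meanTanh]

end Shape

/-! ### Linearization of the quadratic interaction -/

section Linearization

variable {n : ℕ} {θ : ℝ}

/-- The empirical counterpart of `H` for the field `h`. -/
noncomputable def empH (θ : ℝ) (h : Fin n → ℝ) (y : ℝ) : ℝ :=
  y ^ 2 / 2 - (∑ i, Real.log (Real.cosh (√θ * y + h i))) / n

/-- Joint density of a configuration and an auxiliary Gaussian variable with mean `√θ m` and
variance `1 / n`, with respect to the Gibbs weight. -/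
noncomputable def joint (θ : ℝ) (h : Fin n → ℝ) (σ : Config n) (y : ℝ) : ℝ :=
  √(n / (2 * Real.pi)) *
    Real.exp (-n * y ^ 2 / 2 + √θ * y * totalSpin σ + ∑ i, h i * spin σ i)

lemma spin_eq (σ : Config n) (i : Fin n) : spin σ i = 1 ∨ spin σ i = -1 := by
  rcases Int.units_eq_one_or (σ i) with h | h <;> simp [spin, h]

lemma abs_totalSpin_le (σ : Config n) : |totalSpin σ| ≤ n := by
  refine (Finset.abs_sum_le_sum_abs _ _).trans ?_
  have : ∀ i, |spin σ i| = 1 := fun i => by rcases spin_eq σ i with h | h <;> simp [h]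
  simp [this]

lemma weight_pos (θ : ℝ) (h : Fin n → ℝ) (σ : Config n) : 0 < weight θ h σ := Real.exp_pos _

lemma joint_nonneg (θ : ℝ) (h : Fin n → ℝ) (σ : Config n) (y : ℝ) : 0 ≤ joint θ h σ y := by
  unfold joint; positivity

lemma continuous_joint (θ : ℝ) (h : Fin n → ℝ) (σ : Config n) : Continuous (joint θ h σ) := by
  unfold joint; fun_prop

lemma continuous_empH (θ : ℝ) (h : Fin n → ℝ) : Continuous (empH θ h) := by
  have : Continuous fun z => Real.log (Real.cosh z) :=
    continuous_iff_continuousAt.2 fun z => (hasDerivAt_log_cosh z).continuousAt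
  exact (by fun_prop : Continuous fun y : ℝ => y ^ 2 / 2).sub
    ((continuous_finsetSum _ fun i _ =>
      this.comp (by fun_prop : Continuous fun y : ℝ => √θ * y + h i)).div_const _)

lemma joint_eq (hθ : 0 < θ) (hn : 0 < n) (h : Fin n → ℝ) (σ : Config n) (y : ℝ) :
    joint θ h σ y = weight θ h σ * (√(n / (2 * Real.pi)) *
      Real.exp (-(n / 2) * (y - √θ * totalSpin σ / n) ^ 2)) := by
  unfold joint weight
  rw [mul_left_comm, ← Real.exp_add]
  congr 2
  have hn' : (n : ℝ) ≠ 0 := by positivity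
  have := Real.sq_sqrt hθ.le
  field_simp
  linear_combination (totalSpin σ ^ 2) * this

lemma integrable_gaussian_shift {b : ℝ} (hb : 0 < b) (c : ℝ) :
    Integrable fun y : ℝ => Real.exp (-b * (y - c) ^ 2) :=
  (integrable_exp_neg_mul_sq hb).comp_sub_right c

lemma integral_gaussian_shift (b c : ℝ) :
    ∫ y : ℝ, Real.exp (-b * (y - c) ^ 2) = √(Real.pi / b) := by
  rw [integral_sub_right_eq_self (fun y : ℝ => Real.exp (-b * y ^ 2)) c, integral_gaussian]

lemma integral_normalized_gaussian (hn : 0 < n) (c : ℝ) :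
    ∫ y : ℝ, √(n / (2 * Real.pi)) * Real.exp (-(n / 2 : ℝ) * (y - c) ^ 2) = 1 := by
  rw [integral_const_mul, integral_gaussian_shift, ← Real.sqrt_mul (by positivity)]
  rw [Real.sqrt_eq_one]
  have := Real.pi_pos
  field_simp

lemma integrable_joint (hθ : 0 < θ) (hn : 0 < n) (h : Fin n → ℝ) (σ : Config n) :
    Integrable (joint θ h σ) := by
  rw [show joint θ h σ = _ from funext (joint_eq hθ hn h σ)]
  exact ((integrable_gaussian_shift (by positivity) _).const_mul _).const_mul _

lemma integral_joint (hθ : 0 < θ) (hn : 0 < n) (h : Fin n → ℝ) (σ : Config n) :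
    ∫ y, joint θ h σ y = weight θ h σ := by
  simp_rw [joint_eq hθ hn h σ]
  rw [integral_const_mul, integral_normalized_gaussian hn, mul_one]

lemma sum_exp_spin (c : Fin n → ℝ) :
    ∑ σ : Config n, Real.exp (∑ i, c i * spin σ i) = ∏ i, (2 * Real.cosh (c i)) := by
  have h1 : ∀ i, 2 * Real.cosh (c i) = ∑ s : ℤˣ, Real.exp (c i * ((s : ℤ) : ℝ)) := by
    intro i
    rw [Real.cosh_eq, show (Finset.univ : Finset ℤˣ) = {1, -1} from rfl,
      Finset.sum_pair (by decide)]
    simp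
    ring
  simp_rw [h1, Finset.prod_univ_sum, Fintype.piFinset_univ, Real.exp_sum]
  rfl

lemma prod_cosh_eq (hn : 0 < n) (h : Fin n → ℝ) (y : ℝ) :
    Real.exp (-n * y ^ 2 / 2) * ∏ i, (2 * Real.cosh (√θ * y + h i)) =
      2 ^ n * Real.exp (-n * empH θ h y) := by
  have h1 : ∏ i, Real.cosh (√θ * y + h i) =
      Real.exp (∑ i, Real.log (Real.cosh (√θ * y + h i))) := by
    rw [Real.exp_sum]
    exact Finset.prod_congr rfl fun i _ => (Real.exp_log (Real.cosh_pos _)).symm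
  rw [Finset.prod_mul_distrib, h1, Finset.prod_const, Finset.card_univ, Fintype.card_fin,
    mul_left_comm, ← Real.exp_add]
  congr 2
  unfold empH
  have hn' : (n : ℝ) ≠ 0 := by positivity
  field_simp
  ring

lemma sum_joint (hn : 0 < n) (h : Fin n → ℝ) (y : ℝ) :
    ∑ σ : Config n, joint θ h σ y =
      √(n / (2 * Real.pi)) * (2 ^ n * Real.exp (-n * empH θ h y)) := by
  rw [← prod_cosh_eq hn, ← sum_exp_spin, Finset.mul_sum, Finset.mul_sum]
  refine Finset.sum_congr rfl fun σ _ => ?_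
  rw [← Real.exp_add, joint]
  congr 2
  rw [totalSpin, Finset.mul_sum, add_assoc, ← Finset.sum_add_distrib]
  congr 1
  exact Finset.sum_congr rfl fun i _ => by ring

/-- The normalization of the auxiliary density at the reference point `x`. -/
noncomputable def normConst (θ : ℝ) (h : Fin n → ℝ) (x : ℝ) : ℝ :=
  √(n / (2 * Real.pi)) * (2 ^ n * Real.exp (-n * empH θ h x))

lemma normConst_pos (hn : 0 < n) (θ : ℝ) (h : Fin n → ℝ) (x : ℝ) : 0 < normConst θ h x := by
  have := Real.pi_pos
  unfold normConst
  positivity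

lemma sum_joint_eq_normConst (hn : 0 < n) (h : Fin n → ℝ) (x y : ℝ) :
    ∑ σ : Config n, joint θ h σ y =
      normConst θ h x * Real.exp (-n * (empH θ h y - empH θ h x)) := by
  rw [sum_joint hn, normConst, mul_assoc, mul_assoc, ← Real.exp_add]
  congr 4
  ring

lemma integrable_exp_empH (hθ : 0 < θ) (hn : 0 < n) (h : Fin n → ℝ) (x : ℝ) :
    Integrable fun y => Real.exp (-n * (empH θ h y - empH θ h x)) := by
  have h1 : Integrable fun y => ∑ σ : Config n, joint θ h σ y :=
    integrable_finsetSum _ fun σ _ => integrable_joint hθ hn h σ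
  simp_rw [sum_joint_eq_normConst hn h x] at h1
  have h2 := h1.const_mul (normConst θ h x)⁻¹
  simpa [← mul_assoc, inv_mul_cancel₀ (normConst_pos hn θ h x).ne'] using h2

/-- Summation over configurations restricted to `A` is, up to an error governed by the value of
the empirical free energy at `0`, integration of the auxiliary variable over `D`. -/
def RegionApprox (θ : ℝ) (h : Fin n → ℝ) (ρ : ℝ) (A : Finset (Config n)) (D : Set ℝ) : Prop :=
  MeasurableSet D ∧ ∀ (φ : Config n → ℝ) (M : ℝ), (∀ σ, |φ σ| ≤ M) →
    |∑ σ ∈ A, weight θ h σ * φ σ - ∫ y in D, ∑ σ, φ σ * joint θ h σ y| ≤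
      ρ * (M * (2 ^ n * Real.exp (-n * empH θ h 0)))

lemma regionApprox_univ (hθ : 0 < θ) (hn : 0 < n) (h : Fin n → ℝ) :
    RegionApprox θ h 0 Finset.univ Set.univ := by
  refine ⟨MeasurableSet.univ, fun φ M _ => ?_⟩
  rw [Measure.restrict_univ, integral_finsetSum _ fun σ _ => (integrable_joint hθ hn h σ).const_mul _]
  simp_rw [integral_const_mul, integral_joint hθ hn, mul_comm (φ _)]
  simp

lemma setIntegral_joint_le (hn : 0 < n) (h : Fin n → ℝ) (σ : Config n)
    {E : Set ℝ} (hE : MeasurableSet E) (hle : ∀ y ∈ E, y * totalSpin σ ≤ 0) :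
    ∫ y in E, joint θ h σ y ≤ Real.exp (∑ i, h i * spin σ i) := by
  have hI : Integrable fun y : ℝ => Real.exp (∑ i, h i * spin σ i) *
      (√(n / (2 * Real.pi)) * Real.exp (-(n / 2 : ℝ) * (y - 0) ^ 2)) :=
    ((integrable_gaussian_shift (by positivity) _).const_mul _).const_mul _
  calc ∫ y in E, joint θ h σ y ≤ ∫ y in E, Real.exp (∑ i, h i * spin σ i) *
      (√(n / (2 * Real.pi)) * Real.exp (-(n / 2 : ℝ) * (y - 0) ^ 2)) := by
        refine integral_mono_of_nonneg (Eventually.of_forall fun y => joint_nonneg _ _ _ _)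
          hI.integrableOn ((ae_restrict_iff' hE).2 (Eventually.of_forall fun y hy => ?_))
        simp only [joint]
        rw [mul_left_comm, ← Real.exp_add]
        refine mul_le_mul_of_nonneg_left (Real.exp_le_exp.2 ?_) (Real.sqrt_nonneg _)
        have := mul_nonneg (Real.sqrt_nonneg θ) (neg_nonneg.2 (hle y hy))
        linarith
    _ ≤ ∫ y, Real.exp (∑ i, h i * spin σ i) *
      (√(n / (2 * Real.pi)) * Real.exp (-(n / 2 : ℝ) * (y - 0) ^ 2)) :=
        setIntegral_le_integral hI (Eventually.of_forall fun y => by positivity)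
    _ = _ := by rw [integral_const_mul, integral_normalized_gaussian hn, mul_one]

lemma regionApprox_sign (hθ : 0 < θ) (hn : 0 < n) (h : Fin n → ℝ) (ε : ℝ) :
    RegionApprox θ h 1 (signRegion n ε) {y | 0 < ε * y} := by
  have hD : MeasurableSet {y : ℝ | 0 < ε * y} :=
    (isOpen_lt continuous_const (by fun_prop)).measurableSet
  refine ⟨hD, fun φ M hM => ?_⟩
  have e0 : ∑ σ ∈ signRegion n ε, weight θ h σ * φ σ =
      ∑ σ, if 0 < ε * totalSpin σ then weight θ h σ * φ σ else 0 := by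
    rw [signRegion, Finset.sum_filter]
  rw [integral_finsetSum _ fun σ _ => ((integrable_joint hθ hn h σ).const_mul _).integrableOn, e0,
    ← Finset.sum_sub_distrib]
  have e1 : 2 ^ n * Real.exp (-n * empH θ h 0) =
      ∑ σ : Config n, Real.exp (∑ i, h i * spin σ i) := by
    rw [← prod_cosh_eq hn, sum_exp_spin]
    simp
  rw [one_mul, e1, Finset.mul_sum]
  refine (Finset.abs_sum_le_sum_abs _ _).trans (Finset.sum_le_sum fun σ _ => ?_)
  rw [integral_const_mul]
  have hMp : 0 ≤ M := (abs_nonneg _).trans (hM σ)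
  split_ifs with hσ
  · rw [← integral_joint hθ hn h σ, ← integral_add_compl hD (integrable_joint hθ hn h σ),
      show ∀ a b c : ℝ, (a + b) * c - c * a = c * b from fun a b c => by ring, abs_mul,
      abs_of_nonneg (integral_nonneg fun y => joint_nonneg _ _ _ _)]
    refine mul_le_mul (hM σ) (setIntegral_joint_le hn h σ hD.compl fun y hy => ?_)
      (integral_nonneg fun y => joint_nonneg _ _ _ _) hMp
    have hy' : ε * y ≤ 0 := not_lt.1 hy
    have hε : ε ≠ 0 := by rintro rfl; simp at hσ
    have : 0 < ε ^ 2 := by positivity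
    by_contra hc
    nlinarith [mul_nonneg hσ.le (neg_nonneg.2 hy'), mul_pos this (not_le.1 hc)]
  · rw [zero_sub, abs_neg, abs_mul,
      abs_of_nonneg (integral_nonneg fun y => joint_nonneg _ _ _ _)]
    refine mul_le_mul (hM σ) (setIntegral_joint_le hn h σ hD fun y hy => ?_)
      (integral_nonneg fun y => joint_nonneg _ _ _ _) hMp
    have hy' : 0 < ε * y := hy
    have hε : ε ≠ 0 := by rintro rfl; simp at hy'
    have : 0 < ε ^ 2 := by positivity
    by_contra hc
    nlinarith [mul_nonneg hy'.le (neg_nonneg.2 (not_lt.1 hσ)), mul_pos this (not_le.1 hc)]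

/-- Mass of a window of width `ω / √n` around the mean of the auxiliary variable. -/
noncomputable def windowMass (ω : ℝ) : ℝ := 2 * ω * √(1 / (2 * Real.pi)) * Real.exp (-ω ^ 2 / 2)

lemma windowMass_pos {ω : ℝ} (hω : 0 < ω) : 0 < windowMass ω := by
  have := Real.pi_pos
  unfold windowMass
  positivity

lemma windowMass_mul_weight_le (hθ : 0 < θ) (hn : 0 < n) (h : Fin n → ℝ) (σ : Config n) {ω : ℝ}
    (hω : 0 < ω) : windowMass ω * weight θ h σ ≤
      ∫ y in Metric.closedBall (√θ * totalSpin σ / n) (ω / √n), joint θ h σ y := by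
  have hn' : (0 : ℝ) < n := by positivity
  have h1 : ∀ y ∈ Metric.closedBall (√θ * totalSpin σ / n) (ω / √n),
      weight θ h σ * (√(n / (2 * Real.pi)) * Real.exp (-ω ^ 2 / 2)) ≤ joint θ h σ y := by
    intro y hy
    rw [joint_eq hθ hn]
    have hw := weight_pos θ h σ
    gcongr
    have h2 : |y - √θ * totalSpin σ / n| ≤ ω / √n := by simpa [Real.dist_eq] using hy
    have h3 : (y - √θ * totalSpin σ / n) ^ 2 ≤ (ω / √n) ^ 2 := by
      rw [← sq_abs]; gcongr
    rw [div_pow, Real.sq_sqrt hn'.le, le_div_iff₀ hn'] at h3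
    linarith
  have h2 := setIntegral_mono_on (μ := volume) (integrableOn_const (C := weight θ h σ *
    (√(n / (2 * Real.pi)) * Real.exp (-ω ^ 2 / 2)))
      (isCompact_closedBall (√θ * totalSpin σ / n) (ω / √n)).measure_lt_top.ne)
      (integrable_joint hθ hn h σ).integrableOn Metric.isClosed_closedBall.measurableSet h1
  refine le_trans (le_of_eq ?_) h2
  rw [setIntegral_const, Real.volume_real_closedBall (by positivity), windowMass, smul_eq_mul,
    show (n : ℝ) / (2 * Real.pi) = n * (1 / (2 * Real.pi)) by ring, Real.sqrt_mul hn'.le]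
  have : (0 : ℝ) < √n := by positivity
  field_simp

lemma sum_weight_le_window (hθ : 0 < θ) (hn : 0 < n) (h : Fin n → ℝ) (x : ℝ) {ω : ℝ} (hω : 0 < ω)
    {A : Finset (Config n)} {φ : Config n → ℝ} {Φ : ℝ → ℝ} (hφ : ∀ σ, 0 ≤ φ σ) (hΦ0 : ∀ y, 0 ≤ Φ y)
    (hΦi : ∀ σ, Integrable fun y => Φ y * joint θ h σ y)
    (hφΦ : ∀ σ ∈ A, ∀ y, |y - √θ * totalSpin σ / n| ≤ ω / √n → φ σ ≤ Φ y) :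
    ∑ σ ∈ A, weight θ h σ * φ σ ≤ (windowMass ω)⁻¹ *
      (normConst θ h x * ∫ y, Φ y * Real.exp (-n * (empH θ h y - empH θ h x))) := by
  rw [le_inv_mul_iff₀ (windowMass_pos hω), ← integral_const_mul, Finset.mul_sum]
  calc ∑ σ ∈ A, windowMass ω * (weight θ h σ * φ σ)
      ≤ ∑ σ ∈ A, ∫ y, Φ y * joint θ h σ y := by
        refine Finset.sum_le_sum fun σ hσ => ?_
        calc _ = φ σ * (windowMass ω * weight θ h σ) := by ring
          _ ≤ φ σ * ∫ y in Metric.closedBall (√θ * totalSpin σ / n) (ω / √n), joint θ h σ y :=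
            mul_le_mul_of_nonneg_left (windowMass_mul_weight_le hθ hn h σ hω) (hφ σ)
          _ = ∫ y in Metric.closedBall (√θ * totalSpin σ / n) (ω / √n), φ σ * joint θ h σ y :=
            (integral_const_mul _ _).symm
          _ ≤ ∫ y in Metric.closedBall (√θ * totalSpin σ / n) (ω / √n), Φ y * joint θ h σ y := by
            refine setIntegral_mono_on ((integrable_joint hθ hn h σ).const_mul _).integrableOn
              (hΦi σ).integrableOn Metric.isClosed_closedBall.measurableSet fun y hy => ?_
            exact mul_le_mul_of_nonneg_right
              (hφΦ σ hσ y (by simpa [Real.dist_eq] using hy)) (joint_nonneg _ _ _ _)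
          _ ≤ _ := setIntegral_le_integral (hΦi σ)
            (Eventually.of_forall fun y => mul_nonneg (hΦ0 y) (joint_nonneg _ _ _ _))
    _ ≤ ∑ σ, ∫ y, Φ y * joint θ h σ y :=
        Finset.sum_le_sum_of_subset_of_nonneg (Finset.subset_univ _) fun σ _ _ =>
          integral_nonneg fun y => mul_nonneg (hΦ0 y) (joint_nonneg _ _ _ _)
    _ = ∫ y, normConst θ h x * (Φ y * Real.exp (-n * (empH θ h y - empH θ h x))) := by
        rw [← integral_finsetSum _ fun σ _ => hΦi σ]
        refine integral_congr_ae (Eventually.of_forall fun y => ?_)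
        simp only
        rw [← Finset.mul_sum, sum_joint_eq_normConst hn h x]
        ring

end Linearization

/-! ### Fluctuations of the empirical free energy -/

section Fluctuations

variable {n : ℕ} {μ : Measure ℝ} {θ : ℝ}

/-- The derivative of `empH - H`. -/
noncomputable def devSlope (μ : Measure ℝ) (θ : ℝ) (h : Fin n → ℝ) (y : ℝ) : ℝ :=
  √θ * (meanTanh μ θ y - (∑ i, Real.tanh (√θ * y + h i)) / n)

/-- The second derivative of `empH - H`. -/
noncomputable def devCurv (μ : Measure ℝ) (θ : ℝ) (h : Fin n → ℝ) (y : ℝ) : ℝ :=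
  θ * (meanSechSq μ θ y - (∑ i, (1 - Real.tanh (√θ * y + h i) ^ 2)) / n)

/-- A bound on the fluctuations of `empH - H` on `[x - B, x + B]`. -/
noncomputable def fluct (μ : Measure ℝ) (θ x B : ℝ) (h : Fin n → ℝ) : ℝ :=
  (1 + √B) * √(devSlope μ θ h x ^ 2 +
    (∫ y in Set.Icc (x - B) (x + B), devCurv μ θ h y ^ 2) + 1 / n)

lemma abs_sum_div_le {f : Fin n → ℝ} {C : ℝ} (hC : 0 ≤ C) (hf : ∀ i, |f i| ≤ C) :
    |(∑ i, f i) / n| ≤ C := by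
  rw [abs_div, Nat.abs_cast]
  refine div_le_of_le_mul₀ (by positivity) hC ?_
  refine (Finset.abs_sum_le_sum_abs _ _).trans ((Finset.sum_le_sum fun i _ => hf i).trans ?_)
  simp [mul_comm]

lemma empH_sub_ge (hθ : 0 < θ) (h : Fin n → ℝ) (x y : ℝ) :
    (y - x) ^ 2 / 2 - (|x| + √θ) * |y - x| ≤ empH θ h y - empH θ h x := by
  have h1 : |(∑ i, (Real.log (Real.cosh (√θ * y + h i)) - Real.log (Real.cosh (√θ * x + h i)))) / n|
      ≤ √θ * |y - x| := by
    refine abs_sum_div_le (by positivity) fun i => (abs_log_cosh_sub_le _ _).trans_eq ?_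
    rw [← abs_of_nonneg (Real.sqrt_nonneg θ), ← abs_mul]
    rw [abs_of_nonneg (Real.sqrt_nonneg θ)]
    congr 1; ring
  rw [Finset.sum_sub_distrib, sub_div] at h1
  have h2 := (abs_le.1 h1).2
  have h3 : -(|x| * |y - x|) ≤ x * (y - x) := by
    rw [← abs_mul]; exact neg_abs_le _
  unfold empH
  nlinarith

lemma sq_div_four_le_empH_sub (hθ : 0 < θ) (h : Fin n → ℝ) {x y B : ℝ}
    (hB : 4 * (|x| + √θ) ≤ B) (hy : B ≤ |y - x|) :
    (y - x) ^ 2 / 4 ≤ empH θ h y - empH θ h x := by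
  have h1 := empH_sub_ge hθ h x y
  have h2 : 4 * (|x| + √θ) * |y - x| ≤ (y - x) ^ 2 := by
    rw [← sq_abs, sq]
    exact mul_le_mul_of_nonneg_right (hB.trans hy) (abs_nonneg _)
  linarith

variable [IsProbabilityMeasure μ]

lemma continuous_meanSechSq : Continuous (meanSechSq μ θ) :=
  continuous_iff_continuousAt.2 fun x => (hasDerivAt_meanSechSq x).continuousAt

lemma hasDerivAt_empH_sub_H (hμ : Integrable (fun h : ℝ => h) μ) (h : Fin n → ℝ) (y : ℝ) :
    HasDerivAt (fun y => empH θ h y - H μ θ y) (devSlope μ θ h y) y := by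
  have h1 : ∀ i, HasDerivAt (fun y => Real.log (Real.cosh (√θ * y + h i)))
      (√θ * Real.tanh (√θ * y + h i)) y := fun i => by
    have h1 : HasDerivAt (fun y => √θ * y + h i) (√θ) y := by
      simpa using ((hasDerivAt_id y).const_mul (√θ)).add_const (h i)
    exact ((hasDerivAt_log_cosh _).comp y h1).congr_deriv (by ring)
  have h2 : HasDerivAt (fun x : ℝ => x ^ 2 / 2) y y :=
    ((hasDerivAt_pow 2 y).div_const 2).congr_deriv (by simp)
  have h3 := (HasDerivAt.fun_sum fun i (_ : i ∈ Finset.univ) => h1 i).div_const (n : ℝ)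
  refine ((h2.sub h3).sub (hasDerivAt_H hμ y)).congr_deriv ?_
  rw [← Finset.mul_sum, devSlope]
  ring

lemma hasDerivAt_devSlope (hθ : 0 < θ) (h : Fin n → ℝ) (y : ℝ) :
    HasDerivAt (devSlope μ θ h) (devCurv μ θ h y) y := by
  have h1 : ∀ i, HasDerivAt (fun y => Real.tanh (√θ * y + h i))
      (√θ * (1 - Real.tanh (√θ * y + h i) ^ 2)) y := fun i => by
    have h1 : HasDerivAt (fun y => √θ * y + h i) (√θ) y := by
      simpa using ((hasDerivAt_id y).const_mul (√θ)).add_const (h i)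
    exact ((hasDerivAt_tanh _).comp y h1).congr_deriv (by ring)
  have h3 := (HasDerivAt.fun_sum fun i (_ : i ∈ Finset.univ) => h1 i).div_const (n : ℝ)
  refine (((hasDerivAt_meanTanh y).sub h3).const_mul (√θ)).congr_deriv ?_
  rw [← Finset.mul_sum, devCurv]
  linear_combination (meanSechSq μ θ y - (∑ i, (1 - Real.tanh (√θ * y + h i) ^ 2)) / n) *
    Real.mul_self_sqrt hθ.le

lemma continuous_devCurv_uncurry :
    Continuous fun p : (Fin n → ℝ) × ℝ => devCurv μ θ p.1 p.2 := by
  have h1 := continuous_meanSechSq (μ := μ) (θ := θ)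
  have h2 := continuous_tanh
  unfold devCurv
  refine continuous_const.mul ((h1.comp continuous_snd).sub (Continuous.div_const
    (continuous_finsetSum _ fun i _ => continuous_const.sub ((h2.comp ?_).pow 2)) _))
  fun_prop

lemma continuous_devCurv (h : Fin n → ℝ) : Continuous (devCurv μ θ h) :=
  Continuous.comp (g := fun p : (Fin n → ℝ) × ℝ => devCurv μ θ p.1 p.2) (f := fun y => (h, y))
    continuous_devCurv_uncurry (by fun_prop)

lemma continuous_devSlope_left (y : ℝ) : Continuous fun h : Fin n → ℝ => devSlope μ θ h y := by
  have h2 := continuous_tanh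
  unfold devSlope
  refine continuous_const.mul (continuous_const.sub (Continuous.div_const
    (continuous_finsetSum _ fun i _ => h2.comp ?_) _))
  fun_prop

section Bounds

variable {x B : ℝ} {h : Fin n → ℝ}

lemma inv_sqrt_le_fluct : (√(n : ℝ))⁻¹ ≤ fluct μ θ x B h := by
  have h0 : 0 ≤ ∫ y in Set.Icc (x - B) (x + B), devCurv μ θ h y ^ 2 :=
    integral_nonneg fun y => sq_nonneg _
  rw [← Real.sqrt_inv, ← one_div]
  have h1 : √(1 / (n : ℝ)) ≤ √(devSlope μ θ h x ^ 2 +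
    (∫ y in Set.Icc (x - B) (x + B), devCurv μ θ h y ^ 2) + 1 / n) :=
    Real.sqrt_le_sqrt (by nlinarith [sq_nonneg (devSlope μ θ h x)])
  unfold fluct
  nlinarith [Real.sqrt_nonneg B, Real.sqrt_nonneg (1 / (n : ℝ))]

lemma fluct_nonneg : 0 ≤ fluct μ θ x B h := le_trans (by positivity) inv_sqrt_le_fluct

lemma fluct_pos (hn : 0 < n) : 0 < fluct μ θ x B h := lt_of_lt_of_le (by positivity) inv_sqrt_le_fluct

lemma one_le_mul_fluct_sq (hn : 0 < n) : 1 ≤ n * fluct μ θ x B h ^ 2 := by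
  have h1 : (√(n : ℝ))⁻¹ ^ 2 ≤ fluct μ θ x B h ^ 2 := by gcongr; exact inv_sqrt_le_fluct
  rw [inv_pow, Real.sq_sqrt (by positivity)] at h1
  calc (1 : ℝ) = n * (n : ℝ)⁻¹ := by field_simp
    _ ≤ _ := by gcongr

lemma abs_devSlope_sub_le_aux (hn : 0 < n) (hθ : 0 < θ) {y : ℝ} (hy : |y - x| ≤ B) :
    |devSlope μ θ h y - devSlope μ θ h x| ≤ √(devSlope μ θ h x ^ 2 +
    (∫ y in Set.Icc (x - B) (x + B), devCurv μ θ h y ^ 2) + 1 / n) * √|y - x| := by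
  set I := ∫ y in Set.Icc (x - B) (x + B), devCurv μ θ h y ^ 2 with hI
  have hI0 : 0 ≤ I := integral_nonneg fun y => sq_nonneg _
  set P := devSlope μ θ h x ^ 2 + I + 1 / n with hP
  have hPI : I ≤ P := by
    have : (0 : ℝ) ≤ 1 / n := by positivity
    nlinarith [sq_nonneg (devSlope μ θ h x)]
  have hP0 : 0 < P := by positivity
  rcases eq_or_ne y x with rfl | hne
  · simp
  have hz : 0 < |y - x| := abs_pos.2 (sub_ne_zero.2 hne)
  set s := √P / √|y - x| with hs
  have hs0 : 0 < s := by positivity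
  have hc := continuous_devCurv (μ := μ) (θ := θ) h
  rw [← intervalIntegral.integral_eq_sub_of_hasDerivAt (fun w _ => hasDerivAt_devSlope hθ h w)
    (hc.intervalIntegrable _ _), ← Real.norm_eq_abs]
  refine intervalIntegral.norm_integral_le_integral_norm_uIoc.trans ?_
  have hsub : Set.uIoc x y ⊆ Set.Icc (x - B) (x + B) := by
    intro w hw
    have hw := Set.uIoc_subset_uIcc hw
    rw [Set.mem_uIcc] at hw
    have := abs_le.1 hy
    constructor <;> rcases hw with hw | hw <;> linarith [hw.1, hw.2]
  have hcI : IntegrableOn (fun w => devCurv μ θ h w ^ 2) (Set.Icc (x - B) (x + B)) :=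
    (hc.pow 2).continuousOn.integrableOn_Icc
  have hcI' : IntegrableOn (fun w => devCurv μ θ h w ^ 2) (Set.uIoc x y) := hcI.mono_set hsub
  have hfin : volume (Set.uIoc x y) ≠ ⊤ := by simp [Set.uIoc]
  calc ∫ w in Set.uIoc x y, ‖devCurv μ θ h w‖
      ≤ ∫ w in Set.uIoc x y, (s / 2 + (2 * s)⁻¹ * devCurv μ θ h w ^ 2) := by
        refine integral_mono_of_nonneg (Eventually.of_forall fun w => norm_nonneg _)
          ((integrableOn_const hfin).add (hcI'.const_mul _)) (Eventually.of_forall fun w => ?_)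
        simp only [Real.norm_eq_abs]
        rw [← sq_abs (devCurv μ θ h w)]
        have := sq_nonneg (s - |devCurv μ θ h w|)
        field_simp
        nlinarith
    _ = |y - x| * (s / 2) + (2 * s)⁻¹ * ∫ w in Set.uIoc x y, devCurv μ θ h w ^ 2 := by
        rw [integral_add (f := fun _ => s / 2) (integrableOn_const hfin) (hcI'.const_mul _), integral_const_mul,
          setIntegral_const, smul_eq_mul, measureReal_def, Real.volume_uIoc,
          ENNReal.toReal_ofReal (abs_nonneg _)]
    _ ≤ |y - x| * (s / 2) + (2 * s)⁻¹ * P := by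
        gcongr
        refine le_trans ?_ hPI
        exact setIntegral_mono_set hcI (Eventually.of_forall fun w => sq_nonneg _)
          (Eventually.of_forall hsub)
    _ = √P * √|y - x| := by
        have h1 := Real.sq_sqrt hz.le
        have h2 := Real.sq_sqrt hP0.le
        have h3 : 0 < √|y - x| := by positivity
        have h4 : 0 < √P := by positivity
        rw [hs]
        nth_rw 1 [← h1]
        nth_rw 3 [← h2]
        field_simp
        norm_num

lemma abs_devSlope_sub_le (hn : 0 < n) (hθ : 0 < θ) {y : ℝ} (hy : |y - x| ≤ B) :
    |devSlope μ θ h y - devSlope μ θ h x| ≤ fluct μ θ x B h * √|y - x| := by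
  refine (abs_devSlope_sub_le_aux hn hθ hy).trans
    (mul_le_mul_of_nonneg_right ?_ (Real.sqrt_nonneg _))
  unfold fluct
  exact le_mul_of_one_le_left (Real.sqrt_nonneg _) (by linarith [Real.sqrt_nonneg B])

lemma abs_devSlope_le_aux : |devSlope μ θ h x| ≤ √(devSlope μ θ h x ^ 2 +
    (∫ y in Set.Icc (x - B) (x + B), devCurv μ θ h y ^ 2) + 1 / n) := by
  have h0 : 0 ≤ ∫ y in Set.Icc (x - B) (x + B), devCurv μ θ h y ^ 2 :=
    integral_nonneg fun y => sq_nonneg _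
  have : (0 : ℝ) ≤ 1 / n := by positivity
  exact Real.abs_le_sqrt (by linarith)

lemma abs_devSlope_center_le : |devSlope μ θ h x| ≤ fluct μ θ x B h := by
  refine (abs_devSlope_le_aux (B := B)).trans ?_
  unfold fluct
  exact le_mul_of_one_le_left (Real.sqrt_nonneg _) (by linarith [Real.sqrt_nonneg B])

lemma abs_devSlope_le (hn : 0 < n) (hθ : 0 < θ) {y : ℝ} (hy : |y - x| ≤ B) :
    |devSlope μ θ h y| ≤ fluct μ θ x B h := by
  have h1 := abs_devSlope_sub_le_aux (μ := μ) (h := h) hn hθ hy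
  have h2 := abs_devSlope_le_aux (μ := μ) (θ := θ) (x := x) (B := B) (h := h)
  have h3 := abs_sub_abs_le_abs_sub (devSlope μ θ h y) (devSlope μ θ h x)
  have h4 : √|y - x| ≤ √B := Real.sqrt_le_sqrt hy
  have h5 := mul_le_mul_of_nonneg_left h4 (Real.sqrt_nonneg (devSlope μ θ h x ^ 2 +
    (∫ y in Set.Icc (x - B) (x + B), devCurv μ θ h y ^ 2) + 1 / n))
  unfold fluct
  linarith

lemma abs_empH_dev_le (hμ : Integrable (fun h : ℝ => h) μ) (hn : 0 < n) (hθ : 0 < θ) {y : ℝ}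
    (hy : |y - x| ≤ B) :
    |(empH θ h y - empH θ h x) - (H μ θ y - H μ θ x)| ≤ fluct μ θ x B h * |y - x| := by
  have := abs_sub_le_of_hasDerivAt (hasDerivAt_empH_sub_H (θ := θ) hμ h) (x := x) (y := y)
    (fun w hw => abs_devSlope_le hn hθ (hw.trans hy))
  convert this using 2
  ring

lemma abs_empH_dev_linear_le (hμ : Integrable (fun h : ℝ => h) μ) (hn : 0 < n) (hθ : 0 < θ) {y : ℝ}
    (hy : |y - x| ≤ B) :
    |(empH θ h y - empH θ h x) - (H μ θ y - H μ θ x) - devSlope μ θ h x * (y - x)| ≤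
      fluct μ θ x B h * (√|y - x| * |y - x|) := by
  have := abs_sub_le_of_hasDerivAt
    (f := fun w => empH θ h w - H μ θ w - devSlope μ θ h x * w)
    (fun w => (hasDerivAt_empH_sub_H (θ := θ) hμ h w).sub
      ((hasDerivAt_id w).const_mul (devSlope μ θ h x))) (x := x) (y := y)
    (M := fluct μ θ x B h * √|y - x|)
    (fun w hw => by
      rw [mul_one]
      refine (abs_devSlope_sub_le hn hθ (hw.trans hy)).trans ?_
      exact mul_le_mul_of_nonneg_left (Real.sqrt_le_sqrt hw) fluct_nonneg)
  rw [← mul_assoc]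
  convert this using 2
  ring

end Bounds

end Fluctuations

/-! ### Exponential moments of the fluctuations -/

section Moments

variable {n : ℕ} {μ : Measure ℝ} {θ : ℝ} [IsProbabilityMeasure μ]

lemma integral_exp_mul_sum (ξ : ℝ → ℝ) (s : ℝ) :
    ∫ h, Real.exp (s * ∑ i, ξ (h i)) ∂(Measure.pi fun _ : Fin n => μ) =
      (∫ x, Real.exp (s * ξ x) ∂μ) ^ n := by
  simp_rw [Finset.mul_sum, Real.exp_sum]
  rw [integral_fintype_prod_eq_pow (fun x => Real.exp (s * ξ x)), Fintype.card_fin]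

lemma integral_exp_mul_sum_le {ξ : ℝ → ℝ} (hξ : Continuous ξ) (hb : ∀ x, |ξ x| ≤ 2)
    (h0 : ∫ x, ξ x ∂μ = 0) (s : ℝ) :
    ∫ h, Real.exp (s * ∑ i, ξ (h i)) ∂(Measure.pi fun _ : Fin n => μ) ≤
      Real.exp (2 * n * s ^ 2) := by
  have h1 := (ProbabilityTheory.hasSubgaussianMGF_of_mem_Icc_of_integral_eq_zero (μ := μ)
    (a := -2) (b := 2) hξ.measurable.aemeasurable
    (Eventually.of_forall fun x => abs_le.1 (hb x)) h0).mgf_le s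
  have h2 : (((‖(2 : ℝ) - -2‖₊ / 2) ^ 2 : NNReal) : ℝ) = 4 := by
    push_cast
    rw [Real.norm_eq_abs]
    norm_num
  rw [h2, ProbabilityTheory.mgf] at h1
  rw [integral_exp_mul_sum]
  calc _ ≤ (Real.exp (4 * s ^ 2 / 2)) ^ n := by
        gcongr
    _ = _ := by rw [← Real.exp_nat_mul]; congr 1; ring

lemma integral_exp_sq_sum_le (hn : 0 < n) {ξ : ℝ → ℝ} (hξ : Continuous ξ) (hb : ∀ x, |ξ x| ≤ 2)
    (h0 : ∫ x, ξ x ∂μ = 0) {l : ℝ} (hl : 0 ≤ l) (hl' : l ≤ 1 / 16) :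
    ∫ h, Real.exp (l * ((∑ i, ξ (h i)) ^ 2 / n)) ∂(Measure.pi fun _ : Fin n => μ) ≤ 2 := by
  have hn' : (0 : ℝ) < n := by positivity
  set P := Measure.pi fun _ : Fin n => μ with hP
  set Y : (Fin n → ℝ) → ℝ := fun h => √l * (∑ i, ξ (h i)) / √n with hY
  have hYc : Continuous Y := by
    rw [hY]; fun_prop
  have hYb : ∀ h, |Y h| ≤ √l * (n * 2) / √n := by
    intro h
    rw [hY]
    simp only [abs_div, abs_mul, abs_of_nonneg (Real.sqrt_nonneg _)]
    gcongr
    refine (Finset.abs_sum_le_sum_abs _ _).trans ((Finset.sum_le_sum fun i _ => hb _).trans ?_)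
    simp
  have e1 : ∀ h, √Real.pi * Real.exp (l * ((∑ i, ξ (h i)) ^ 2 / n)) =
      ∫ y : ℝ, Real.exp (-y ^ 2 + 2 * y * Y h) := by
    intro h
    have h1 : ∀ y, Real.exp (-y ^ 2 + 2 * y * Y h) =
        Real.exp (Y h ^ 2) * Real.exp (-1 * (y - Y h) ^ 2) := by
      intro y; rw [← Real.exp_add]; congr 1; ring
    simp_rw [h1]
    rw [integral_const_mul, integral_gaussian_shift, div_one, mul_comm]
    congr 2
    rw [hY]
    simp only [div_pow, mul_pow, Real.sq_sqrt hl, Real.sq_sqrt hn'.le]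
    ring
  have hpi : 0 < √Real.pi := Real.sqrt_pos.2 Real.pi_pos
  have hΦi : Integrable (Function.uncurry fun (h : Fin n → ℝ) (y : ℝ) =>
      Real.exp (-y ^ 2 + 2 * y * Y h)) (P.prod volume) := by
    set b := √l * (n * 2) / √n
    have hg : Integrable (fun y : ℝ => Real.exp (2 * b ^ 2) * Real.exp (-(1 / 2) * y ^ 2)) :=
      (integrable_exp_neg_mul_sq (by norm_num)).const_mul _
    refine (hg.comp_snd P).mono' ?_ (Eventually.of_forall fun p => ?_)
    · refine Continuous.aestronglyMeasurable ?_
      simp only [Function.uncurry_def]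
      fun_prop
    · simp only [Function.uncurry, Real.norm_eq_abs, Real.abs_exp]
      rw [← Real.exp_add, Real.exp_le_exp]
      have h1 : (Y p.1) ^ 2 ≤ b ^ 2 := sq_le_sq' (abs_le.1 (hYb p.1)).1 (abs_le.1 (hYb p.1)).2
      nlinarith [sq_nonneg (p.2 - 2 * Y p.1)]
  have e2 : √Real.pi * ∫ h, Real.exp (l * ((∑ i, ξ (h i)) ^ 2 / n)) ∂P =
      ∫ y : ℝ, ∫ h, Real.exp (-y ^ 2 + 2 * y * Y h) ∂P := by
    rw [← integral_const_mul]
    simp_rw [e1]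
    exact integral_integral_swap hΦi
  have h3 : ∀ y : ℝ, ∫ h, Real.exp (-y ^ 2 + 2 * y * Y h) ∂P ≤ Real.exp (-(1 / 2) * y ^ 2) := by
    intro y
    have h4 : ∀ h, Real.exp (-y ^ 2 + 2 * y * Y h) =
        Real.exp (-y ^ 2) * Real.exp ((2 * y * √l / √n) * ∑ i, ξ (h i)) := by
      intro h; rw [← Real.exp_add, hY]; congr 1; ring
    simp_rw [h4]
    rw [integral_const_mul]
    calc _ ≤ Real.exp (-y ^ 2) * Real.exp (2 * n * (2 * y * √l / √n) ^ 2) := by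
          gcongr
          exact integral_exp_mul_sum_le hξ hb h0 _
      _ ≤ _ := by
          rw [← Real.exp_add, Real.exp_le_exp, div_pow, mul_pow, mul_pow, Real.sq_sqrt hl,
            Real.sq_sqrt hn'.le]
          field_simp
          nlinarith [sq_nonneg y, mul_nonneg (sub_nonneg.2 hl') (sq_nonneg y)]
  have h5 : √Real.pi * ∫ h, Real.exp (l * ((∑ i, ξ (h i)) ^ 2 / n)) ∂P ≤ √Real.pi * 2 := by
    rw [e2]
    calc _ ≤ ∫ y : ℝ, Real.exp (-(1 / 2) * y ^ 2) :=
          integral_mono_of_nonneg (Eventually.of_forall fun y => integral_nonneg fun h =>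
            (Real.exp_pos _).le) (integrable_exp_neg_mul_sq (by norm_num))
            (Eventually.of_forall h3)
      _ = √(Real.pi / (1 / 2)) := integral_gaussian _
      _ ≤ √(Real.pi * 4) := Real.sqrt_le_sqrt (by have := Real.pi_pos; linarith)
      _ = √Real.pi * 2 := by
          rw [Real.sqrt_mul Real.pi_pos.le, show (4 : ℝ) = 2 ^ 2 by norm_num,
            Real.sqrt_sq (by norm_num)]
  exact le_of_mul_le_mul_left h5 hpi

lemma abs_meanTanh_le (x : ℝ) : |meanTanh μ θ x| ≤ 1 := by
  unfold meanTanh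
  rw [← Real.norm_eq_abs]
  exact le_trans (norm_integral_le_of_norm_le_const (C := 1)
    (Eventually.of_forall fun h => abs_tanh_le_one _)) (by simp)

lemma integrable_tanh (c : ℝ) : Integrable (fun h => Real.tanh (c + h)) μ :=
  integrable_of_continuous_bounded (continuous_tanh.comp (by fun_prop)) fun h => abs_tanh_le_one _

lemma integral_tanh_sub_mean (y : ℝ) :
    ∫ x, (Real.tanh (√θ * y + x) - meanTanh μ θ y) ∂μ = 0 := by
  rw [integral_sub (integrable_tanh _) (integrable_const _)]
  simp [meanTanh]

lemma abs_tanh_sub_mean_le (y x : ℝ) : |Real.tanh (√θ * y + x) - meanTanh μ θ y| ≤ 2 := by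
  refine (abs_sub _ _).trans ?_
  linarith [abs_tanh_le_one (√θ * y + x), abs_meanTanh_le (μ := μ) (θ := θ) y]

lemma devSlope_eq (hn : 0 < n) (h : Fin n → ℝ) (y : ℝ) :
    devSlope μ θ h y = -√θ * ((∑ i, (Real.tanh (√θ * y + h i) - meanTanh μ θ y)) / n) := by
  rw [devSlope, Finset.sum_sub_distrib]
  simp only [Finset.sum_const, Finset.card_univ, Fintype.card_fin, nsmul_eq_mul]
  field_simp
  ring

lemma devCurv_eq (hn : 0 < n) (h : Fin n → ℝ) (y : ℝ) :
    devCurv μ θ h y =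
      -θ * ((∑ i, ((1 - Real.tanh (√θ * y + h i) ^ 2) - meanSechSq μ θ y)) / n) := by
  rw [devCurv, Finset.sum_sub_distrib (f := fun i => 1 - Real.tanh (√θ * y + h i) ^ 2)]
  simp only [Finset.sum_const, Finset.card_univ, Fintype.card_fin, nsmul_eq_mul]
  field_simp
  ring

lemma integral_exp_devSlope_le (hn : 0 < n) (hθ : 0 < θ) (y : ℝ) {l : ℝ} (hl : 0 ≤ l)
    (hl' : l * θ ≤ 1 / 16) :
    ∫ h, Real.exp (l * (n * devSlope μ θ h y ^ 2)) ∂(Measure.pi fun _ : Fin n => μ) ≤ 2 := by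
  have h1 := integral_exp_sq_sum_le (μ := μ) hn
    (ξ := fun x => Real.tanh (√θ * y + x) - meanTanh μ θ y)
    ((continuous_tanh.comp (by fun_prop)).sub continuous_const) (abs_tanh_sub_mean_le y)
    (integral_tanh_sub_mean y) (l := l * θ) (by positivity) hl'
  convert h1 using 4 with h
  rw [devSlope_eq hn, mul_pow, neg_sq, Real.sq_sqrt hθ.le]
  field_simp

lemma integral_exp_devCurv_le (hn : 0 < n) (y : ℝ) {l : ℝ} (hl : 0 ≤ l)
    (hl' : l * θ ^ 2 ≤ 1 / 16) :
    ∫ h, Real.exp (l * (n * devCurv μ θ h y ^ 2)) ∂(Measure.pi fun _ : Fin n => μ) ≤ 2 := by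
  have hT : Continuous fun x => Real.tanh (√θ * y + x) := continuous_tanh.comp (by fun_prop)
  have hb : ∀ x, 0 ≤ 1 - Real.tanh (√θ * y + x) ^ 2 ∧ 1 - Real.tanh (√θ * y + x) ^ 2 ≤ 1 := by
    intro x
    have := Real.tanh_sq_lt_one (√θ * y + x)
    constructor <;> nlinarith [sq_nonneg (Real.tanh (√θ * y + x))]
  have hI : Integrable (fun x => 1 - Real.tanh (√θ * y + x) ^ 2) μ :=
    integrable_of_continuous_bounded (C := 1) (by fun_prop) fun x => by
      rw [abs_of_nonneg (hb x).1]; exact (hb x).2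
  have h1 := integral_exp_sq_sum_le (μ := μ) hn
    (ξ := fun x => (1 - Real.tanh (√θ * y + x) ^ 2) - meanSechSq μ θ y)
    (by fun_prop) (fun x => by
      have h2 := meanSechSq_mem (μ := μ) (θ := θ) y
      have h3 := hb x
      rw [abs_le]; constructor <;> linarith [h2.1, h2.2, h3.1, h3.2])
    (by
      rw [integral_sub hI (integrable_const _)]
      simp [meanSechSq, inv_cosh_sq]) (l := l * θ ^ 2) (by positivity) hl'
  convert h1 using 4 with h
  rw [devCurv_eq hn]
  field_simp

lemma abs_devCurv_le (hθ : 0 < θ) (h : Fin n → ℝ) (y : ℝ) : |devCurv μ θ h y| ≤ 2 * θ := by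
  have h1 : |(∑ i, (1 - Real.tanh (√θ * y + h i) ^ 2)) / (n : ℝ)| ≤ 1 :=
    abs_sum_div_le zero_le_one fun i => by
      have := Real.tanh_sq_lt_one (√θ * y + h i)
      rw [abs_le]; constructor <;> nlinarith [sq_nonneg (Real.tanh (√θ * y + h i))]
  have h2 := meanSechSq_mem (μ := μ) (θ := θ) y
  rw [devCurv, abs_mul, abs_of_pos hθ, mul_comm]
  gcongr
  have := abs_le.1 h1
  rw [abs_le]; constructor <;> linarith [h2.1, h2.2, this.1, this.2]

lemma abs_devSlope_le_two (h : Fin n → ℝ) (y : ℝ) : |devSlope μ θ h y| ≤ √θ * 2 := by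
  have h1 : |(∑ i, Real.tanh (√θ * y + h i)) / n| ≤ 1 :=
    abs_sum_div_le zero_le_one fun i => abs_tanh_le_one _
  have h2 := abs_meanTanh_le (μ := μ) (θ := θ) y
  rw [devSlope, abs_mul, abs_of_nonneg (Real.sqrt_nonneg θ)]
  gcongr
  exact (abs_sub _ _).trans (by linarith)

lemma measurable_fluct (x B : ℝ) : Measurable fun h : Fin n → ℝ => fluct μ θ x B h := by
  have h1 : Measurable fun h : Fin n → ℝ =>
      ∫ y in Set.Icc (x - B) (x + B), devCurv μ θ h y ^ 2 := by
    refine (StronglyMeasurable.integral_prod_right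
      (f := fun (h : Fin n → ℝ) y => devCurv μ θ h y ^ 2) ?_).measurable
    exact (continuous_devCurv_uncurry.pow 2).stronglyMeasurable
  have h2 := (continuous_devSlope_left (n := n) (μ := μ) (θ := θ) x).measurable
  unfold fluct
  exact (((h2.pow_const 2).add h1).add_const _).sqrt.const_mul _

lemma integral_devCurv_sq_le (hθ : 0 < θ) (x : ℝ) {B : ℝ} (hB : 0 < B) (h : Fin n → ℝ) :
    ∫ y in Set.Icc (x - B) (x + B), devCurv μ θ h y ^ 2 ≤ (2 * θ) ^ 2 * (2 * B) := by
  have h1 := norm_setIntegral_le_of_norm_le_const (μ := volume) (s := Set.Icc (x - B) (x + B))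
    (f := fun y => devCurv μ θ h y ^ 2) (C := (2 * θ) ^ 2) (by simp) (fun y _ => by
      rw [norm_pow]
      have := abs_devCurv_le (μ := μ) hθ h y
      gcongr
      exact this)
  rw [Real.volume_real_Icc_of_le (by linarith)] at h1
  refine (le_abs_self _).trans (h1.trans_eq ?_)
  ring

lemma integrable_exp_fluct (hθ : 0 < θ) (x : ℝ) {B : ℝ} (hB : 0 < B) (l : ℝ) :
    Integrable (fun h : Fin n → ℝ => Real.exp (l * (n * fluct μ θ x B h ^ 2)))
      (Measure.pi fun _ : Fin n => μ) := by
  have hb : ∀ h : Fin n → ℝ, fluct μ θ x B h ^ 2 ≤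
      (1 + √B) ^ 2 * ((√θ * 2) ^ 2 + (2 * θ) ^ 2 * (2 * B) + 1 / n) := by
    intro h
    have h0 : 0 ≤ ∫ y in Set.Icc (x - B) (x + B), devCurv μ θ h y ^ 2 :=
      integral_nonneg fun y => sq_nonneg _
    rw [fluct, mul_pow, Real.sq_sqrt (by positivity)]
    have h1 := integral_devCurv_sq_le (μ := μ) hθ x hB h
    have h2 : devSlope μ θ h x ^ 2 ≤ (√θ * 2) ^ 2 := by
      rw [← sq_abs]; gcongr; exact abs_devSlope_le_two h x
    gcongr
  refine Integrable.of_bound (C := Real.exp (|l| * (n * ((1 + √B) ^ 2 * ((√θ * 2) ^ 2 +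
    (2 * θ) ^ 2 * (2 * B) + 1 / n))))) ?_ (Eventually.of_forall fun h => ?_)
  · exact ((((measurable_fluct x B).pow_const 2).const_mul _).const_mul _).exp.aestronglyMeasurable
  · rw [Real.norm_eq_abs, Real.abs_exp]
    gcongr
    · exact le_abs_self l
    · exact hb h

lemma exists_integral_exp_fluct_le (hθ : 0 < θ) (x : ℝ) {B : ℝ} (hB : 0 < B) :
    ∃ κ : ℝ, 0 < κ ∧ ∃ C : ℝ, ∀ n : ℕ, 0 < n →
      ∫ h, Real.exp (κ * (n * fluct μ θ x B h ^ 2)) ∂(Measure.pi fun _ : Fin n => μ) ≤ C := by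
  set k := 1 / (16 * (2 * θ + 4 * B * θ ^ 2)) with hk
  have hk0 : 0 < k := by positivity
  refine ⟨k / (1 + √B) ^ 2, by positivity, Real.exp k * 2, fun n hn => ?_⟩
  have hn' : (0 : ℝ) < n := by positivity
  set P := Measure.pi fun _ : Fin n => μ with hP
  have hden : k * (2 * θ + 4 * B * θ ^ 2) = 1 / 16 := by rw [hk]; field_simp
  have hk1 : 2 * k * θ ≤ 1 / 16 := by
    have : 0 < k * (4 * B * θ ^ 2) := by positivity
    linarith
  have hk2 : (4 * B * k) * θ ^ 2 ≤ 1 / 16 := by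
    have : 0 < k * θ := by positivity
    linarith
  have hcurv : ∀ h : Fin n → ℝ, Continuous fun y => Real.exp (4 * B * k * (n * devCurv μ θ h y ^ 2)) := by
    intro h
    have := continuous_devCurv (μ := μ) (θ := θ) h
    fun_prop
  have hvol : volume.real (Set.Icc (x - B) (x + B)) = 2 * B := by
    rw [Real.volume_real_Icc_of_le (by linarith)]; ring
  have jensen : ∀ h : Fin n → ℝ, Real.exp (2 * k * (n * ∫ y in Set.Icc (x - B) (x + B),
      devCurv μ θ h y ^ 2)) ≤ (2 * B)⁻¹ * ∫ y in Set.Icc (x - B) (x + B),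
        Real.exp (4 * B * k * (n * devCurv μ θ h y ^ 2)) := by
    intro h
    have hc := continuous_devCurv (μ := μ) (θ := θ) h
    have := convexOn_exp.map_set_average_le (μ := volume) (t := Set.Icc (x - B) (x + B))
      (f := fun y => 4 * B * k * (n * devCurv μ θ h y ^ 2)) Real.continuous_exp.continuousOn
      isClosed_univ (by simp [Real.volume_Icc]; linarith) (by simp) (Eventually.of_forall fun _ => trivial)
      (by fun_prop : Continuous fun y => 4 * B * k * (n * devCurv μ θ h y ^ 2)).continuousOn.integrableOn_Icc
      (hcurv h).continuousOn.integrableOn_Icc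
    rw [setAverage_eq, setAverage_eq, hvol, integral_const_mul, integral_const_mul, smul_eq_mul,
      smul_eq_mul] at this
    refine le_trans (le_of_eq ?_) this
    congr 1
    field_simp
    ring
  have pointwise : ∀ h : Fin n → ℝ, Real.exp (k / (1 + √B) ^ 2 * (n * fluct μ θ x B h ^ 2)) ≤
      Real.exp k * (1 / 2 * Real.exp (2 * k * (n * devSlope μ θ h x ^ 2)) +
        1 / 2 * ((2 * B)⁻¹ * ∫ y in Set.Icc (x - B) (x + B),
        Real.exp (4 * B * k * (n * devCurv μ θ h y ^ 2)))) := by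
    intro h
    have h0 : 0 ≤ ∫ y in Set.Icc (x - B) (x + B), devCurv μ θ h y ^ 2 :=
      integral_nonneg fun y => sq_nonneg _
    have e : k / (1 + √B) ^ 2 * (n * fluct μ θ x B h ^ 2) = k + (1 / 2 * (2 * k * (n *
        devSlope μ θ h x ^ 2)) + 1 / 2 * (2 * k * (n * ∫ y in Set.Icc (x - B) (x + B),
      devCurv μ θ h y ^ 2))) := by
      rw [fluct, mul_pow, Real.sq_sqrt (by positivity)]
      have : 0 < (1 + √B) := by positivity
      field_simp
      ring
    rw [e, Real.exp_add]
    gcongr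
    have := convexOn_exp.2 (Set.mem_univ (2 * k * (n * devSlope μ θ h x ^ 2))) (Set.mem_univ
      (2 * k * (n * ∫ y in Set.Icc (x - B) (x + B), devCurv μ θ h y ^ 2)))
      (by norm_num : (0 : ℝ) ≤ 1 / 2) (by norm_num : (0 : ℝ) ≤ 1 / 2) (by norm_num)
    simp only [smul_eq_mul] at this
    exact this.trans (by gcongr; exact jensen h)
  have hu : Continuous fun p : (Fin n → ℝ) × ℝ =>
      Real.exp (4 * B * k * (n * devCurv μ θ p.1 p.2 ^ 2)) := by
    have := continuous_devCurv_uncurry (n := n) (μ := μ) (θ := θ)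
    fun_prop
  have hbd : ∀ p : (Fin n → ℝ) × ℝ, |Real.exp (4 * B * k * (n * devCurv μ θ p.1 p.2 ^ 2))| ≤
      Real.exp (4 * B * k * (n * (2 * θ) ^ 2)) := by
    intro p
    rw [Real.abs_exp]
    have h1 : devCurv μ θ p.1 p.2 ^ 2 ≤ (2 * θ) ^ 2 := by
      rw [← sq_abs]; gcongr; exact abs_devCurv_le hθ _ _
    gcongr
  have hprod : Integrable (Function.uncurry fun (h : Fin n → ℝ) (y : ℝ) =>
      Real.exp (4 * B * k * (n * devCurv μ θ h y ^ 2)))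
      (P.prod (volume.restrict (Set.Icc (x - B) (x + B)))) :=
    Integrable.of_bound hu.aestronglyMeasurable _ (Eventually.of_forall hbd)
  have hfirst : Integrable (fun h => Real.exp (2 * k * (n * devSlope μ θ h x ^ 2))) P := by
    have := continuous_devSlope_left (n := n) (μ := μ) (θ := θ) x
    refine integrable_of_continuous_bounded (C := Real.exp (2 * k * (n * (√θ * 2) ^ 2)))
      (by fun_prop) fun h => ?_
    rw [Real.abs_exp]
    have h1 : devSlope μ θ h x ^ 2 ≤ (√θ * 2) ^ 2 := by
      rw [← sq_abs]; gcongr; exact abs_devSlope_le_two h x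
    gcongr
  have hsecond : Integrable (fun h => ∫ y in Set.Icc (x - B) (x + B),
      Real.exp (4 * B * k * (n * devCurv μ θ h y ^ 2))) P := hprod.integral_prod_left
  have hswap : ∫ h, (∫ y in Set.Icc (x - B) (x + B),
      Real.exp (4 * B * k * (n * devCurv μ θ h y ^ 2))) ∂P ≤ 2 * (2 * B) := by
    rw [integral_integral_swap hprod]
    have h1 := norm_setIntegral_le_of_norm_le_const (μ := volume) (s := Set.Icc (x - B) (x + B))
      (f := fun y => ∫ h, Real.exp (4 * B * k * (n * devCurv μ θ h y ^ 2)) ∂P) (C := 2) (by simp)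
      (fun y _ => by
        rw [Real.norm_of_nonneg (integral_nonneg fun h => (Real.exp_pos _).le)]
        exact integral_exp_devCurv_le hn y (by positivity) hk2)
    rw [hvol] at h1
    exact (le_abs_self _).trans h1
  calc _ ≤ ∫ h, Real.exp k * (1 / 2 * Real.exp (2 * k * (n * devSlope μ θ h x ^ 2)) +
        1 / 2 * ((2 * B)⁻¹ * ∫ y in Set.Icc (x - B) (x + B),
        Real.exp (4 * B * k * (n * devCurv μ θ h y ^ 2)))) ∂P :=
        integral_mono (integrable_exp_fluct hθ x hB _)
          (((hfirst.const_mul _).add ((hsecond.const_mul _).const_mul _)).const_mul _) pointwise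
    _ = Real.exp k * (1 / 2 * (∫ h, Real.exp (2 * k * (n * devSlope μ θ h x ^ 2)) ∂P) +
        1 / 2 * ((2 * B)⁻¹ * ∫ h, (∫ y in Set.Icc (x - B) (x + B),
        Real.exp (4 * B * k * (n * devCurv μ θ h y ^ 2))) ∂P)) := by
        rw [integral_const_mul, integral_add (hfirst.const_mul _)
          ((hsecond.const_mul _).const_mul _)]
        simp only [integral_const_mul]
    _ ≤ Real.exp k * (1 / 2 * 2 + 1 / 2 * ((2 * B)⁻¹ * (2 * (2 * B)))) := by
        gcongr
        exact integral_exp_devSlope_le hn hθ x (by positivity) hk1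
    _ = _ := by field_simp; norm_num

end Moments

/-! ### Tightness of Laplace-type integrals -/

section Laplace

lemma integral_abs_pow_mul_exp {b : ℝ} (hb : 0 < b) (k : ℕ) :
    ∫ z : ℝ, |z| ^ k * Real.exp (-b * |z| ^ (k + 1)) = 2 / (b * (k + 1)) := by
  have e : ∀ x ∈ Set.Ioi (0 : ℝ), x ^ (k : ℝ) * Real.exp (-b * x ^ ((k + 1 : ℕ) : ℝ)) =
      x ^ k * Real.exp (-b * x ^ (k + 1)) := fun x _ => by
    rw [Real.rpow_natCast, Real.rpow_natCast]
  rw [integral_comp_abs (f := fun x : ℝ => x ^ k * Real.exp (-b * x ^ (k + 1))),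
    ← setIntegral_congr_fun measurableSet_Ioi e,
    integral_rpow_mul_exp_neg_mul_rpow (by positivity)
      (by have : (0 : ℝ) ≤ k := by positivity
          linarith) hb]
  have h3 : (k + 1 : ℝ) ≠ 0 := by positivity
  push_cast
  rw [neg_div, div_self h3, Real.Gamma_one, Real.rpow_neg hb.le, Real.rpow_one]
  field_simp

lemma integrable_abs_pow_mul_exp {b : ℝ} (hb : 0 < b) (k : ℕ) :
    Integrable (fun z : ℝ => |z| ^ k * Real.exp (-b * |z| ^ (k + 1))) :=
  Integrable.of_integral_ne_zero (by rw [integral_abs_pow_mul_exp hb]; positivity)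

variable {F : ℝ → ℝ} {N a r C₀ x : ℝ}

lemma integral_exp_ge (hF : Continuous F) (hN : 1 ≤ N) (ha : 0 < a) (hNa : 1 ≤ N * a ^ 2)
    (hr : 0 < r) (hC : 0 ≤ C₀)
    (hup : ∀ y, |y - x| ≤ r → F y ≤ C₀ * |y - x| ^ 2 + a * |y - x|) :
    min r 1 * Real.exp (-(1 + C₀)) / (N * a) ≤
      ∫ y in Metric.closedBall x r, Real.exp (-N * F y) := by
  set ρ := min r 1 with hρ
  have hρ0 : 0 < ρ := by positivity
  have hN0 : 0 < N := by linarith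
  have hNa1 : 1 ≤ N * a := by nlinarith [mul_pos hN0 ha]
  have hlen : ρ / (N * a) ≤ ρ := div_le_self hρ0.le hNa1
  have hsub : Set.Icc x (x + ρ / (N * a)) ⊆ Metric.closedBall x r := by
    intro y hy
    rw [Metric.mem_closedBall, Real.dist_eq, abs_of_nonneg (by linarith [hy.1])]
    linarith [hy.2, min_le_left r 1]
  have hc : Continuous fun y => Real.exp (-N * F y) := by fun_prop
  have hI : IntegrableOn (fun y => Real.exp (-N * F y)) (Metric.closedBall x r) :=
    hc.continuousOn.integrableOn_compact (isCompact_closedBall _ _)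
  calc _ = ∫ y in Set.Icc x (x + ρ / (N * a)), Real.exp (-(1 + C₀)) := by
        rw [setIntegral_const, Real.volume_real_Icc_of_le (by
          have : 0 < ρ / (N * a) := by positivity
          linarith), smul_eq_mul]
        ring
    _ ≤ ∫ y in Set.Icc x (x + ρ / (N * a)), Real.exp (-N * F y) := by
        refine setIntegral_mono_on (integrableOn_const (by simp)) (hI.mono_set hsub)
          measurableSet_Icc fun y hy => ?_
        rw [Real.exp_le_exp]
        have h1 := hup y (by simpa [Real.dist_eq] using hsub hy)
        rw [abs_of_nonneg (by linarith [hy.1])] at h1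
        have h2 : 0 ≤ y - x := by linarith [hy.1]
        have h3 : y - x ≤ ρ / (N * a) := by linarith [hy.2]
        have h4 : (y - x) * (N * a) ≤ ρ := by rwa [le_div_iff₀ (by positivity)] at h3
        have h5 : ρ ≤ 1 := min_le_right _ _
        have h6 : N * (y - x) ^ 2 ≤ 1 := by
          have h7 : ((y - x) * (N * a)) ^ 2 ≤ 1 := by
            have : 0 ≤ (y - x) * (N * a) := by positivity
            nlinarith
          have h8 : N * (y - x) ^ 2 ≤ N * (y - x) ^ 2 * (N * a ^ 2) :=
            le_mul_of_one_le_right (by positivity) hNa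
          nlinarith
        have h9 : N * F y ≤ C₀ * (N * (y - x) ^ 2) + (y - x) * (N * a) := by nlinarith
        nlinarith
    _ ≤ _ := setIntegral_mono_set hI (Eventually.of_forall fun y => (Real.exp_pos _).le)
        (Eventually.of_forall hsub)

lemma integral_exp_weighted_le (hF : Continuous F) (hN : 1 ≤ N) (ha : 0 < a)
    (hNa : 1 ≤ N * a ^ 2) (hr : 0 < r) (hC : 0 ≤ C₀)
    (hup : ∀ y, |y - x| ≤ r → F y ≤ C₀ * |y - x| ^ 2 + a * |y - x|)
    {E : Set ℝ} (hE : MeasurableSet E) {B c κ : ℝ} {k : ℕ} (hk : 1 ≤ k) (hc : 0 < c) (hκ : 0 ≤ κ)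
    (hEB : ∀ y ∈ E, |y - x| ≤ B) (hκB : κ * B ^ (k - 1) ≤ c / 4)
    (hlow : ∀ y ∈ E, c * |y - x| ^ (k + 1) - a * |y - x| ≤ F y)
    (har : 4 / c * a ≤ r ^ k) :
    ∫ y in E, Real.exp (κ * (N * |y - x| ^ (2 * k))) * Real.exp (-N * F y) ≤
      (Real.exp (κ * ((4 / c) ^ 2 * (N * a ^ 2))) + (min r 1 * Real.exp (-(1 + C₀)))⁻¹) *
        ∫ y in Metric.closedBall x r, Real.exp (-N * F y) := by
  have hN0 : 0 < N := by linarith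
  set L := 4 / c with hL
  have hL0 : 0 < L := by positivity
  have hlo := integral_exp_ge hF hN ha hNa hr hC hup
  set J := ∫ y in Metric.closedBall x r, Real.exp (-N * F y) with hJ
  set S := {y : ℝ | |y - x| ^ k ≤ L * a} with hS
  have hSm : MeasurableSet S := (isClosed_le (by fun_prop) continuous_const).measurableSet
  have hSr : S ⊆ Metric.closedBall x r := by
    intro y hy
    rw [Metric.mem_closedBall, Real.dist_eq]
    exact (pow_le_pow_iff_left₀ (abs_nonneg _) hr.le (by omega)).1 (le_trans hy har)
  have hcont : Continuous fun y => Real.exp (κ * (N * |y - x| ^ (2 * k))) * Real.exp (-N * F y) := by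
    fun_prop
  have hcont' : Continuous fun y => Real.exp (-N * F y) := by fun_prop
  have hEI : IntegrableOn (fun y => Real.exp (κ * (N * |y - x| ^ (2 * k))) * Real.exp (-N * F y)) E :=
    (hcont.continuousOn.integrableOn_compact (isCompact_closedBall x B)).mono_set fun y hy => by
      simpa [Real.dist_eq] using hEB y hy
  have hBI : IntegrableOn (fun y => Real.exp (-N * F y)) (Metric.closedBall x r) :=
    hcont'.continuousOn.integrableOn_compact (isCompact_closedBall _ _)
  have hcE : 0 < c * N / 2 := by positivity
  have hgI : Integrable fun y : ℝ => (L * a)⁻¹ *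
      (|y - x| ^ k * Real.exp (-(c * N / 2) * |y - x| ^ (k + 1))) :=
    ((integrable_abs_pow_mul_exp hcE k).comp_sub_right x).const_mul _
  rw [← integral_inter_add_sdiff hSm hEI, add_mul]
  refine add_le_add ?_ ?_
  · calc _ ≤ ∫ y in E ∩ S, Real.exp (κ * (L ^ 2 * (N * a ^ 2))) * Real.exp (-N * F y) := by
          refine setIntegral_mono_on (hEI.mono_set Set.inter_subset_left)
            ((hBI.mono_set (Set.inter_subset_right.trans hSr)).const_mul _) (hE.inter hSm)
            fun y hy => ?_
          have h1 : |y - x| ^ (2 * k) ≤ (L * a) ^ 2 := by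
            rw [mul_comm 2 k, pow_mul]
            exact pow_le_pow_left₀ (by positivity) hy.2 2
          have h2 : L ^ 2 * (N * a ^ 2) = N * (L * a) ^ 2 := by ring
          rw [h2]
          gcongr
      _ = Real.exp (κ * (L ^ 2 * (N * a ^ 2))) * ∫ y in E ∩ S, Real.exp (-N * F y) :=
          integral_const_mul _ _
      _ ≤ _ := by
          gcongr
          exact setIntegral_mono_set hBI (Eventually.of_forall fun y => (Real.exp_pos _).le)
            (Eventually.of_forall (Set.inter_subset_right.trans hSr))
  · have h1 : ∫ y in E \ S, Real.exp (κ * (N * |y - x| ^ (2 * k))) * Real.exp (-N * F y) ≤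
        1 / (N * a) := by
      calc _ ≤ ∫ y in E \ S, (L * a)⁻¹ *
          (|y - x| ^ k * Real.exp (-(c * N / 2) * |y - x| ^ (k + 1))) := by
            refine setIntegral_mono_on (hEI.mono_set Set.sdiff_subset) hgI.integrableOn
              (hE.diff hSm) fun y hy => ?_
            have hyS : L * a < |y - x| ^ k := not_le.1 hy.2
            set z := |y - x| with hz
            have hz0 : 0 ≤ z := abs_nonneg _
            have h2 : 1 ≤ (L * a)⁻¹ * z ^ k := by
              rw [le_inv_mul_iff₀ (by positivity)]; linarith
            have h3 : κ * z ^ (2 * k) ≤ c / 4 * z ^ (k + 1) := by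
              have e : z ^ (2 * k) = z ^ (k - 1) * z ^ (k + 1) := by
                rw [← pow_add]; congr 1; omega
              rw [e, ← mul_assoc]
              refine mul_le_mul_of_nonneg_right (le_trans ?_ hκB) (by positivity)
              exact mul_le_mul_of_nonneg_left (pow_le_pow_left₀ hz0 (hEB y hy.1) _) hκ
            have h4 : a * z ≤ c / 4 * z ^ (k + 1) := by
              have : a ≤ c / 4 * z ^ k := by
                have h5 : c / 4 * (L * a) = a := by rw [hL]; field_simp
                rw [← h5]
                gcongr
              calc a * z ≤ c / 4 * z ^ k * z := by gcongr
                _ = _ := by ring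
            have h5 := hlow y hy.1
            rw [← Real.exp_add]
            calc _ ≤ 1 * Real.exp (-(c * N / 2) * z ^ (k + 1)) := by
                  rw [one_mul, Real.exp_le_exp]
                  nlinarith
              _ ≤ (L * a)⁻¹ * z ^ k * Real.exp (-(c * N / 2) * z ^ (k + 1)) :=
                  mul_le_mul_of_nonneg_right h2 (Real.exp_pos _).le
              _ = _ := mul_assoc _ _ _
        _ ≤ ∫ y, (L * a)⁻¹ * (|y - x| ^ k * Real.exp (-(c * N / 2) * |y - x| ^ (k + 1))) :=
            setIntegral_le_integral hgI (Eventually.of_forall fun y => by positivity)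
        _ = (L * a)⁻¹ * (2 / (c * N / 2 * (k + 1))) := by
            rw [integral_const_mul, integral_sub_right_eq_self
              (fun y : ℝ => |y| ^ k * Real.exp (-(c * N / 2) * |y| ^ (k + 1))) x,
              integral_abs_pow_mul_exp hcE]
        _ = (1 / (N * a)) * (1 / (k + 1)) := by
            rw [hL]; field_simp; norm_num
        _ ≤ 1 / (N * a) := by
            refine mul_le_of_le_one_right (by positivity) ?_
            rw [div_le_one (by positivity)]
            have : (0 : ℝ) ≤ k := by positivity
            linarith
    refine h1.trans ?_
    rw [le_inv_mul_iff₀ (by positivity)]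
    refine le_trans (le_of_eq ?_) hlo
    ring

end Laplace

/-! ### Phases -/

section Tightness

variable {μ : Measure ℝ} {θ x₁ ρ B r c ω : ℝ} {k : ℕ}
  {A : ∀ n : ℕ, Finset (Config n)} {D D' : Set ℝ}

/-- A minimum `x₁` of `H` of order `k + 1` together with the configurations `A n` it dominates,
and the corresponding values `D` of the auxiliary variable. -/
structure Phase (μ : Measure ℝ) (θ x₁ : ℝ) (k : ℕ) (A : ∀ n : ℕ, Finset (Config n))
    (D D' : Set ℝ) (ρ B r c ω : ℝ) : Prop where
  integrable : Integrable (fun h : ℝ => h) μ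
  theta_pos : 0 < θ
  crit : x₁ = √θ * meanTanh μ θ x₁
  one_le_k : 1 ≤ k
  le_B : 4 * (|x₁| + √θ) + 1 ≤ B
  r_pos : 0 < r
  r_le : r ≤ B
  c_pos : 0 < c
  omega_pos : 0 < ω
  omega_le : ω ≤ 1
  ball_subset : Metric.closedBall x₁ r ⊆ D
  measurable' : MeasurableSet D'
  thick : ∀ y ∈ D, ∀ z, |z - y| ≤ ω → z ∈ D'
  nonempty : ∀ n, 0 < n → (A n).Nonempty
  mem_D : ∀ n, 0 < n → ∀ σ ∈ A n, √θ * totalSpin σ / n ∈ D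
  approx : ∀ n, 0 < n → ∀ h : Fin n → ℝ, RegionApprox θ h ρ (A n) D
  lower : ∀ y ∈ D', |y - x₁| ≤ B → c * |y - x₁| ^ (k + 1) ≤ H μ θ y - H μ θ x₁
  gap : ρ = 0 ∨ (ρ = 1 ∧ H μ θ x₁ < H μ θ 0)

lemma gibbs_le_of_le {n : ℕ} {h : Fin n → ℝ} {A : Finset (Config n)}
    (hA : A.Nonempty) {f : Config n → ℝ} {C : ℝ} (hf : ∀ σ ∈ A, f σ ≤ C) : gibbs θ h A f ≤ C := by
  have hZ : 0 < ∑ σ ∈ A, weight θ h σ := Finset.sum_pos (fun σ _ => weight_pos θ h σ) hA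
  rw [gibbs, div_le_iff₀ hZ, Finset.mul_sum]
  refine Finset.sum_le_sum fun σ hσ => ?_
  rw [mul_comm]
  exact mul_le_mul_of_nonneg_right (hf σ hσ) (weight_pos θ h σ).le

lemma exists_forall_mul_exp_neg_le {b : ℝ} (hb : 0 < b) (C : ℝ) {δ : ℝ} (hδ : 0 < δ) :
    ∃ n₀ : ℕ, ∀ n : ℕ, n₀ ≤ n → C * (n * Real.exp (-(b * n))) ≤ δ := by
  have h1 : Tendsto (fun n : ℕ => b * (n : ℝ)) atTop atTop :=
    tendsto_natCast_atTop_atTop.const_mul_atTop hb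
  have h2 := ((Real.tendsto_pow_mul_exp_neg_atTop_nhds_zero 1).comp h1).const_mul (C / b)
  rw [mul_zero] at h2
  obtain ⟨n₀, hn₀⟩ := eventually_atTop.1 (h2.eventually (ge_mem_nhds hδ))
  refine ⟨n₀, fun n hn => le_trans (le_of_eq ?_) (hn₀ n hn)⟩
  simp only [Function.comp, pow_one]
  field_simp

variable [IsProbabilityMeasure μ]

namespace Phase

lemma B_pos (P : Phase μ θ x₁ k A D D' ρ B r c ω) : 0 < B := by
  have := P.le_B
  have := abs_nonneg x₁
  have := Real.sqrt_nonneg θ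
  linarith

lemma two_sqrt_le (P : Phase μ θ x₁ k A D D' ρ B r c ω) : 2 * √θ + 1 ≤ B := by
  have := P.le_B
  have := abs_nonneg x₁
  have := Real.sqrt_nonneg θ
  linarith

lemma empH_lower (P : Phase μ θ x₁ k A D D' ρ B r c ω) {n : ℕ} (hn : 0 < n) (h : Fin n → ℝ) {y : ℝ}
    (hy : y ∈ D') (hyB : |y - x₁| ≤ B) :
    c * |y - x₁| ^ (k + 1) - fluct μ θ x₁ B h * |y - x₁| ≤ empH θ h y - empH θ h x₁ := by
  have h1 := abs_empH_dev_le (h := h) P.integrable hn P.theta_pos hyB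
  have h2 := P.lower y hy hyB
  linarith [(abs_le.1 h1).1]

lemma empH_upper (P : Phase μ θ x₁ k A D D' ρ B r c ω) {n : ℕ} (hn : 0 < n) (h : Fin n → ℝ) {y : ℝ}
    (hyB : |y - x₁| ≤ B) :
    empH θ h y - empH θ h x₁ ≤ (1 + θ) * |y - x₁| ^ 2 + fluct μ θ x₁ B h * |y - x₁| := by
  have h1 := abs_empH_dev_le (h := h) P.integrable hn P.theta_pos hyB
  have h2 := abs_H_sub_le P.integrable P.theta_pos P.crit y
  linarith [(abs_le.1 h1).2, (abs_le.1 h2).2]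

lemma abs_mag_sub_le {n : ℕ} (hn : 0 < n) (σ : Config n) :
    |totalSpin σ / n - meanTanh μ θ x₁| ≤ 2 := by
  have h1 : |totalSpin σ / n| ≤ 1 := by
    rw [abs_div, Nat.abs_cast, div_le_one (by positivity)]
    exact abs_totalSpin_le σ
  have h2 := abs_meanTanh_le (μ := μ) (θ := θ) x₁
  exact (abs_sub _ _).trans (by linarith)

lemma window_dist (P : Phase μ θ x₁ k A D D' ρ B r c ω) {n : ℕ} {σ : Config n}
    {y : ℝ} (hy : |y - √θ * totalSpin σ / n| ≤ ω / √n) :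
    |(y - x₁) - √θ * (totalSpin σ / n - meanTanh μ θ x₁)| ≤ ω / √n := by
  convert hy using 2
  nth_rw 1 [P.crit]
  ring

lemma omega_div_le (P : Phase μ θ x₁ k A D D' ρ B r c ω) {n : ℕ} (hn : 0 < n) : ω / √n ≤ ω := by
  refine div_le_self P.omega_pos.le ?_
  rw [Real.one_le_sqrt]
  exact_mod_cast hn

lemma window_mem (P : Phase μ θ x₁ k A D D' ρ B r c ω) {n : ℕ} (hn : 0 < n) {σ : Config n}
    (hσ : σ ∈ A n) {y : ℝ} (hy : |y - √θ * totalSpin σ / n| ≤ ω / √n) :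
    y ∈ D' ∩ Metric.closedBall x₁ B := by
  refine ⟨P.thick _ (P.mem_D n hn σ hσ) y (hy.trans (P.omega_div_le hn)), ?_⟩
  rw [Metric.mem_closedBall, Real.dist_eq]
  have h1 := P.window_dist hy
  have h2 := P.omega_div_le hn
  have h3 := P.omega_le
  have h4 := abs_mag_sub_le (μ := μ) (θ := θ) (x₁ := x₁) hn σ
  have h5 := P.two_sqrt_le
  have h6 : |√θ * (totalSpin σ / n - meanTanh μ θ x₁)| ≤ √θ * 2 := by
    rw [abs_mul, abs_of_nonneg (Real.sqrt_nonneg θ)]; gcongr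
  have h7 := abs_sub_abs_le_abs_sub (y - x₁) (√θ * (totalSpin σ / n - meanTanh μ θ x₁))
  linarith

/-- For moderate fluctuations and large `n`, the partition function over `A n` is at least half of
the contribution of a neighbourhood of `x₁`. -/
lemma exists_partition_ge (P : Phase μ θ x₁ k A D D' ρ B r c ω) :
    ∃ a₀ : ℝ, 0 < a₀ ∧ ∃ n₀ : ℕ, ∀ n : ℕ, 0 < n → n₀ ≤ n → ∀ h : Fin n → ℝ,
      fluct μ θ x₁ B h ≤ a₀ →
      normConst θ h x₁ * (1 / 2 * ∫ y in Metric.closedBall x₁ r,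
        Real.exp (-n * (empH θ h y - empH θ h x₁))) ≤ ∑ σ ∈ A n, weight θ h σ := by
  set η := H μ θ 0 - H μ θ x₁ with hη
  set c₁ := min r 1 * Real.exp (-(1 + (1 + θ))) with hc₁
  have hr := P.r_pos
  have hθ := P.theta_pos
  have hc₁0 : 0 < c₁ := by positivity
  set a₀ := if ρ = 0 then 1 else η / (2 * (|x₁| + 1)) with ha₀
  have ha₀0 : 0 < a₀ := by
    rw [ha₀]
    split_ifs with h0
    · exact one_pos
    · have : 0 < η := sub_pos.2 (P.gap.resolve_left h0).2
      positivity
  have key : ∃ n₀ : ℕ, ∀ n : ℕ, n₀ ≤ n →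
      ρ * (a₀ * √(2 * Real.pi) * (n * Real.exp (-(η / 2 * n)))) ≤ 1 / 2 * c₁ := by
    rcases P.gap with h0 | ⟨h1, hg⟩
    · exact ⟨0, fun n _ => by rw [h0, zero_mul]; positivity⟩
    · rw [h1]
      simp only [one_mul]
      exact exists_forall_mul_exp_neg_le (half_pos (sub_pos.2 hg)) _ (by positivity)
  obtain ⟨n₀, hn₀⟩ := key
  refine ⟨a₀, ha₀0, n₀, fun n hn hnn h hfl => ?_⟩
  have hn' : (0 : ℝ) < n := by positivity
  set a := fluct μ θ x₁ B h with ha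
  have ha0 : 0 < a := fluct_pos hn
  set J := ∫ y in Metric.closedBall x₁ r, Real.exp (-n * (empH θ h y - empH θ h x₁)) with hJ
  have hcont : Continuous fun y => empH θ h y - empH θ h x₁ := (continuous_empH θ h).sub continuous_const
  have hJlow : c₁ / (n * a) ≤ J := integral_exp_ge hcont (by exact_mod_cast hn) ha0
    (one_le_mul_fluct_sq hn) hr (by positivity) fun y hy => P.empH_upper hn h (hy.trans P.r_le)
  have hap := (P.approx n hn h).2 (fun _ => 1) 1 (fun _ => by simp)
  simp only [mul_one, one_mul] at hap
  have hI := integrable_exp_empH hθ hn h x₁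
  have hDint : normConst θ h x₁ * J ≤ ∫ y in D, ∑ σ, joint θ h σ y := by
    simp_rw [sum_joint_eq_normConst hn h x₁]
    rw [integral_const_mul]
    refine mul_le_mul_of_nonneg_left ?_ (normConst_pos hn θ h x₁).le
    exact setIntegral_mono_set hI.integrableOn (Eventually.of_forall fun y => (Real.exp_pos _).le)
      (Eventually.of_forall P.ball_subset)
  have herr : ρ * (2 ^ n * Real.exp (-n * empH θ h 0)) ≤ normConst θ h x₁ * (1 / 2 * J) := by
    rcases P.gap with h0 | ⟨h1, hg⟩
    · rw [h0, zero_mul]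
      have : 0 ≤ J := integral_nonneg fun y => (Real.exp_pos _).le
      have := normConst_pos hn θ h x₁
      positivity
    · have hρ0 : ρ ≠ 0 := by rw [h1]; norm_num
      have hη0 : 0 < η := sub_pos.2 hg
      have hx1 : |0 - x₁| ≤ B := by
        have := P.le_B
        have := abs_nonneg x₁
        have := Real.sqrt_nonneg θ
        rw [zero_sub, abs_neg]; linarith
      have hdev := (abs_le.1 (abs_empH_dev_le (h := h) P.integrable hn hθ hx1)).1
      have hax : a * |0 - x₁| ≤ η / 2 := by
        rw [zero_sub, abs_neg]
        have : a ≤ η / (2 * (|x₁| + 1)) := by rw [ha₀, if_neg hρ0] at hfl; exact hfl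
        rw [le_div_iff₀ (by positivity)] at this
        nlinarith [abs_nonneg x₁]
      have hK0 : η / 2 ≤ empH θ h 0 - empH θ h x₁ := by
        have : -(a * |0 - x₁|) ≤ empH θ h 0 - empH θ h x₁ - η := hdev
        linarith
      have hN := hn₀ n hnn
      rw [h1, one_mul] at hN
      rw [h1, one_mul, normConst, mul_assoc √_, ← mul_assoc, mul_comm √_, mul_assoc]
      have hexp : Real.exp (-n * empH θ h 0) ≤
          Real.exp (-n * empH θ h x₁) * Real.exp (-(η / 2 * n)) := by
        rw [← Real.exp_add, Real.exp_le_exp]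
        nlinarith
      have hsq : Real.exp (-(η / 2 * n)) ≤ √(n / (2 * Real.pi)) * (1 / 2 * J) := by
        have hp := Real.pi_pos
        have h3 : c₁ / (n * a₀) ≤ J := le_trans (by gcongr) hJlow
        have h4 : 1 / √(2 * Real.pi) ≤ √(n / (2 * Real.pi)) := by
          rw [Real.sqrt_div hn'.le]
          gcongr
          rw [Real.one_le_sqrt]
          exact_mod_cast hn
        have h5 : 0 < √(2 * Real.pi) := by positivity
        calc Real.exp (-(η / 2 * n)) ≤ 1 / √(2 * Real.pi) * (1 / 2 * (c₁ / (n * a₀))) := by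
              generalize Real.exp (-(η / 2 * n)) = e at hN
              field_simp
              linarith
          _ ≤ _ := by gcongr
      calc 2 ^ n * Real.exp (-n * empH θ h 0) ≤ 2 ^ n * (Real.exp (-n * empH θ h x₁) *
            (√(n / (2 * Real.pi)) * (1 / 2 * J))) := by
            gcongr
            exact hexp.trans (by gcongr)
        _ = _ := by ring
  have := (abs_le.1 hap).1
  have hfin : ∀ a b c d : ℝ, a * d ≤ b → c ≤ a * (1 / 2 * d) → a * (1 / 2 * d) ≤ b - c := by
    intro a b c d h1 h2; linarith
  have h6 := hfin _ _ _ _ hDint herr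
  linarith

/-- Exponential tightness of the magnetization, with explicit dependence on the fluctuations of
the field. -/
theorem exists_gibbs_exp_le (P : Phase μ θ x₁ k A D D' ρ B r c ω) :
    ∃ κ₀ : ℝ, 0 < κ₀ ∧ ∃ C C' : ℝ, 0 < C ∧ 0 < C' ∧ ∀ κ : ℝ, 0 < κ → κ ≤ κ₀ → ∀ n : ℕ, 0 < n →
      ∀ h : Fin n → ℝ,
      gibbs θ h (A n) (fun σ =>
        Real.exp (κ * (n * |totalSpin σ / n - meanTanh μ θ x₁| ^ (2 * k)))) ≤
        C * Real.exp (κ * (C' * (n * fluct μ θ x₁ B h ^ 2))) := by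
  obtain ⟨a₀, ha₀, n₀, hpart⟩ := P.exists_partition_ge
  have hθ := P.theta_pos
  have hc := P.c_pos
  have hr := P.r_pos
  have hB := P.B_pos
  have hω := P.omega_pos
  have hk := P.one_le_k
  set C₃ : ℝ := 4 ^ k / θ ^ k with hC₃
  have hC₃0 : 0 < C₃ := by positivity
  set a₁ := min a₀ (c / 4 * r ^ k) with ha₁
  have ha₁0 : 0 < a₁ := by positivity
  set κ₀ := min (C₃⁻¹ * (c / 4) / B ^ (k - 1)) C₃⁻¹ with hκ₀
  have hκ₀0 : 0 < κ₀ := by positivity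
  set G := (min r 1 * Real.exp (-(1 + (1 + θ))))⁻¹ with hG
  have hG0 : 0 < G := by positivity
  have hW := windowMass_pos hω
  refine ⟨κ₀, hκ₀0, (windowMass ω)⁻¹ * (Real.exp 1 * ((1 + G) * 2)) + Real.exp (κ₀ * (n₀ * 4 ^ k)),
    C₃ * (4 / c) ^ 2 + 4 ^ k / a₁ ^ 2, by positivity, by positivity, fun κ hκ hκle n hn h => ?_⟩
  have hn' : (0 : ℝ) < n := by positivity
  set a := fluct μ θ x₁ B h with ha
  have ha0 : 0 < a := fluct_pos hn
  have htriv : ∀ σ : Config n, Real.exp (κ * (n * |totalSpin σ / n - meanTanh μ θ x₁| ^ (2 * k))) ≤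
      Real.exp (κ * (n * 4 ^ k)) := by
    intro σ
    have h1 : |totalSpin σ / n - meanTanh μ θ x₁| ^ (2 * k) ≤ 4 ^ k := by
      rw [pow_mul]
      refine pow_le_pow_left₀ (by positivity) ?_ _
      have := abs_mag_sub_le (μ := μ) (θ := θ) (x₁ := x₁) hn σ
      nlinarith [abs_nonneg (totalSpin σ / n - meanTanh μ θ x₁)]
    gcongr
  have hone : (1 : ℝ) ≤ Real.exp (κ * ((C₃ * (4 / c) ^ 2 + 4 ^ k / a₁ ^ 2) * (n * a ^ 2))) :=
    Real.one_le_exp (by positivity)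
  rcases lt_or_ge n n₀ with hlt | hge
  · refine (gibbs_le_of_le (P.nonempty n hn) fun σ _ => htriv σ).trans ?_
    have h1 : Real.exp (κ * (n * 4 ^ k)) ≤ Real.exp (κ₀ * (n₀ * 4 ^ k)) := by gcongr
    refine h1.trans ?_
    refine le_trans ?_ (le_mul_of_one_le_right (by positivity) hone)
    exact le_add_of_nonneg_left (by positivity)
  rcases lt_or_ge a₁ a with hlt | hle
  · refine (gibbs_le_of_le (P.nonempty n hn) fun σ _ => htriv σ).trans ?_
    have h1 : Real.exp (κ * (n * 4 ^ k)) ≤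
        Real.exp (κ * ((C₃ * (4 / c) ^ 2 + 4 ^ k / a₁ ^ 2) * (n * a ^ 2))) := by
      refine Real.exp_le_exp.2 (mul_le_mul_of_nonneg_left ?_ hκ.le)
      calc (n : ℝ) * 4 ^ k = 4 ^ k / a₁ ^ 2 * (n * a₁ ^ 2) := by field_simp
        _ ≤ (C₃ * (4 / c) ^ 2 + 4 ^ k / a₁ ^ 2) * (n * a ^ 2) := by
          gcongr
          exact le_add_of_nonneg_left (by positivity)
    refine h1.trans (le_mul_of_one_le_left (Real.exp_pos _).le ?_)
    have : 1 ≤ Real.exp (κ₀ * (n₀ * 4 ^ k)) := Real.one_le_exp (by positivity)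
    have h2 : 0 ≤ (windowMass ω)⁻¹ * (Real.exp 1 * ((1 + G) * 2)) := by positivity
    linarith
  have hcont : Continuous fun y => empH θ h y - empH θ h x₁ := (continuous_empH θ h).sub continuous_const
  have hZ := hpart n hn hge h (hle.trans (min_le_left _ _))
  set J := ∫ y in Metric.closedBall x₁ r, Real.exp (-n * (empH θ h y - empH θ h x₁)) with hJ
  set κ₁ := κ * C₃ with hκ₁
  have hκ₁0 : 0 < κ₁ := by positivity
  have hκ₁1 : κ₁ ≤ 1 := by
    have := hκle.trans (min_le_right _ _)
    rw [← one_div, le_div_iff₀ hC₃0] at this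
    exact this
  have hκ₁B : κ₁ * B ^ (k - 1) ≤ c / 4 := by
    have := hκle.trans (min_le_left _ _)
    rw [le_div_iff₀ (by positivity)] at this
    calc _ = C₃ * (κ * B ^ (k - 1)) := by ring
      _ ≤ C₃ * (C₃⁻¹ * (c / 4)) := by gcongr
      _ = _ := by field_simp
  set E := D' ∩ Metric.closedBall x₁ B with hE
  have hEm : MeasurableSet E := P.measurable'.inter Metric.isClosed_closedBall.measurableSet
  have hlap := integral_exp_weighted_le (x := x₁) (N := n) (k := k) (κ := κ₁) (c := c) (B := B) hcont
    (by exact_mod_cast hn) ha0 (one_le_mul_fluct_sq hn) hr (by positivity : 0 ≤ 1 + θ)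
    (fun y hy => P.empH_upper hn h (hy.trans P.r_le)) hEm hk hc hκ₁0.le
    (fun y hy => by simpa [Real.dist_eq] using hy.2) hκ₁B
    (fun y hy => P.empH_lower hn h hy.1 (by simpa [Real.dist_eq] using hy.2))
    (by
      have : a ≤ c / 4 * r ^ k := hle.trans (min_le_right _ _)
      calc 4 / c * a ≤ 4 / c * (c / 4 * r ^ k) := by gcongr
        _ = _ := by field_simp)
  set Φ : ℝ → ℝ := E.indicator fun y => Real.exp 1 * Real.exp (κ₁ * (n * |y - x₁| ^ (2 * k))) with hΦ
  have hΦ0 : ∀ y, 0 ≤ Φ y := fun y => Set.indicator_nonneg (fun _ _ => by positivity) _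
  have hΦint : ∀ σ, Integrable fun y => Φ y * joint θ h σ y := by
    intro σ
    have hc1 : Continuous fun y =>
        Real.exp 1 * Real.exp (κ₁ * (n * |y - x₁| ^ (2 * k))) * joint θ h σ y := by
      have := continuous_joint θ h σ
      fun_prop
    have h1 : IntegrableOn (fun y => Real.exp 1 * Real.exp (κ₁ * (n * |y - x₁| ^ (2 * k))) *
        joint θ h σ y) E :=
      (hc1.continuousOn.integrableOn_compact (isCompact_closedBall x₁ B)).mono_set
        Set.inter_subset_right
    refine (h1.integrable_indicator hEm).congr (Eventually.of_forall fun y => ?_)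
    simp only [hΦ, Set.indicator]
    split_ifs <;> simp
  have hwin : ∀ σ ∈ A n, ∀ y, |y - √θ * totalSpin σ / n| ≤ ω / √n →
      Real.exp (κ * (n * |totalSpin σ / n - meanTanh μ θ x₁| ^ (2 * k))) ≤ Φ y := by
    intro σ hσ y hy
    rw [hΦ, Set.indicator_of_mem (P.window_mem hn hσ hy), ← Real.exp_add, Real.exp_le_exp]
    set m := totalSpin σ / n - meanTanh μ θ x₁ with hm
    have h1 := P.window_dist hy
    have h2 : √θ * |m| ≤ |y - x₁| + 1 / √n := by
      have h3 := abs_sub_abs_le_abs_sub (√θ * m) (y - x₁)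
      rw [abs_mul, abs_of_nonneg (Real.sqrt_nonneg θ), abs_sub_comm (√θ * m)] at h3
      have h4 : ω / √n ≤ 1 / √n := by
        gcongr
        exact P.omega_le
      linarith
    have h3 : (√θ * |m|) ^ (2 * k) ≤ 4 ^ k * (|y - x₁| ^ (2 * k) + (1 / √n) ^ (2 * k)) := by
      refine (pow_le_pow_left₀ (by positivity) h2 _).trans ?_
      have h5 := add_pow_le (abs_nonneg (y - x₁)) (by positivity : 0 ≤ 1 / √(n : ℝ)) (2 * k)
      refine h5.trans (mul_le_mul_of_nonneg_right ?_ (by positivity))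
      rw [show (4 : ℝ) = 2 ^ 2 by norm_num, ← pow_mul]
      exact pow_le_pow_right₀ (by norm_num) (by omega)
    have h4 : (n : ℝ) * (1 / √n) ^ (2 * k) ≤ 1 := by
      rw [pow_mul, div_pow, Real.sq_sqrt hn'.le, one_pow, one_div, inv_pow]
      rw [← div_eq_mul_inv, div_le_one (by positivity)]
      have h1n : (1 : ℝ) ≤ n := by exact_mod_cast hn
      calc (n : ℝ) = n ^ 1 := (pow_one _).symm
        _ ≤ n ^ k := pow_le_pow_right₀ h1n hk
    have h5 : |m| ^ (2 * k) ≤ C₃ * (|y - x₁| ^ (2 * k) + (1 / √n) ^ (2 * k)) := by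
      rw [mul_pow, pow_mul √θ, Real.sq_sqrt hθ.le] at h3
      rw [hC₃, div_mul_eq_mul_div, le_div_iff₀ (by positivity)]
      linarith
    calc κ * (n * |m| ^ (2 * k)) ≤ κ * (n * (C₃ * (|y - x₁| ^ (2 * k) + (1 / √n) ^ (2 * k)))) := by
          gcongr
      _ = κ₁ * (n * |y - x₁| ^ (2 * k)) + κ₁ * (n * (1 / √n) ^ (2 * k)) := by rw [hκ₁]; ring
      _ ≤ κ₁ * (n * |y - x₁| ^ (2 * k)) + 1 * 1 := by gcongr
      _ = _ := by ring
  have hnum := sum_weight_le_window hθ hn h x₁ hω (A := A n)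
    (φ := fun σ => Real.exp (κ * (n * |totalSpin σ / n - meanTanh μ θ x₁| ^ (2 * k))))
    (fun σ => (Real.exp_pos _).le) hΦ0 hΦint hwin
  have hΦJ : ∫ y, Φ y * Real.exp (-n * (empH θ h y - empH θ h x₁)) ≤
      Real.exp 1 * ((Real.exp (κ₁ * ((4 / c) ^ 2 * (n * a ^ 2))) + G) * J) := by
    have e : ∀ y, Φ y * Real.exp (-n * (empH θ h y - empH θ h x₁)) = E.indicator (fun y =>
        Real.exp 1 * (Real.exp (κ₁ * (n * |y - x₁| ^ (2 * k))) *
          Real.exp (-n * (empH θ h y - empH θ h x₁)))) y := by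
      intro y
      simp only [hΦ, Set.indicator]
      split_ifs <;> simp [mul_assoc]
    simp_rw [e]
    rw [integral_indicator hEm, integral_const_mul]
    gcongr
  have hJ0 : 0 ≤ J := integral_nonneg fun y => (Real.exp_pos _).le
  have hN0 := normConst_pos hn θ h x₁
  have hZ0 : 0 < ∑ σ ∈ A n, weight θ h σ :=
    Finset.sum_pos (fun σ _ => weight_pos θ h σ) (P.nonempty n hn)
  set Q := Real.exp (κ * ((C₃ * (4 / c) ^ 2 + 4 ^ k / a₁ ^ 2) * (n * a ^ 2))) with hQ
  have hQ1 : Real.exp (κ₁ * ((4 / c) ^ 2 * (n * a ^ 2))) ≤ Q := by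
    rw [hQ, Real.exp_le_exp, hκ₁]
    have : 0 ≤ κ * (4 ^ k / a₁ ^ 2 * (n * a ^ 2)) := by positivity
    linarith
  rw [gibbs, div_le_iff₀ hZ0]
  calc _ ≤ _ := hnum
    _ ≤ (windowMass ω)⁻¹ * (normConst θ h x₁ *
        (Real.exp 1 * ((Real.exp (κ₁ * ((4 / c) ^ 2 * (n * a ^ 2))) + G) * J))) := by gcongr
    _ ≤ (windowMass ω)⁻¹ * (normConst θ h x₁ * (Real.exp 1 * (((1 + G) * Q) * J))) := by
        gcongr
        nlinarith
    _ = ((windowMass ω)⁻¹ * (Real.exp 1 * ((1 + G) * 2)) * Q) *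
        (normConst θ h x₁ * (1 / 2 * J)) := by ring
    _ ≤ ((windowMass ω)⁻¹ * (Real.exp 1 * ((1 + G) * 2)) * Q) * ∑ σ ∈ A n, weight θ h σ := by
        gcongr
    _ ≤ _ := by
        gcongr
        exact le_add_of_nonneg_right (Real.exp_pos _).le

end Phase

end Tightness

/-! ### Gibbs averages and their expectation over the field -/

section Expectation

variable {n : ℕ} {θ : ℝ} {h : Fin n → ℝ} {A : Finset (Config n)} {f g : Config n → ℝ}

lemma gibbs_mono (hfg : ∀ σ ∈ A, f σ ≤ g σ) : gibbs θ h A f ≤ gibbs θ h A g := by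
  refine div_le_div_of_nonneg_right (Finset.sum_le_sum fun σ hσ => ?_)
    (Finset.sum_nonneg fun σ _ => (weight_pos θ h σ).le)
  exact mul_le_mul_of_nonneg_left (hfg σ hσ) (weight_pos θ h σ).le

lemma gibbs_add : gibbs θ h A (fun σ => f σ + g σ) = gibbs θ h A f + gibbs θ h A g := by
  simp only [gibbs, mul_add, Finset.sum_add_distrib, add_div]

lemma gibbs_const_mul (c : ℝ) : gibbs θ h A (fun σ => c * f σ) = c * gibbs θ h A f := by
  simp only [gibbs, mul_left_comm _ c, ← Finset.mul_sum, mul_div_assoc]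

lemma gibbs_const (hA : A.Nonempty) (c : ℝ) : gibbs θ h A (fun _ => c) = c := by
  have hZ : 0 < ∑ σ ∈ A, weight θ h σ := Finset.sum_pos (fun σ _ => weight_pos θ h σ) hA
  rw [gibbs, ← Finset.sum_mul]
  field_simp

lemma gibbs_sub : gibbs θ h A (fun σ => f σ - g σ) = gibbs θ h A f - gibbs θ h A g := by
  simp only [gibbs, mul_sub, Finset.sum_sub_distrib, sub_div]

lemma abs_gibbs_le : |gibbs θ h A f| ≤ gibbs θ h A fun σ => |f σ| := by
  rw [abs_le]
  constructor
  · have := gibbs_mono (θ := θ) (h := h) (A := A) (f := fun σ => (-1) * |f σ|) (g := f)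
      fun σ _ => by linarith [neg_abs_le (f σ)]
    rw [gibbs_const_mul] at this
    linarith
  · exact gibbs_mono fun σ _ => le_abs_self _

lemma gibbs_nonneg (hf : ∀ σ ∈ A, 0 ≤ f σ) : 0 ≤ gibbs θ h A f :=
  div_nonneg (Finset.sum_nonneg fun σ hσ => mul_nonneg (weight_pos θ h σ).le (hf σ hσ))
    (Finset.sum_nonneg fun σ _ => (weight_pos θ h σ).le)

lemma continuous_gibbs (hA : A.Nonempty) : Continuous fun h => gibbs θ h A f := by
  have hw : ∀ σ : Config n, Continuous fun h => weight θ h σ := fun σ => by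
    unfold weight; fun_prop
  refine Continuous.div (continuous_finsetSum _ fun σ _ => (hw σ).mul continuous_const)
    (continuous_finsetSum _ fun σ _ => hw σ) fun h => ?_
  exact (Finset.sum_pos (fun σ _ => weight_pos θ h σ) hA).ne'

lemma integrable_gibbs (μ : Measure ℝ) [IsProbabilityMeasure μ] (hA : A.Nonempty) :
    Integrable (fun h => gibbs θ h A f) (Measure.pi fun _ : Fin n => μ) :=
  integrable_of_continuous_bounded (C := ∑ σ, |f σ|) (continuous_gibbs hA) fun _ =>
    abs_gibbs_le.trans (gibbs_le_of_le hA fun σ _ =>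
      Finset.single_le_sum (f := fun σ => |f σ|) (fun _ _ => abs_nonneg _) (Finset.mem_univ σ))

variable {μ : Measure ℝ} [IsProbabilityMeasure μ]

lemma expect_mono (hA : A.Nonempty) (hfg : ∀ σ ∈ A, f σ ≤ g σ) :
    expect μ θ A f ≤ expect μ θ A g :=
  integral_mono (integrable_gibbs μ hA) (integrable_gibbs μ hA) fun _ => gibbs_mono hfg

lemma expect_add (hA : A.Nonempty) :
    expect μ θ A (fun σ => f σ + g σ) = expect μ θ A f + expect μ θ A g := by
  simp only [expect, gibbs_add]
  exact integral_add (integrable_gibbs μ hA) (integrable_gibbs μ hA)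

lemma expect_sub (hA : A.Nonempty) :
    expect μ θ A (fun σ => f σ - g σ) = expect μ θ A f - expect μ θ A g := by
  simp only [expect, gibbs_sub]
  exact integral_sub (integrable_gibbs μ hA) (integrable_gibbs μ hA)

lemma expect_const_mul (c : ℝ) :
    expect μ θ A (fun σ => c * f σ) = c * expect μ θ A f := by
  simp only [expect, gibbs_const_mul, integral_const_mul]

lemma expect_const (hA : A.Nonempty) (c : ℝ) : expect μ θ A (fun _ => c) = c := by
  simp [expect, gibbs_const hA]

lemma expect_finsetSum {ι : Type*} (s : Finset ι) (hA : A.Nonempty) (F : ι → Config n → ℝ) :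
    expect μ θ A (fun σ => ∑ i ∈ s, F i σ) = ∑ i ∈ s, expect μ θ A (F i) := by
  classical
  induction s using Finset.induction_on with
  | empty => simpa using expect_const (μ := μ) (θ := θ) hA 0
  | insert i s hi ih => simp only [Finset.sum_insert hi]; rw [expect_add hA, ih]

lemma abs_expect_le (hA : A.Nonempty) : |expect μ θ A f| ≤ expect μ θ A fun σ => |f σ| := by
  rw [abs_le]
  constructor
  · have := expect_mono (μ := μ) (θ := θ) hA (f := fun σ => (-1) * |f σ|) (g := f)
      fun σ _ => by linarith [neg_abs_le (f σ)]
    rw [expect_const_mul] at this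
    linarith
  · exact expect_mono hA fun σ _ => le_abs_self _

lemma exp_div_le {M : ℝ} (hM : 1 ≤ M) (x : ℝ) : Real.exp (x / M) ≤ M⁻¹ * Real.exp x + 1 := by
  have hM0 : 0 < M := by linarith
  have h1 : M⁻¹ ≤ 1 := inv_le_one_of_one_le₀ hM
  have := convexOn_exp.2 (Set.mem_univ x) (Set.mem_univ 0) (inv_nonneg.2 hM0.le)
    (sub_nonneg.2 h1) (by ring)
  simp only [smul_eq_mul, mul_zero, add_zero, Real.exp_zero, mul_one] at this
  rw [div_eq_inv_mul]
  have h2 : 0 ≤ M⁻¹ := by positivity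
  linarith

lemma expect_exp_div_le_two (hA : A.Nonempty) {M C : ℝ} (hM : 1 ≤ M) (hC : C ≤ M)
    (hf : expect μ θ A (fun σ => Real.exp (f σ)) ≤ C) :
    expect μ θ A (fun σ => Real.exp (f σ / M)) ≤ 2 := by
  have hM0 : 0 < M := by linarith
  calc _ ≤ expect μ θ A (fun σ => M⁻¹ * Real.exp (f σ) + 1) :=
        expect_mono hA fun σ _ => exp_div_le hM _
    _ = M⁻¹ * expect μ θ A (fun σ => Real.exp (f σ)) + 1 := by
        rw [expect_add hA, expect_const_mul, expect_const hA]
    _ ≤ M⁻¹ * M + 1 := by gcongr; exact hf.trans hC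
    _ = 2 := by rw [inv_mul_cancel₀ hM0.ne']; norm_num

/-- Two families of functionals of the field which agree asymptotically, uniformly where the
nonnegative quantity `X n` is bounded, have asymptotically equal expectations, provided that they
are dominated by exponentials of `X n`. -/
lemma tendsto_integral_sub_of_uniform {Q : ∀ n : ℕ, Measure (Fin n → ℝ)}
    [∀ n, IsProbabilityMeasure (Q n)] {F G X : ∀ n : ℕ, (Fin n → ℝ) → ℝ} {κ C C' : ℝ}
    (hκ : 0 < κ)
    (hFi : ∀ n, 0 < n → Integrable (F n) (Q n)) (hGi : ∀ n, 0 < n → Integrable (G n) (Q n))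
    (hXi : ∀ n, 0 < n → Integrable (fun h => Real.exp (2 * κ * X n h)) (Q n))
    (hX : ∀ n, 0 < n → ∫ h, Real.exp (2 * κ * X n h) ∂(Q n) ≤ C')
    (hF : ∀ n, 0 < n → ∀ h, |F n h| ≤ C * Real.exp (κ * X n h))
    (hG : ∀ n, 0 < n → ∀ h, |G n h| ≤ C * Real.exp (κ * X n h))
    (huni : ∀ R ε : ℝ, 0 < ε → ∀ᶠ n : ℕ in atTop, ∀ h, X n h ≤ R → |F n h - G n h| ≤ ε) :
    Tendsto (fun n => ∫ h, F n h ∂(Q n) - ∫ h, G n h ∂(Q n)) atTop (𝓝 0) := by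
  rw [Metric.tendsto_atTop']
  intro ε hε
  have hCC : Tendsto (fun R => 2 * C * C' * Real.exp (-(κ * R))) atTop (𝓝 0) := by
    have h1 : Tendsto (fun R => κ * R) atTop atTop := tendsto_id.const_mul_atTop hκ
    simpa using (Real.tendsto_exp_neg_atTop_nhds_zero.comp h1).const_mul (2 * C * C')
  obtain ⟨R, hR⟩ := (hCC.eventually (gt_mem_nhds (half_pos hε))).exists
  obtain ⟨n₀, hn₀⟩ := eventually_atTop.1 (huni R (ε / 4) (by positivity))
  refine ⟨n₀, fun n hn => ?_⟩
  have hnp : 0 < n := by omega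
  have hC0 : 0 ≤ C := by
    have h1 := (abs_nonneg _).trans (hF n hnp 0)
    exact nonneg_of_mul_nonneg_left h1 (Real.exp_pos _)
  have hpt : ∀ h, ‖F n h - G n h‖ ≤
      ε / 4 + 2 * C * Real.exp (-(κ * R)) * Real.exp (2 * κ * X n h) := by
    intro h
    rw [Real.norm_eq_abs]
    rcases le_or_gt (X n h) R with hle | hgt
    · have := hn₀ n hn.le h hle
      have h2 : 0 ≤ 2 * C * Real.exp (-(κ * R)) * Real.exp (2 * κ * X n h) := by positivity
      linarith
    · have h1 := abs_sub (F n h) (G n h)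
      have h2 := hF n hnp h
      have h3 := hG n hnp h
      have h4 : Real.exp (κ * X n h) ≤ Real.exp (-(κ * R)) * Real.exp (2 * κ * X n h) := by
        rw [← Real.exp_add, Real.exp_le_exp]
        nlinarith
      have h5 : C * Real.exp (κ * X n h) ≤ C * (Real.exp (-(κ * R)) * Real.exp (2 * κ * X n h)) := by
        gcongr
      linarith
  rw [dist_zero_right, ← integral_sub (hFi n hnp) (hGi n hnp)]
  calc _ ≤ ∫ h, (ε / 4 + 2 * C * Real.exp (-(κ * R)) * Real.exp (2 * κ * X n h)) ∂(Q n) :=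
        norm_integral_le_of_norm_le ((integrable_const _).add ((hXi n hnp).const_mul _))
          (Eventually.of_forall hpt)
    _ = ε / 4 + 2 * C * Real.exp (-(κ * R)) * ∫ h, Real.exp (2 * κ * X n h) ∂(Q n) := by
        rw [integral_add (integrable_const _) ((hXi n hnp).const_mul _), integral_const_mul]
        simp
    _ ≤ ε / 4 + 2 * C * Real.exp (-(κ * R)) * C' := by gcongr; exact hX n hnp
    _ = ε / 4 + 2 * C * C' * Real.exp (-(κ * R)) := by ring
    _ < ε := by linarith

end Expectation

section PhaseExpectation

variable {μ : Measure ℝ} {θ x₁ ρ B r c ω : ℝ} {k : ℕ}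
  {A : ∀ n : ℕ, Finset (Config n)} {D D' : Set ℝ} [IsProbabilityMeasure μ]

namespace Phase

/-- Exponential moments for a fixed field, and of the fluctuations of the field. -/
lemma exists_tight (P : Phase μ θ x₁ k A D D' ρ B r c ω) :
    ∃ κ l C C' : ℝ, 0 < κ ∧ 0 < l ∧ 0 < C ∧ 0 < C' ∧ ∀ n : ℕ, 0 < n →
      (∀ h : Fin n → ℝ, gibbs θ h (A n) (fun σ =>
        Real.exp (κ * (n * |totalSpin σ / n - meanTanh μ θ x₁| ^ (2 * k)))) ≤
        C * Real.exp (l * (n * fluct μ θ x₁ B h ^ 2))) ∧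
      ∫ h, Real.exp (2 * l * (n * fluct μ θ x₁ B h ^ 2)) ∂(Measure.pi fun _ : Fin n => μ) ≤ C' := by
  obtain ⟨κ₀, hκ₀, C, C₁, hC, hC₁, hg⟩ := P.exists_gibbs_exp_le
  obtain ⟨l, hl, C', hC'⟩ := exists_integral_exp_fluct_le (μ := μ) P.theta_pos x₁ P.B_pos
  set κ := min κ₀ (l / 2 / C₁) with hκ
  have hκ0 : 0 < κ := by positivity
  refine ⟨κ, l / 2, C, max C' 1, hκ0, by positivity, hC, by positivity, fun n hn => ⟨fun h => ?_, ?_⟩⟩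
  · refine (hg κ hκ0 (min_le_left _ _) n hn h).trans ?_
    have h1 : κ * C₁ ≤ l / 2 := by
      have := min_le_right κ₀ (l / 2 / C₁)
      rwa [← hκ, le_div_iff₀ hC₁] at this
    rw [← mul_assoc κ]
    gcongr
  · rw [mul_div_cancel₀ l (two_ne_zero)]
    exact (hC' n hn).trans (le_max_left _ _)

lemma exists_expect_exp_le (P : Phase μ θ x₁ k A D D' ρ B r c ω) :
    ∃ κ C : ℝ, 0 < κ ∧ ∀ n : ℕ, 0 < n → expect μ θ (A n) (fun σ =>
        Real.exp (κ * (n * |totalSpin σ / n - meanTanh μ θ x₁| ^ (2 * k)))) ≤ C := by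
  obtain ⟨κ, l, C, C', hκ, hl, hC, hC', ht⟩ := P.exists_tight
  refine ⟨κ, C * C', hκ, fun n hn => ?_⟩
  have hI := integrable_exp_fluct (μ := μ) (n := n) P.theta_pos x₁ P.B_pos
  calc _ ≤ ∫ h, C * Real.exp (2 * l * (n * fluct μ θ x₁ B h ^ 2))
        ∂(Measure.pi fun _ : Fin n => μ) := by
        refine integral_mono (integrable_gibbs μ (P.nonempty n hn)) ((hI _).const_mul _) fun h => ?_
        refine ((ht n hn).1 h).trans ?_
        gcongr
        linarith
    _ ≤ C * C' := by
        rw [integral_const_mul]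
        gcongr
        exact (ht n hn).2

end Phase

end PhaseExpectation

/-! ### Moment generating function at a nondegenerate minimum -/

section GaussianLimit

lemma abs_exp_sub_exp_le {a b M : ℝ} (ha : a ≤ M) (hb : b ≤ M) :
    |Real.exp a - Real.exp b| ≤ |a - b| * Real.exp M := by
  wlog hab : b ≤ a generalizing a b
  · rw [abs_sub_comm, abs_sub_comm a]
    exact this hb ha (le_of_not_ge hab)
  rw [abs_of_nonneg (sub_nonneg.2 (Real.exp_le_exp.2 hab)), abs_of_nonneg (sub_nonneg.2 hab)]
  have h1 := Real.add_one_le_exp (b - a)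
  have h2 : Real.exp b = Real.exp a * Real.exp (b - a) := by rw [← Real.exp_add]; congr 1; ring
  calc Real.exp a - Real.exp b ≤ (a - b) * Real.exp a := by
        rw [h2]; nlinarith [Real.exp_pos a]
    _ ≤ _ := mul_le_mul_of_nonneg_left (Real.exp_le_exp.2 ha) (sub_nonneg.2 hab)

lemma integral_comp_affine {g : ℝ → ℝ} {b : ℝ} (hb : 0 < b) (c : ℝ) :
    ∫ y, g y = b⁻¹ * ∫ u, g (c + u / b) := by
  have h1 := Measure.integral_comp_div (fun u => g (c + u)) b
  rw [integral_add_left_eq_self (fun u => g u) c] at h1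
  rw [h1, abs_of_pos hb, smul_eq_mul, ← mul_assoc, inv_mul_cancel₀ hb.ne', one_mul]

lemma integral_exp_quadratic {v : ℝ} (hv : 0 < v) (w : ℝ) :
    ∫ u : ℝ, Real.exp (w * u - v / 2 * u ^ 2) = √(2 * Real.pi / v) * Real.exp (w ^ 2 / (2 * v)) := by
  have h1 : ∀ u : ℝ, Real.exp (w * u - v / 2 * u ^ 2) =
      Real.exp (w ^ 2 / (2 * v)) * Real.exp (-(v / 2) * (u - w / v) ^ 2) := by
    intro u
    rw [← Real.exp_add]
    congr 1
    field_simp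
    ring
  simp_rw [h1]
  rw [integral_const_mul, integral_gaussian_shift, mul_comm]
  congr 2
  field_simp

lemma integrable_exp_quadratic {v : ℝ} (hv : 0 < v) (w : ℝ) :
    Integrable fun u : ℝ => Real.exp (w * u - v / 2 * u ^ 2) := by
  refine Integrable.of_integral_ne_zero ?_
  rw [integral_exp_quadratic hv]
  have := Real.pi_pos
  positivity

/-- A cubic factor and a linear exponent are absorbed by the Gaussian. -/
lemma exists_cubic_exp_le {q : ℝ} (hq : 0 < q) (p : ℝ) :
    ∃ C : ℝ, 0 < C ∧ ∀ u : ℝ, (1 + |u|) ^ 3 * Real.exp (p * |u| - q * u ^ 2) ≤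
      C * Real.exp (-(q / 2) * u ^ 2) := by
  refine ⟨Real.exp ((p + 3) ^ 2 / (2 * q)), Real.exp_pos _, fun u => ?_⟩
  have h1 : (1 + |u|) ^ 3 ≤ Real.exp (3 * |u|) := by
    have := Real.add_one_le_exp |u|
    rw [show (3 : ℝ) * |u| = ((3 : ℕ) : ℝ) * |u| by norm_num, Real.exp_nat_mul]
    gcongr
    linarith
  calc _ ≤ Real.exp (3 * |u|) * Real.exp (p * |u| - q * u ^ 2) := by gcongr
    _ ≤ _ := by
      rw [← Real.exp_add, ← Real.exp_add, Real.exp_le_exp, ← sq_abs u]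
      have h2 : 0 ≤ (q * |u| - (p + 3)) ^ 2 / (2 * q) := by positivity
      have h3 : (q * |u| - (p + 3)) ^ 2 / (2 * q) =
          q / 2 * |u| ^ 2 - (p + 3) * |u| + (p + 3) ^ 2 / (2 * q) := by
        field_simp; ring
      linarith

variable {μ : Measure ℝ} {θ x₁ ρ B r c ω : ℝ} {k : ℕ}
  {A : ∀ n : ℕ, Finset (Config n)} {D D' : Set ℝ}

/-- Rescaled Laplace integral with a linear tilt `l` over the region `D` shifted by `s`. -/
noncomputable def tilted (θ x₁ : ℝ) (D : Set ℝ) {n : ℕ} (h : Fin n → ℝ) (l s u : ℝ) : ℝ :=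
  D.indicator (fun _ => 1) (x₁ + u / √n - s) *
    Real.exp (l * u - n * (empH θ h (x₁ + u / √n) - empH θ h x₁))

lemma exp_gaussScaled_mul_joint (hθ : 0 < θ) {n : ℕ} (hn : 0 < n) (h : Fin n → ℝ) (σ : Config n)
    {a : ℝ} (ha : x₁ = √θ * a) (t y : ℝ) :
    Real.exp (t * gaussScaled a σ) * joint θ h σ (y - t / (√n * √θ)) =
      Real.exp (-(t ^ 2 / (2 * θ)) + t / √θ * (√n * (y - x₁))) * joint θ h σ y := by
  unfold joint
  rw [mul_left_comm, mul_left_comm _ √_, ← Real.exp_add, ← Real.exp_add]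
  congr 2
  have hn' : (0 : ℝ) < n := by positivity
  have h1 : gaussScaled a σ = (√n)⁻¹ * (totalSpin σ - n * a) := by
    simp [gaussScaled, totalSpin, Finset.sum_sub_distrib]
  rw [h1, ha]
  have h2 := Real.sq_sqrt hθ.le
  have h3 := Real.sq_sqrt hn'.le
  have h4 : 0 < √θ := by positivity
  have h5 : 0 < √(n : ℝ) := by positivity
  set e := √θ
  set d := √(n : ℝ)
  rw [← h2, ← h3]
  field_simp
  ring

lemma integral_mgf_region (hθ : 0 < θ) {n : ℕ} (hn : 0 < n) (h : Fin n → ℝ)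
    (hD : MeasurableSet D) {a : ℝ} (ha : x₁ = √θ * a) (t : ℝ) :
    ∫ y in D, ∑ σ, Real.exp (t * gaussScaled a σ) * joint θ h σ y =
      normConst θ h x₁ * (√n)⁻¹ * (Real.exp (-(t ^ 2 / (2 * θ))) *
        ∫ u, tilted θ x₁ D h (t / √θ) (t / (√n * √θ)) u) := by
  have hn' : (0 : ℝ) < n := by positivity
  have h5 : 0 < √(n : ℝ) := by positivity
  rw [← integral_indicator hD, integral_comp_affine h5 (x₁ - t / (√n * √θ)),
    ← integral_const_mul, ← integral_const_mul, ← integral_const_mul]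
  refine integral_congr_ae (Eventually.of_forall fun u => ?_)
  simp only [tilted]
  have e1 : x₁ - t / (√n * √θ) + u / √n = x₁ + u / √n - t / (√n * √θ) := by ring
  rw [e1]
  by_cases hu : x₁ + u / √n - t / (√n * √θ) ∈ D
  · rw [Set.indicator_of_mem hu, Set.indicator_of_mem hu, one_mul]
    simp_rw [exp_gaussScaled_mul_joint hθ hn h _ ha]
    rw [← Finset.mul_sum, sum_joint_eq_normConst hn h x₁]
    have e2 : √(n : ℝ) * (x₁ + u / √n - x₁) = u := by field_simp; ring
    rw [e2, Real.exp_add, Real.exp_sub, neg_mul, Real.exp_neg (n * _)]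
    ring
  · rw [Set.indicator_of_notMem hu, Set.indicator_of_notMem hu]
    simp

variable [IsProbabilityMeasure μ]

lemma sqrt_mul_fluct_le {n : ℕ} {h : Fin n → ℝ} {R : ℝ} (hR : n * fluct μ θ x₁ B h ^ 2 ≤ R) :
    √n * fluct μ θ x₁ B h ≤ √R := by
  refine Real.le_sqrt_of_sq_le ?_
  rwa [mul_pow, Real.sq_sqrt (by positivity)]

/-- Near the minimum the exponents of the Laplace integrand and of its Gaussian limit are close. -/
lemma abs_exp_sub_exp_le_of_near {d u v c q l g fl K ΔH T R : ℝ} (hd : 1 ≤ d) (hT : 0 ≤ T)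
    (hfl : 0 ≤ fl) (hqc : q ≤ c) (hR : d * fl ≤ R)
    (hb : (l - d * g) * u - v / 2 * u ^ 2 ≤ (|l| + R) * |u| - q * u ^ 2)
    (h1 : |ΔH - v / 2 * (u / d) ^ 2| ≤ T * |u / d| ^ 3)
    (h2 : |K - ΔH - g * (u / d)| ≤ fl * (√|u / d| * |u / d|))
    (h3 : c * |u / d| ^ (1 + 1) - fl * |u / d| ≤ K) :
    |Real.exp (l * u - d ^ 2 * K) - Real.exp ((l - d * g) * u - v / 2 * u ^ 2)| ≤
      (√d)⁻¹ * ((T + R) * ((1 + |u|) ^ 3 * Real.exp ((|l| + R) * |u| - q * u ^ 2))) := by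
  have hd0 : 0 < d := by linarith
  have hu := abs_nonneg u
  have habs : |u / d| = |u| / d := by rw [abs_div, abs_of_pos hd0]
  have he0 : 0 < √d := by positivity
  have he2 : √d * √d = d := Real.mul_self_sqrt hd0.le
  have he1 : 1 ≤ √d := by rw [Real.one_le_sqrt]; exact hd
  have hR0 : 0 ≤ R := le_trans (by positivity) hR
  have ha : l * u - d ^ 2 * K ≤ (|l| + R) * |u| - q * u ^ 2 := by
    have h4 : d ^ 2 * (c * |u / d| ^ (1 + 1) - fl * |u / d|) ≤ d ^ 2 * K := by gcongr
    have h5 : d ^ 2 * (c * |u / d| ^ (1 + 1) - fl * |u / d|) = c * u ^ 2 - d * fl * |u| := by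
      rw [← sq_abs u, habs, show 1 + 1 = 2 from rfl]; field_simp
    have h6 : l * u ≤ |l| * |u| := by rw [← abs_mul]; exact le_abs_self _
    have h7 : d * fl * |u| ≤ R * |u| := by gcongr
    have h8 : q * u ^ 2 ≤ c * u ^ 2 := by gcongr
    linarith
  refine (abs_exp_sub_exp_le ha hb).trans ?_
  have e1 : l * u - d ^ 2 * K - ((l - d * g) * u - v / 2 * u ^ 2) =
      -(d ^ 2 * (K - ΔH - g * (u / d))) - d ^ 2 * (ΔH - v / 2 * (u / d) ^ 2) := by
    field_simp; ring
  have h4 : |l * u - d ^ 2 * K - ((l - d * g) * u - v / 2 * u ^ 2)| ≤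
      d ^ 2 * (fl * (√|u / d| * |u / d|)) + d ^ 2 * (T * |u / d| ^ 3) := by
    rw [e1]
    refine (abs_sub _ _).trans ?_
    rw [abs_neg, abs_mul, abs_mul, abs_of_pos (by positivity : 0 < d ^ 2)]
    gcongr
  have h5 : d ^ 2 * (T * |u / d| ^ 3) ≤ (√d)⁻¹ * (T * (1 + |u|) ^ 3) := by
    have e2 : d ^ 2 * (T * |u / d| ^ 3) = d⁻¹ * (T * |u| ^ 3) := by
      rw [habs]; field_simp
    rw [e2]
    have h6 : √d ≤ d := by nlinarith
    gcongr
    linarith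
  have h6 : d ^ 2 * (fl * (√|u / d| * |u / d|)) ≤ (√d)⁻¹ * (R * (1 + |u|) ^ 3) := by
    have h7 : √|u / d| = √|u| / √d := by rw [habs, Real.sqrt_div (abs_nonneg _)]
    have h8 : d ^ 2 * (fl * (√|u / d| * |u / d|)) = (√d)⁻¹ * ((d * fl) * (√|u| * |u|)) := by
      rw [h7, habs]; field_simp
    have h9 : √|u| ≤ 1 + |u| := by
      rw [Real.sqrt_le_left (by positivity)]
      nlinarith
    have h10 : √|u| * |u| ≤ (1 + |u|) ^ 3 := by
      calc √|u| * |u| ≤ (1 + |u|) * (1 + |u|) := by gcongr; linarith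
        _ ≤ (1 + |u|) ^ 3 := by nlinarith [pow_nonneg hu 2, pow_nonneg hu 3]
    rw [h8]
    gcongr
  calc _ ≤ ((√d)⁻¹ * (R * (1 + |u|) ^ 3) + (√d)⁻¹ * (T * (1 + |u|) ^ 3)) *
        Real.exp ((|l| + R) * |u| - q * u ^ 2) := by
        gcongr
        linarith
    _ = _ := by ring

lemma abs_le_of_far {d u g M K : ℝ} (hd : 1 ≤ d) (hK : 0 < K) (hKz : K ≤ |u / d|)
    (hg : |g| ≤ 2 * Real.exp M) :
    |g| ≤ (√d)⁻¹ * (2 / K * ((1 + |u|) ^ 3 * Real.exp M)) := by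
  have hd0 : 0 < d := by linarith
  have hu := abs_nonneg u
  have he0 : 0 < √d := by positivity
  have he1 : 1 ≤ √d := by rw [Real.one_le_sqrt]; exact hd
  have he2 : √d * √d = d := Real.mul_self_sqrt hd0.le
  have h1 : 1 ≤ (√d)⁻¹ * ((1 + |u|) ^ 3 / K) := by
    have h2 : K ≤ d⁻¹ * |u| := by
      rwa [abs_div, abs_of_pos hd0, div_eq_inv_mul] at hKz
    have h3 : d⁻¹ * |u| ≤ (√d)⁻¹ * (1 + |u|) ^ 3 := by
      have h4 : √d ≤ d := by nlinarith
      have h5 : |u| ≤ (1 + |u|) ^ 3 := by nlinarith [pow_nonneg hu 2, pow_nonneg hu 3]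
      gcongr
    rw [← mul_div_assoc, le_div_iff₀ hK, one_mul]
    exact h2.trans h3
  calc |g| ≤ 1 * (2 * Real.exp M) := by rw [one_mul]; exact hg
    _ ≤ (√d)⁻¹ * ((1 + |u|) ^ 3 / K) * (2 * Real.exp M) := by gcongr
    _ = _ := by ring

namespace Phase

lemma tilted_sub_le (P : Phase μ θ x₁ 1 A D D' ρ B r c ω) {v : ℝ}
    (hv : v = 1 - θ * meanSechSq μ θ x₁) {l s R : ℝ} {n : ℕ}
    (hn : 0 < n) (hs : |s| ≤ ω) (hsr : |s| ≤ r / 2) {h : Fin n → ℝ}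
    (hR : n * fluct μ θ x₁ B h ^ 2 ≤ R) (u : ℝ) :
    |tilted θ x₁ D h l s u - Real.exp ((l - √n * devSlope μ θ h x₁) * u - v / 2 * u ^ 2)| ≤
      (√√n)⁻¹ * ((θ * √θ * 2 + √R + 2 / B + 4 / r) * ((1 + |u|) ^ 3 *
        Real.exp ((|l| + √R) * |u| - min c (min (v / 2) (1 / 4)) * u ^ 2))) := by
  have hθ := P.theta_pos
  have hB := P.B_pos
  have hr := P.r_pos
  have hn' : (0 : ℝ) < n := by positivity
  have hd1 : 1 ≤ √(n : ℝ) := by rw [Real.one_le_sqrt]; exact_mod_cast hn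
  have hd2 : (n : ℝ) = √(n : ℝ) ^ 2 := (Real.sq_sqrt hn'.le).symm
  have hfl := sqrt_mul_fluct_le hR
  have hwR : |√n * devSlope μ θ h x₁| ≤ √R := by
    rw [abs_mul, abs_of_nonneg (Real.sqrt_nonneg _)]
    exact (mul_le_mul_of_nonneg_left abs_devSlope_center_le (Real.sqrt_nonneg _)).trans hfl
  obtain ⟨q, hq⟩ : ∃ q, q = min c (min (v / 2) (1 / 4)) := ⟨_, rfl⟩
  have hqc : q ≤ c := hq.trans_le (min_le_left _ _)
  have hqv : q ≤ v / 2 := hq.trans_le ((min_le_right _ _).trans (min_le_left _ _))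
  have hq4 : q ≤ 1 / 4 := hq.trans_le ((min_le_right _ _).trans (min_le_right _ _))
  rw [← hq]
  have hu2 := sq_nonneg u
  have hR0 := Real.sqrt_nonneg R
  have hb : (l - √n * devSlope μ θ h x₁) * u - v / 2 * u ^ 2 ≤ (|l| + √R) * |u| - q * u ^ 2 := by
    have h1 : (l - √n * devSlope μ θ h x₁) * u ≤ (|l| + √R) * |u| := by
      refine (le_abs_self _).trans ?_
      rw [abs_mul]
      gcongr
      exact (abs_sub _ _).trans (by linarith)
    have := mul_le_mul_of_nonneg_right hqv hu2
    linarith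
  have hpos1 : 0 ≤ θ * √θ * 2 := by positivity
  have hpos2 : 0 ≤ 2 / B := by positivity
  have hpos3 : 0 ≤ 4 / r := by positivity
  have weaken : ∀ K : ℝ, K ≤ θ * √θ * 2 + √R + 2 / B + 4 / r →
      (√√n)⁻¹ * (K * ((1 + |u|) ^ 3 * Real.exp ((|l| + √R) * |u| - q * u ^ 2))) ≤
        (√√n)⁻¹ * ((θ * √θ * 2 + √R + 2 / B + 4 / r) * ((1 + |u|) ^ 3 *
          Real.exp ((|l| + √R) * |u| - q * u ^ 2))) := fun K hK => by
    gcongr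
  unfold tilted
  have hzz : x₁ + u / √n - x₁ = u / √n := by ring
  by_cases hu : x₁ + u / √n - s ∈ D
  · rw [Set.indicator_of_mem hu, one_mul]
    have hyD' : x₁ + u / √n ∈ D' := P.thick _ hu _ (by
      rw [show x₁ + u / √n - (x₁ + u / √n - s) = s by ring]; exact hs)
    rcases le_total |u / √n| B with hzB | hzB
    · have h1 := abs_H_sub_quadratic_le P.integrable hθ P.crit (x₁ + u / √n)
      have h2 := abs_empH_dev_linear_le (h := h) P.integrable hn hθ (x := x₁) (B := B)
        (y := x₁ + u / √n) (by rw [hzz]; exact hzB)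
      have h3 := P.empH_lower hn h hyD' (by rw [hzz]; exact hzB)
      rw [hzz] at h1 h2 h3
      rw [← hv] at h1
      have h4 := abs_exp_sub_exp_le_of_near hd1 hpos1 fluct_nonneg hqc hfl hb h1 h2 h3
      rw [← hd2] at h4
      exact h4.trans (weaken _ (by linarith))
    · have hK := sq_div_four_le_empH_sub hθ h (x := x₁) (y := x₁ + u / √n) (B := B)
        (by have := P.le_B; linarith) (by rw [hzz]; exact hzB)
      rw [hzz] at hK
      have ha : l * u - n * (empH θ h (x₁ + u / √n) - empH θ h x₁) ≤
          (|l| + √R) * |u| - q * u ^ 2 := by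
        have h1 : (n : ℝ) * ((u / √n) ^ 2 / 4) ≤
            n * (empH θ h (x₁ + u / √n) - empH θ h x₁) := by gcongr
        have h2 : (n : ℝ) * ((u / √n) ^ 2 / 4) = u ^ 2 / 4 := by
          rw [div_pow, Real.sq_sqrt hn'.le]; field_simp
        have h3 : l * u ≤ |l| * |u| := by rw [← abs_mul]; exact le_abs_self _
        have h4 : 0 ≤ √R * |u| := by positivity
        have := mul_le_mul_of_nonneg_right hq4 hu2
        linarith
      refine (abs_le_of_far hd1 hB hzB ?_).trans (weaken _ (by linarith))
      refine (abs_sub _ _).trans ?_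
      rw [Real.abs_exp, Real.abs_exp, two_mul]
      exact add_le_add (Real.exp_le_exp.2 ha) (Real.exp_le_exp.2 hb)
  · rw [Set.indicator_of_notMem hu, zero_mul]
    have hzr : r / 2 ≤ |u / √n| := by
      by_contra hc
      refine hu (P.ball_subset ?_)
      rw [Metric.mem_closedBall, Real.dist_eq, show x₁ + u / √n - s - x₁ = u / √n - s by ring]
      exact (abs_sub _ _).trans (by linarith)
    rw [zero_sub, abs_neg]
    have h1 := Real.exp_le_exp.2 hb
    refine (abs_le_of_far (M := (|l| + √R) * |u| - q * u ^ 2) hd1 (half_pos hr) hzr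
      (by rw [Real.abs_exp]; linarith [Real.exp_pos ((|l| + √R) * |u| - q * u ^ 2)])).trans
      (weaken _ ?_)
    rw [show 2 / (r / 2) = 4 / r by field_simp; norm_num]
    linarith

/-- The rescaled Laplace integral converges to a Gaussian integral, uniformly over fields with
bounded rescaled fluctuations. -/
lemma eventually_integral_tilted (P : Phase μ θ x₁ 1 A D D' ρ B r c ω) {v : ℝ}
    (hv : v = 1 - θ * meanSechSq μ θ x₁) (hv0 : 0 < v) (l s₀ R : ℝ) {ε : ℝ} (hε : 0 < ε) :
    ∀ᶠ n : ℕ in atTop, ∀ h : Fin n → ℝ, n * fluct μ θ x₁ B h ^ 2 ≤ R →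
      |(∫ u, tilted θ x₁ D h l (s₀ / √n) u) - √(2 * Real.pi / v) *
        Real.exp ((l - √n * devSlope μ θ h x₁) ^ 2 / (2 * v))| ≤ ε := by
  have hB := P.B_pos
  have hr := P.r_pos
  have hc := P.c_pos
  have hθ := P.theta_pos
  obtain ⟨q, hq⟩ : ∃ q, q = min c (min (v / 2) (1 / 4)) := ⟨_, rfl⟩
  have hq0 : 0 < q := by rw [hq]; positivity
  obtain ⟨C, hC, hCu⟩ := exists_cubic_exp_le hq0 (|l| + √R)
  obtain ⟨T, hT⟩ : ∃ T, T = θ * √θ * 2 + √R + 2 / B + 4 / r := ⟨_, rfl⟩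
  have hT0 : 0 ≤ T := by rw [hT]; positivity
  have hd : Tendsto (fun n : ℕ => √(n : ℝ)) atTop atTop :=
    Real.tendsto_sqrt_atTop.comp tendsto_natCast_atTop_atTop
  have hd' : Tendsto (fun n : ℕ => (√√(n : ℝ))⁻¹) atTop (𝓝 0) :=
    tendsto_inv_atTop_zero.comp (Real.tendsto_sqrt_atTop.comp hd)
  have hlim : Tendsto (fun n : ℕ => (√√(n : ℝ))⁻¹ * (T * (C * √(Real.pi / (q / 2))))) atTop (𝓝 0) := by
    simpa using hd'.mul_const (T * (C * √(Real.pi / (q / 2))))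
  have hs : Tendsto (fun n : ℕ => |s₀ / √(n : ℝ)|) atTop (𝓝 0) := by
    simpa using (hd.const_div_atTop s₀).abs
  filter_upwards [eventually_gt_atTop 0, hlim.eventually (ge_mem_nhds hε),
    hs.eventually (ge_mem_nhds P.omega_pos), hs.eventually (ge_mem_nhds (half_pos hr))]
    with n hn hsmall hsω hsr h hR
  have hpt : ∀ u, ‖tilted θ x₁ D h l (s₀ / √n) u -
      Real.exp ((l - √n * devSlope μ θ h x₁) * u - v / 2 * u ^ 2)‖ ≤
      (√√n)⁻¹ * (T * (C * Real.exp (-(q / 2) * u ^ 2))) := by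
    intro u
    refine (P.tilted_sub_le hv hn hsω hsr hR u).trans ?_
    rw [← hq, ← hT]
    exact mul_le_mul_of_nonneg_left (mul_le_mul_of_nonneg_left (hCu u) hT0) (by positivity)
  have hgI : Integrable fun u : ℝ => (√√(n : ℝ))⁻¹ * (T * (C * Real.exp (-(q / 2) * u ^ 2))) :=
    (((integrable_exp_neg_mul_sq (by positivity)).const_mul _).const_mul _).const_mul _
  have hEI := integrable_exp_quadratic hv0 (l - √n * devSlope μ θ h x₁)
  have hmeas : Measurable fun u => tilted θ x₁ D h l (s₀ / √n) u := by
    have hD := (P.approx n hn h).1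
    have h1 : Measurable (D.indicator fun _ : ℝ => (1 : ℝ)) := measurable_const.indicator hD
    have h2 := (continuous_empH θ h).measurable
    unfold tilted
    exact (h1.comp (by fun_prop)).mul (((by fun_prop : Measurable fun u : ℝ => l * u).sub
      (((h2.comp (by fun_prop)).sub_const _).const_mul _)).exp)
  have hdI : Integrable fun u => tilted θ x₁ D h l (s₀ / √n) u -
      Real.exp ((l - √n * devSlope μ θ h x₁) * u - v / 2 * u ^ 2) :=
    hgI.mono' (hmeas.sub (by fun_prop)).aestronglyMeasurable (Eventually.of_forall hpt)
  have htI : Integrable fun u => tilted θ x₁ D h l (s₀ / √n) u := by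
    refine (hdI.add hEI).congr (Eventually.of_forall fun u => ?_)
    simp
  rw [← integral_exp_quadratic hv0, ← integral_sub htI hEI]
  refine (norm_integral_le_of_norm_le hgI (Eventually.of_forall hpt)).trans ?_
  rw [integral_const_mul, integral_const_mul, integral_const_mul, integral_gaussian]
  exact hsmall

end Phase

end GaussianLimit

section GaussianExpectation

lemma abs_div_sub_div_le {p q p₀ q₀ g δ : ℝ} (hp : |p - p₀| ≤ δ) (hq : |q - q₀| ≤ δ)
    (hq₀ : 0 < q₀) (hδ : δ ≤ q₀ / 2) (hg : p₀ = g * q₀) :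
    |p / q - g| ≤ δ * (1 + |g|) / (q₀ / 2) := by
  have hq1 : q₀ / 2 ≤ q := by linarith [(abs_le.1 hq).1]
  have hqpos : 0 < q := by linarith
  have e : p / q - g = (p - p₀ - g * (q - q₀)) / q := by rw [hg]; field_simp; ring
  rw [e, abs_div, abs_of_pos hqpos]
  have hδ0 : 0 ≤ δ := (abs_nonneg _).trans hp
  gcongr
  calc _ ≤ |p - p₀| + |g| * |q - q₀| := by rw [← abs_mul]; exact abs_sub _ _
    _ ≤ δ + |g| * δ := by gcongr
    _ = _ := by ring

/-- Convergence of the moment generating function of normalized sums of bounded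
centred i.i.d. variables. -/
lemma tendsto_mgf_pow {μ : Measure ℝ} [IsProbabilityMeasure μ] {ξ : ℝ → ℝ} (hξ : Continuous ξ)
    (hb : ∀ x, |ξ x| ≤ 2) (h0 : ∫ x, ξ x ∂μ = 0) (s : ℝ) :
    Tendsto (fun n : ℕ => (∫ x, Real.exp (s / √n * ξ x) ∂μ) ^ n) atTop
      (𝓝 (Real.exp (s ^ 2 * (∫ x, ξ x ^ 2 ∂μ) / 2))) := by
  have hd : Tendsto (fun n : ℕ => √(n : ℝ)) atTop atTop :=
    Real.tendsto_sqrt_atTop.comp tendsto_natCast_atTop_atTop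
  have hξI : Integrable ξ μ := integrable_of_continuous_bounded hξ hb
  have hξI2 : Integrable (fun x => ξ x ^ 2) μ :=
    integrable_of_continuous_bounded (C := 4) (by fun_prop) fun x => by
      rw [abs_pow]; nlinarith [hb x, abs_nonneg (ξ x)]
  have key : Tendsto (fun n : ℕ => (n : ℝ) * (∫ x, Real.exp (s / √n * ξ x) ∂μ - 1)) atTop
      (𝓝 (s ^ 2 * (∫ x, ξ x ^ 2 ∂μ) / 2)) := by
    have hlim : Tendsto (fun n : ℕ => (2 * |s|) ^ 3 / √(n : ℝ)) atTop (𝓝 0) := hd.const_div_atTop _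
    rw [tendsto_iff_norm_sub_tendsto_zero]
    refine squeeze_zero' (Eventually.of_forall fun n => norm_nonneg _) ?_ hlim
    filter_upwards [hd.eventually_ge_atTop (2 * |s|), eventually_gt_atTop 0] with n hn hn0
    have hn' : (0 : ℝ) < n := by positivity
    have hdp : 0 < √(n : ℝ) := by positivity
    have hx : ∀ x, |s / √n * ξ x| ≤ 2 * |s| / √n := by
      intro x
      rw [abs_mul, abs_div, abs_of_pos hdp]
      calc |s| / √n * |ξ x| ≤ |s| / √n * 2 := by gcongr; exact hb x
        _ = _ := by ring
    have hx1 : ∀ x, |s / √n * ξ x| ≤ 1 := fun x => (hx x).trans ((div_le_one hdp).2 hn)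
    have hEI : Integrable (fun x => Real.exp (s / √n * ξ x)) μ :=
      integrable_of_continuous_bounded (C := Real.exp 1) (by fun_prop) fun x => by
        rw [Real.abs_exp]; gcongr; exact (le_abs_self _).trans (hx1 x)
    have e : (n : ℝ) * (∫ x, Real.exp (s / √n * ξ x) ∂μ - 1) - s ^ 2 * (∫ x, ξ x ^ 2 ∂μ) / 2 =
        n * ∫ x, (Real.exp (s / √n * ξ x) - 1 - s / √n * ξ x - (s / √n * ξ x) ^ 2 / 2) ∂μ := by
      have h1 : ∫ x, (Real.exp (s / √n * ξ x) - 1 - s / √n * ξ x - (s / √n * ξ x) ^ 2 / 2) ∂μ =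
          ∫ x, Real.exp (s / √n * ξ x) ∂μ - 1 - s / √n * 0 -
            (s / √n) ^ 2 / 2 * ∫ x, ξ x ^ 2 ∂μ := by
        have e2 : ∀ x, (s / √n * ξ x) ^ 2 / 2 = (s / √n) ^ 2 / 2 * ξ x ^ 2 := fun x => by ring
        simp_rw [e2]
        have hE1 : Integrable (fun x => Real.exp (s / √n * ξ x) - 1) μ :=
          hEI.sub (integrable_const _)
        have hE2 : Integrable (fun x => Real.exp (s / √n * ξ x) - 1 - s / √n * ξ x) μ :=
          hE1.sub (hξI.const_mul _)
        rw [integral_sub hE2 (hξI2.const_mul _), integral_sub hE1 (hξI.const_mul _),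
          integral_sub hEI (integrable_const _), integral_const_mul, integral_const_mul, h0]
        simp
      rw [h1, div_pow, Real.sq_sqrt hn'.le]
      field_simp
      ring
    rw [e, norm_mul, Real.norm_natCast]
    have hbound : ‖∫ x, (Real.exp (s / √n * ξ x) - 1 - s / √n * ξ x - (s / √n * ξ x) ^ 2 / 2) ∂μ‖ ≤
        (2 * |s| / √n) ^ 3 := by
      refine le_trans (norm_integral_le_of_norm_le_const (C := (2 * |s| / √n) ^ 3)
        (Eventually.of_forall fun x => ?_)) (by simp)
      have h1 := Real.exp_bound (hx1 x) (n := 3) (by norm_num)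
      simp only [Finset.sum_range_succ, Finset.sum_range_zero] at h1
      norm_num [Nat.factorial] at h1
      rw [Real.norm_eq_abs]
      calc _ = |Real.exp (s / √n * ξ x) - (1 + s / √n * ξ x + (s / √n * ξ x) ^ 2 / 2)| := by
            congr 1; ring
        _ ≤ |s / √n * ξ x| ^ 3 * (2 / 9) := by convert h1 using 1; rw [abs_mul]
        _ ≤ |s / √n * ξ x| ^ 3 := mul_le_of_le_one_right (by positivity) (by norm_num)
        _ ≤ _ := pow_le_pow_left₀ (abs_nonneg _) (hx x) 3
    calc (n : ℝ) * _ ≤ n * (2 * |s| / √n) ^ 3 := by gcongr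
      _ = _ := by
        nth_rw 1 [← Real.sq_sqrt hn'.le]
        field_simp
  have := Real.tendsto_one_add_pow_exp_of_tendsto key
  simpa using this

variable {μ : Measure ℝ} {θ x₁ ρ B r c ω : ℝ} {k : ℕ}
  {A : ∀ n : ℕ, Finset (Config n)} {D D' : Set ℝ} [IsProbabilityMeasure μ]

lemma sqrt_mul_devSlope_eq {n : ℕ} (hn : 0 < n) (h : Fin n → ℝ) (y : ℝ) :
    √n * devSlope μ θ h y =
      -(√θ / √n) * ∑ i, (Real.tanh (√θ * y + h i) - meanTanh μ θ y) := by
  have hn' : (0 : ℝ) < n := by positivity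
  rw [devSlope_eq hn]
  nth_rw 2 [← Real.sq_sqrt hn'.le]
  field_simp

lemma gaussScaled_eq {n : ℕ} (hn : 0 < n) (a : ℝ) (σ : Config n) :
    gaussScaled a σ = √n * (totalSpin σ / n - a) := by
  have hn' : (0 : ℝ) < n := by positivity
  have h1 : gaussScaled a σ = (√n)⁻¹ * (totalSpin σ - n * a) := by
    simp [gaussScaled, totalSpin, Finset.sum_sub_distrib]
  rw [h1]
  have hd : 0 < √(n : ℝ) := by positivity
  have h2 : (n : ℝ) = √n * √n := (Real.mul_self_sqrt hn'.le).symm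
  rw [inv_mul_eq_div, div_eq_iff hd.ne', show √n * (totalSpin σ / n - a) * √n =
    (√n * √n) * (totalSpin σ / n - a) by ring, ← h2]
  field_simp

lemma gaussScaled_sq {n : ℕ} (hn : 0 < n) (a : ℝ) (σ : Config n) :
    gaussScaled a σ ^ 2 = n * |totalSpin σ / n - a| ^ (2 * 1) := by
  rw [gaussScaled_eq hn, mul_pow, Real.sq_sqrt (by positivity), mul_one, sq_abs]

namespace Phase

/-- The contribution of configurations outside the phase is negligible. -/
lemma eventually_error_le (P : Phase μ θ x₁ k A D D' ρ B r c ω) (R T : ℝ) {ε : ℝ} (hε : 0 < ε) :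
    ∀ᶠ n : ℕ in atTop, ∀ h : Fin n → ℝ, n * fluct μ θ x₁ B h ^ 2 ≤ R →
      ρ * (Real.exp (T * √n) * (√(2 * Real.pi) * Real.exp (-n * (empH θ h 0 - empH θ h x₁)))) ≤ ε := by
  rcases P.gap with h0 | ⟨h1, hg⟩
  · exact Eventually.of_forall fun n h _ => by rw [h0, zero_mul]; exact hε.le
  obtain ⟨η, hη⟩ : ∃ η, η = H μ θ 0 - H μ θ x₁ := ⟨_, rfl⟩
  have hη0 : 0 < η := by rw [hη]; exact sub_pos.2 hg
  have hd : Tendsto (fun n : ℕ => √(n : ℝ)) atTop atTop :=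
    Real.tendsto_sqrt_atTop.comp tendsto_natCast_atTop_atTop
  have hx1 : |0 - x₁| ≤ B := by
    have := P.le_B
    have := abs_nonneg x₁
    have := Real.sqrt_nonneg θ
    rw [zero_sub, abs_neg]; linarith
  obtain ⟨T', hT'⟩ : ∃ T', T' = T + √R * |x₁| + 1 := ⟨_, rfl⟩
  have hlim : Tendsto (fun n : ℕ => √(2 * Real.pi) * Real.exp (-√(n : ℝ))) atTop (𝓝 0) := by
    simpa using (Real.tendsto_exp_neg_atTop_nhds_zero.comp hd).const_mul √(2 * Real.pi)
  filter_upwards [eventually_gt_atTop 0, hlim.eventually (ge_mem_nhds hε),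
    hd.eventually_ge_atTop (T' / η)] with n hn hsmall hbig h hR
  have hn' : (0 : ℝ) < n := by positivity
  have hdp : 0 < √(n : ℝ) := by positivity
  rw [h1, one_mul]
  refine le_trans ?_ hsmall
  rw [mul_left_comm, ← Real.exp_add]
  gcongr
  have hdev := (abs_le.1 (abs_empH_dev_le (h := h) P.integrable hn P.theta_pos hx1)).1
  rw [← hη, zero_sub, abs_neg] at hdev
  have hfl := sqrt_mul_fluct_le hR
  have hns : (n : ℝ) = √n * √n := (Real.mul_self_sqrt hn'.le).symm
  have h2 : (n : ℝ) * (η - fluct μ θ x₁ B h * |x₁|) ≤ n * (empH θ h 0 - empH θ h x₁) := by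
    refine mul_le_mul_of_nonneg_left ?_ hn'.le
    linarith
  have h3 : (n : ℝ) * (fluct μ θ x₁ B h * |x₁|) ≤ √n * (√R * |x₁|) := by
    rw [show (n : ℝ) * (fluct μ θ x₁ B h * |x₁|) = √n * ((√n * fluct μ θ x₁ B h) * |x₁|) by
      nth_rw 1 [hns]; ring]
    gcongr
  rw [div_le_iff₀ hη0] at hbig
  have h4 : √n * T' ≤ n * η := by
    nth_rw 2 [hns]
    rw [mul_assoc]
    gcongr
  rw [hT'] at h4
  linarith

/-- Conditionally on the field, the moment generating function is asymptotically that of a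
Gaussian variable, uniformly over fields with bounded rescaled fluctuations. -/
lemma eventually_gibbs_mgf (P : Phase μ θ x₁ 1 A D D' ρ B r c ω) {v : ℝ}
    (hv : v = 1 - θ * meanSechSq μ θ x₁) (hv0 : 0 < v) (t R : ℝ) {ε : ℝ} (hε : 0 < ε) :
    ∀ᶠ n : ℕ in atTop, ∀ h : Fin n → ℝ, n * fluct μ θ x₁ B h ^ 2 ≤ R →
      |gibbs θ h (A n) (fun σ => Real.exp (t * gaussScaled (meanTanh μ θ x₁) σ)) -
        Real.exp (-(t ^ 2 / (2 * θ)) + (t / √θ) ^ 2 / (2 * v) -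
          t / √θ / v * (√n * devSlope μ θ h x₁))| ≤ ε := by
  have hpi := Real.pi_pos
  have hθ := P.theta_pos
  obtain ⟨l, hl⟩ : ∃ l, l = t / √θ := ⟨_, rfl⟩
  rw [← hl]
  obtain ⟨q, hq⟩ : ∃ q, q = √(2 * Real.pi / v) := ⟨_, rfl⟩
  have hq0 : 0 < q := by rw [hq]; positivity
  obtain ⟨S, hS⟩ : ∃ S, S = Real.exp (l ^ 2 / (2 * v) + |l / v| * √R) := ⟨_, rfl⟩
  have hS0 : 0 < S := by rw [hS]; exact Real.exp_pos _
  obtain ⟨δ, hδ⟩ : ∃ δ, δ = min (q / 2) (ε * (q / 2) / (1 + S)) := ⟨_, rfl⟩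
  have hδ0 : 0 < δ := by rw [hδ]; positivity
  have hδq : δ ≤ q / 2 := hδ.trans_le (min_le_left _ _)
  have hδε : δ ≤ ε * (q / 2) / (1 + S) := hδ.trans_le (min_le_right _ _)
  filter_upwards [eventually_gt_atTop 0,
    P.eventually_integral_tilted hv hv0 l l R (half_pos hδ0),
    P.eventually_integral_tilted hv hv0 0 0 R (half_pos hδ0),
    P.eventually_error_le R (2 * |t|) (half_pos hδ0), P.eventually_error_le R 0 (half_pos hδ0)]
    with n hn hL hZ herrL herrZ h hR
  specialize hL h hR
  specialize hZ h hR
  specialize herrL h hR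
  specialize herrZ h hR
  have hn' : (0 : ℝ) < n := by positivity
  have hdp : 0 < √(n : ℝ) := by positivity
  obtain ⟨w, hw⟩ : ∃ w, w = √n * devSlope μ θ h x₁ := ⟨_, rfl⟩
  have hwR : |w| ≤ √R := by
    rw [hw, abs_mul, abs_of_nonneg (Real.sqrt_nonneg _)]
    exact (mul_le_mul_of_nonneg_left abs_devSlope_center_le (Real.sqrt_nonneg _)).trans
      (sqrt_mul_fluct_le hR)
  obtain ⟨N, hN⟩ : ∃ N, N = normConst θ h x₁ * (√n)⁻¹ := ⟨_, rfl⟩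
  have hN0 : 0 < N := by rw [hN]; have := normConst_pos hn θ h x₁; positivity
  have herr : 2 ^ n * Real.exp (-n * empH θ h 0) =
      N * (√(2 * Real.pi) * Real.exp (-n * (empH θ h 0 - empH θ h x₁))) := by
    rw [hN, normConst, Real.sqrt_div hn'.le, mul_sub, Real.exp_sub]
    have h1 := Real.exp_pos (-n * empH θ h x₁)
    have h2 : 0 < √(2 * Real.pi) := by positivity
    field_simp
  have htriv : ∀ σ : Config n, |Real.exp (t * gaussScaled (meanTanh μ θ x₁) σ)| ≤
      Real.exp (2 * |t| * √n) := by
    intro σ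
    rw [Real.abs_exp, Real.exp_le_exp, gaussScaled_eq hn]
    refine (le_abs_self _).trans ?_
    rw [abs_mul, abs_mul, abs_of_pos hdp]
    have := abs_mag_sub_le (μ := μ) (θ := θ) (x₁ := x₁) hn σ
    calc |t| * (√n * |totalSpin σ / n - meanTanh μ θ x₁|) ≤ |t| * (√n * 2) := by gcongr
      _ = _ := by ring
  have hD := (P.approx n hn h).1
  have haL := (P.approx n hn h).2 _ _ htriv
  have haZ := (P.approx n hn h).2 (fun σ => Real.exp (0 * gaussScaled (meanTanh μ θ x₁) σ)) 1
    (fun _ => by simp)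
  rw [integral_mgf_region hθ hn h hD P.crit] at haL haZ
  have e1 : t / (√n * √θ) = l / √n := by rw [hl]; field_simp
  have e2 : (0 : ℝ) / (√n * √θ) = 0 / √n := by simp
  rw [e1, ← hl, ← hN, herr] at haL
  rw [e2, ← hN, herr, zero_div √θ] at haZ
  simp only [zero_mul, Real.exp_zero, mul_one, ne_eq, OfNat.ofNat_ne_zero, not_false_eq_true,
    zero_pow, zero_div, neg_zero, one_mul] at haZ hZ herrZ
  rw [← hw] at hL ⊢
  rw [← hw, zero_sub, neg_sq, ← hq] at hZ
  rw [← hq] at hL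
  obtain ⟨IL, hIL⟩ : ∃ I, I = ∫ u, tilted θ x₁ D h l (l / √n) u := ⟨_, rfl⟩
  obtain ⟨IZ, hIZ⟩ : ∃ I, I = ∫ u, tilted θ x₁ D h 0 0 u := ⟨_, rfl⟩
  rw [← hIL] at haL hL
  rw [← hIZ] at haZ hZ
  obtain ⟨E0, hE0⟩ : ∃ E, E = √(2 * Real.pi) * Real.exp (-n * (empH θ h 0 - empH θ h x₁)) :=
    ⟨_, rfl⟩
  rw [← hE0] at haL haZ herrL herrZ
  obtain ⟨b, hb⟩ : ∃ b, b = Real.exp (-(t ^ 2 / (2 * θ))) := ⟨_, rfl⟩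
  have hb1 : b ≤ 1 := by rw [hb, Real.exp_le_one_iff]; have := hθ; simp; positivity
  have hb0 : 0 < b := by rw [hb]; exact Real.exp_pos _
  rw [← hb] at haL
  -- normalize numerator and denominator
  have hp : |(∑ σ ∈ A n, weight θ h σ * Real.exp (t * gaussScaled (meanTanh μ θ x₁) σ)) / N -
      b * (q * Real.exp ((l - w) ^ 2 / (2 * v)))| ≤ δ := by
    have h1 : |(∑ σ ∈ A n, weight θ h σ * Real.exp (t * gaussScaled (meanTanh μ θ x₁) σ)) / N -
        b * IL| ≤ δ / 2 := by
      rw [show (∑ σ ∈ A n, weight θ h σ * Real.exp (t * gaussScaled (meanTanh μ θ x₁) σ)) / N -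
        b * IL = ((∑ σ ∈ A n, weight θ h σ * Real.exp (t * gaussScaled (meanTanh μ θ x₁) σ)) -
        N * (b * IL)) / N by field_simp, abs_div, abs_of_pos hN0, div_le_iff₀ hN0]
      refine haL.trans ?_
      calc _ = ρ * (Real.exp (2 * |t| * √n) * E0) * N := by ring
        _ ≤ _ := by gcongr
    have h2 : |b * IL - b * (q * Real.exp ((l - w) ^ 2 / (2 * v)))| ≤ δ / 2 := by
      rw [← mul_sub, abs_mul, abs_of_pos hb0]
      calc _ ≤ 1 * (δ / 2) := by gcongr
        _ = _ := one_mul _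
    calc _ ≤ _ := abs_sub_le _ (b * IL) _
      _ ≤ δ / 2 + δ / 2 := by gcongr
      _ = δ := by ring
  have hz : |(∑ σ ∈ A n, weight θ h σ) / N - q * Real.exp (w ^ 2 / (2 * v))| ≤ δ := by
    have h1 : |(∑ σ ∈ A n, weight θ h σ) / N - IZ| ≤ δ / 2 := by
      rw [show (∑ σ ∈ A n, weight θ h σ) / N - IZ = ((∑ σ ∈ A n, weight θ h σ) - N * IZ) / N by
        field_simp, abs_div, abs_of_pos hN0, div_le_iff₀ hN0]
      refine haZ.trans ?_
      calc _ = ρ * E0 * N := by ring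
        _ ≤ _ := by gcongr
    calc _ ≤ _ := abs_sub_le _ IZ _
      _ ≤ δ / 2 + δ / 2 := by gcongr
      _ = δ := by ring
  have hq₀ : q ≤ q * Real.exp (w ^ 2 / (2 * v)) :=
    le_mul_of_one_le_right hq0.le (Real.one_le_exp (by positivity))
  have hfin := abs_div_sub_div_le (g := Real.exp (-(t ^ 2 / (2 * θ)) + l ^ 2 / (2 * v) - l / v * w))
    hp hz (by positivity) (by linarith) (by
      rw [hb, mul_left_comm, ← Real.exp_add, mul_left_comm, ← Real.exp_add]
      congr 2
      field_simp
      ring)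
  have hdivN : (∑ σ ∈ A n, weight θ h σ * Real.exp (t * gaussScaled (meanTanh μ θ x₁) σ)) / N /
      ((∑ σ ∈ A n, weight θ h σ) / N) = gibbs θ h (A n)
        (fun σ => Real.exp (t * gaussScaled (meanTanh μ θ x₁) σ)) := by
    rw [gibbs, div_div_div_cancel_right₀ hN0.ne']
  rw [hdivN] at hfin
  refine hfin.trans ?_
  have hgS : |Real.exp (-(t ^ 2 / (2 * θ)) + l ^ 2 / (2 * v) - l / v * w)| ≤ S := by
    rw [Real.abs_exp, hS, Real.exp_le_exp]
    have h1 : -(l / v * w) ≤ |l / v| * √R := by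
      refine (neg_le_abs _).trans ?_
      rw [abs_mul]
      gcongr
    have h2 : 0 ≤ t ^ 2 / (2 * θ) := by positivity
    linarith
  rw [div_le_iff₀ (by positivity)]
  rw [le_div_iff₀ (by positivity)] at hδε
  calc _ ≤ δ * (1 + S) := by gcongr
    _ ≤ ε * (q / 2) := hδε
    _ ≤ _ := by gcongr

/-- **Gaussian limit.** At a nondegenerate minimum, the moment generating function of the rescaled
magnetization converges to that of a centred Gaussian variable. -/
theorem tendsto_expect_mgf (P : Phase μ θ x₁ 1 A D D' ρ B r c ω)
    (hv0 : θ * meanSechSq μ θ x₁ < 1) (t : ℝ) :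
    Tendsto (fun n : ℕ => expect μ θ (A n) fun σ =>
      Real.exp (t * gaussScaled (meanTanh μ θ x₁) σ)) atTop
      (𝓝 (Real.exp (gaussVar μ θ x₁ * t ^ 2 / 2))) := by
  have hθ := P.theta_pos
  obtain ⟨v, hv⟩ : ∃ v, v = 1 - θ * meanSechSq μ θ x₁ := ⟨_, rfl⟩
  have hvpos : 0 < v := by rw [hv]; linarith
  obtain ⟨κ, l, C, C', hκ, hl, hC, hC', ht⟩ := P.exists_tight
  obtain ⟨b, hb⟩ : ∃ b, b = -(t ^ 2 / (2 * θ)) + (t / √θ) ^ 2 / (2 * v) := ⟨_, rfl⟩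
  obtain ⟨p, hp⟩ : ∃ p, p = t / √θ / v := ⟨_, rfl⟩
  have hGc : ∀ n : ℕ, Continuous fun h : Fin n → ℝ =>
      Real.exp (b - p * (√n * devSlope μ θ h x₁)) := by
    intro n
    have := continuous_devSlope_left (n := n) (μ := μ) (θ := θ) x₁
    fun_prop
  have hGb : ∀ n : ℕ, ∀ h : Fin n → ℝ, |Real.exp (b - p * (√n * devSlope μ θ h x₁))| ≤
      Real.exp (b + p ^ 2 / (4 * l)) * Real.exp (l * (n * fluct μ θ x₁ B h ^ 2)) := by
    intro n h
    rw [Real.abs_exp, ← Real.exp_add, Real.exp_le_exp]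
    have h1 : (√n * devSlope μ θ h x₁) ^ 2 ≤ n * fluct μ θ x₁ B h ^ 2 := by
      rw [mul_pow, Real.sq_sqrt (by positivity), ← sq_abs (devSlope μ θ h x₁)]
      gcongr
      exact abs_devSlope_center_le
    have h2 : 0 ≤ (2 * l * (√n * devSlope μ θ h x₁) + p) ^ 2 / (4 * l) := by positivity
    have h3 : (2 * l * (√n * devSlope μ θ h x₁) + p) ^ 2 / (4 * l) =
        l * (√n * devSlope μ θ h x₁) ^ 2 + p * (√n * devSlope μ θ h x₁) + p ^ 2 / (4 * l) := by
      field_simp; ring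
    nlinarith
  have hFb : ∀ n : ℕ, 0 < n → ∀ h : Fin n → ℝ,
      |gibbs θ h (A n) (fun σ => Real.exp (t * gaussScaled (meanTanh μ θ x₁) σ))| ≤
      Real.exp (t ^ 2 / (4 * κ)) * C * Real.exp (l * (n * fluct μ θ x₁ B h ^ 2)) := by
    intro n hn h
    rw [abs_of_nonneg (gibbs_nonneg fun σ _ => (Real.exp_pos _).le)]
    calc _ ≤ gibbs θ h (A n) (fun σ => Real.exp (t ^ 2 / (4 * κ)) *
          Real.exp (κ * (n * |totalSpin σ / n - meanTanh μ θ x₁| ^ (2 * 1)))) := by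
          refine gibbs_mono fun σ _ => ?_
          rw [← gaussScaled_sq hn, ← Real.exp_add, Real.exp_le_exp]
          have h2 : 0 ≤ (2 * κ * gaussScaled (meanTanh μ θ x₁) σ - t) ^ 2 / (4 * κ) := by positivity
          have h3 : (2 * κ * gaussScaled (meanTanh μ θ x₁) σ - t) ^ 2 / (4 * κ) =
            κ * gaussScaled (meanTanh μ θ x₁) σ ^ 2 - t * gaussScaled (meanTanh μ θ x₁) σ +
              t ^ 2 / (4 * κ) := by field_simp; ring
          linarith
      _ ≤ Real.exp (t ^ 2 / (4 * κ)) * (C * Real.exp (l * (n * fluct μ θ x₁ B h ^ 2))) := by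
          rw [gibbs_const_mul]
          gcongr
          exact (ht n hn).1 h
      _ = _ := by ring
  have hdiff := tendsto_integral_sub_of_uniform (Q := fun n => Measure.pi fun _ : Fin n => μ)
    (F := fun n h => gibbs θ h (A n) (fun σ => Real.exp (t * gaussScaled (meanTanh μ θ x₁) σ)))
    (G := fun n h => Real.exp (b - p * (√n * devSlope μ θ h x₁)))
    (X := fun n h => n * fluct μ θ x₁ B h ^ 2) (κ := l)
    (C := max (Real.exp (t ^ 2 / (4 * κ)) * C) (Real.exp (b + p ^ 2 / (4 * l)))) (C' := C') hl
    (fun n hn => integrable_gibbs μ (P.nonempty n hn))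
    (fun n hn => (integrable_exp_fluct hθ x₁ P.B_pos l).const_mul _ |>.mono'
      (hGc n).aestronglyMeasurable (Eventually.of_forall (hGb n)))
    (fun n hn => integrable_exp_fluct hθ x₁ P.B_pos _) (fun n hn => (ht n hn).2)
    (fun n hn h => (hFb n hn h).trans (by gcongr; exact le_max_left _ _))
    (fun n hn h => (hGb n h).trans (by gcongr; exact le_max_right _ _))
    (fun R ε hε => by
      rw [hb, hp]
      exact P.eventually_gibbs_mgf hv hvpos t R hε)
  have hG : Tendsto (fun n : ℕ => ∫ h, Real.exp (b - p * (√n * devSlope μ θ h x₁))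
      ∂(Measure.pi fun _ : Fin n => μ)) atTop (𝓝 (Real.exp (gaussVar μ θ x₁ * t ^ 2 / 2))) := by
    have h1 := (tendsto_mgf_pow (μ := μ) (ξ := fun x => Real.tanh (√θ * x₁ + x) - meanTanh μ θ x₁)
      ((continuous_tanh.comp (by fun_prop)).sub continuous_const) (abs_tanh_sub_mean_le x₁)
      (integral_tanh_sub_mean x₁) (p * √θ)).const_mul (Real.exp b)
    have hvar : ∫ x, (Real.tanh (√θ * x₁ + x) - meanTanh μ θ x₁) ^ 2 ∂μ =
        1 - meanSechSq μ θ x₁ - meanTanh μ θ x₁ ^ 2 := by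
      have hc : Continuous fun x => Real.tanh (√θ * x₁ + x) :=
        continuous_tanh.comp (by fun_prop)
      rw [← variance_tanh_eq, ProbabilityTheory.variance_eq_integral
        hc.measurable.aemeasurable]
      rfl
    rw [hvar, ← Real.exp_add] at h1
    have e : b + (p * √θ) ^ 2 * (1 - meanSechSq μ θ x₁ - meanTanh μ θ x₁ ^ 2) / 2 =
        gaussVar μ θ x₁ * t ^ 2 / 2 := by
      simp only [hb, hp, gaussVar, ← hv, mul_pow, div_pow, Real.sq_sqrt hθ.le]
      have hs : meanSechSq μ θ x₁ = (1 - v) / θ := by rw [hv]; field_simp; ring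
      rw [hs]
      field_simp
      ring
    rw [e] at h1
    refine h1.congr' ?_
    filter_upwards [eventually_gt_atTop 0] with n hn
    have h2 : ∀ h : Fin n → ℝ, Real.exp (b - p * (√n * devSlope μ θ h x₁)) = Real.exp b *
        Real.exp (p * √θ / √n * ∑ i, (Real.tanh (√θ * x₁ + h i) - meanTanh μ θ x₁)) := by
      intro h
      rw [← Real.exp_add, sqrt_mul_devSlope_eq hn]
      congr 1
      ring
    simp_rw [h2]
    rw [integral_const_mul,
      integral_exp_mul_sum (fun x => Real.tanh (√θ * x₁ + x) - meanTanh μ θ x₁)]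
  have := hdiff.add hG
  simpa [expect] using this

end Phase

end GaussianExpectation

/-! ### Odd roots and even powers -/

section Powers

lemma surjective_odd_pow {k : ℕ} (hk : Odd k) : Function.Surjective fun x : ℝ => x ^ k := by
  have hk0 : k ≠ 0 := hk.pos.ne'
  intro x
  rcases le_total 0 x with hx | hx
  · exact ⟨x ^ (k : ℝ)⁻¹, Real.rpow_inv_natCast_pow hx hk0⟩
  · refine ⟨-(-x) ^ (k : ℝ)⁻¹, ?_⟩
    simp only
    rw [hk.neg_pow, Real.rpow_inv_natCast_pow (by linarith) hk0, neg_neg]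

/-- The `k`-th power, for odd `k`, as an order isomorphism of the real line. -/
noncomputable def oddPow {k : ℕ} (hk : Odd k) : ℝ ≃o ℝ :=
  StrictMono.orderIsoOfSurjective _ hk.strictMono_pow (surjective_odd_pow hk)

/-- The real `k`-th root, for odd `k`. -/
noncomputable def oddRoot {k : ℕ} (hk : Odd k) (x : ℝ) : ℝ := (oddPow hk).symm x

variable {k : ℕ} (hk : Odd k)

lemma oddRoot_pow (x : ℝ) : oddRoot hk x ^ k = x := (oddPow hk).apply_symm_apply x

lemma oddRoot_of_pow (x : ℝ) : oddRoot hk (x ^ k) = x := (oddPow hk).symm_apply_apply x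

lemma continuous_oddRoot : Continuous (oddRoot hk) := (oddPow hk).symm.continuous

lemma oddRoot_eq_of_pow_eq {x y : ℝ} (h : y ^ k = x) : oddRoot hk x = y := by
  rw [← h, oddRoot_of_pow]

lemma oddRoot_neg (x : ℝ) : oddRoot hk (-x) = -oddRoot hk x :=
  oddRoot_eq_of_pow_eq hk (by rw [hk.neg_pow, oddRoot_pow])

lemma abs_oddRoot_le (x : ℝ) : |oddRoot hk x| ≤ 1 + |x| := by
  have h1 := congrArg abs (oddRoot_pow hk x)
  rw [abs_pow] at h1
  rcases le_total |oddRoot hk x| 1 with h | h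
  · linarith [abs_nonneg x]
  · have : |oddRoot hk x| ≤ |oddRoot hk x| ^ k := le_self_pow₀ h hk.pos.ne'
    linarith

lemma tangent_le_even_pow {p : ℕ} (hp : Even p) (u v : ℝ) :
    v ^ p + p * v ^ (p - 1) * (u - v) ≤ u ^ p := by
  have hc : ConvexOn ℝ Set.univ fun x : ℝ => x ^ p := hp.convexOn_pow
  have hd := hasDerivAt_pow p v
  rcases lt_trichotomy u v with h | h | h
  · have := hc.slope_le_of_hasDerivAt (Set.mem_univ u) (Set.mem_univ v) h hd
    rw [slope_def_field, div_le_iff₀ (by linarith)] at this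
    linarith
  · simp [h]
  · have := hc.le_slope_of_hasDerivAt (Set.mem_univ v) (Set.mem_univ u) h hd
    rw [slope_def_field, le_div_iff₀ (by linarith)] at this
    linarith

lemma half_add_pow_add_half_sub_pow_le {j : ℕ} (hj : j ≠ 0) (u v : ℝ) :
    ((u + v) / 2) ^ (2 * j) + ((u - v) / 2) ^ (2 * j) ≤ (u ^ (2 * j) + v ^ (2 * j)) / 2 := by
  simp only [pow_mul]
  calc _ ≤ (((u + v) / 2) ^ 2 + ((u - v) / 2) ^ 2) ^ j :=
        pow_add_pow_le (sq_nonneg _) (sq_nonneg _) hj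
    _ = (u ^ 2 + v ^ 2) ^ j / 2 ^ j := by rw [← div_pow]; congr 1; ring
    _ ≤ 2 ^ (j - 1) * ((u ^ 2) ^ j + (v ^ 2) ^ j) / 2 ^ j := by
        gcongr
        exact add_pow_le (sq_nonneg _) (sq_nonneg _) j
    _ = _ := by
        have : (2 : ℝ) ^ j = 2 ^ (j - 1) * 2 := (pow_sub_one_mul hj 2).symm
        rw [this]
        field_simp

/-- Uniform convexity of even powers. -/
lemma even_pow_sub_tangent_ge {p : ℕ} (hp : Even p) (hp0 : p ≠ 0) (u v : ℝ) :
    2 * ((u - v) / 2) ^ p ≤ u ^ p - v ^ p - p * v ^ (p - 1) * (u - v) := by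
  obtain ⟨j, hj⟩ := hp.two_dvd
  have h1 := half_add_pow_add_half_sub_pow_le (j := j) (by rintro rfl; simp at hj; exact hp0 hj) u v
  rw [← hj] at h1
  have h2 := tangent_le_even_pow hp ((u + v) / 2) v
  have h3 : p * v ^ (p - 1) * ((u + v) / 2 - v) = p * v ^ (p - 1) * (u - v) / 2 := by ring
  rw [h3] at h2
  linarith

end Powers

/-! ### The critical scale -/

section CriticalScale

/-- `n^{1/(2k)}`. -/
noncomputable def scale (k n : ℕ) : ℝ := (n : ℝ) ^ (((2 * k : ℕ) : ℝ)⁻¹)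

lemma scale_pow {k : ℕ} (hk : 1 ≤ k) (n : ℕ) : scale k n ^ (2 * k) = n :=
  Real.rpow_inv_natCast_pow (by positivity) (by omega)

lemma scale_nonneg (k n : ℕ) : 0 ≤ scale k n := by unfold scale; positivity

lemma scale_pow_half {k : ℕ} (hk : 1 ≤ k) (n : ℕ) : scale k n ^ k = √n := by
  rw [eq_comm, Real.sqrt_eq_iff_mul_self_eq (by positivity) (pow_nonneg (scale_nonneg _ _) _),
    ← pow_add, ← two_mul, scale_pow hk]

lemma one_le_scale (k : ℕ) {n : ℕ} (hn : 0 < n) : 1 ≤ scale k n :=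
  Real.one_le_rpow (by exact_mod_cast hn) (by positivity)

lemma tendsto_scale {k : ℕ} (hk : 1 ≤ k) : Tendsto (scale k) atTop atTop :=
  (tendsto_rpow_atTop (by positivity)).comp tendsto_natCast_atTop_atTop

/-- `n^{1/(2k)} (m - a)`. -/
noncomputable def magScaled (k : ℕ) {n : ℕ} (a : ℝ) (σ : Config n) : ℝ :=
  scale k n * (totalSpin σ / n - a)

lemma abs_magScaled_pow {k n : ℕ} (hk : 1 ≤ k) (a : ℝ) (σ : Config n) :
    |magScaled k a σ| ^ (2 * k) = n * |totalSpin σ / n - a| ^ (2 * k) := by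
  rw [magScaled, abs_mul, mul_pow, abs_of_nonneg (scale_nonneg _ _), scale_pow hk]

variable {μ : Measure ℝ} {θ x₁ ρ B r c ω b : ℝ} {k : ℕ}
  {A : ∀ n : ℕ, Finset (Config n)} {D D' : Set ℝ} [IsProbabilityMeasure μ]

namespace Phase

/-- On the critical scale the empirical energy is a tilted even power, up to an error which is
uniformly small over fields with bounded rescaled fluctuations. -/
lemma eventually_empH_scaled (P : Phase μ θ x₁ k A D D' ρ B r c ω)
    (hloc : (fun x => H μ θ x - H μ θ x₁ - b * (x - x₁) ^ (k + 1)) =O[𝓝 x₁]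
      fun x => (x - x₁) ^ (k + 2)) (R : ℝ) {U η : ℝ} (hU : 0 < U) (hη : 0 < η) :
    ∀ᶠ n : ℕ in atTop, ∀ h : Fin n → ℝ, n * fluct μ θ x₁ B h ^ 2 ≤ R → ∀ y,
      |scale k n * (y - x₁)| ≤ U →
      |n * (empH θ h y - empH θ h x₁) - scale k n ^ (k - 1) *
        (b * (scale k n * (y - x₁)) ^ (k + 1) +
          √n * devSlope μ θ h x₁ * (scale k n * (y - x₁)))| ≤ scale k n ^ (k - 1) * η := by
  have hk := P.one_le_k
  have hB := P.B_pos
  obtain ⟨C, hC0, hC⟩ := hloc.exists_pos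
  obtain ⟨e, he, hball⟩ := Metric.eventually_nhds_iff.1 hC.bound
  have hs := tendsto_scale hk
  have hlim : Tendsto (fun n => C * U ^ (k + 2) / scale k n + √R * U * √(U / scale k n)) atTop
      (𝓝 0) := by
    have h1 : Tendsto (fun n => √(U / scale k n)) atTop (𝓝 0) := by
      simpa using (hs.const_div_atTop U).sqrt
    simpa using (hs.const_div_atTop (C * U ^ (k + 2))).add (h1.const_mul (√R * U))
  filter_upwards [eventually_gt_atTop 0, hlim.eventually (ge_mem_nhds hη),
    (hs.const_div_atTop U).eventually (gt_mem_nhds he),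
    (hs.const_div_atTop U).eventually (ge_mem_nhds hB)] with n hn hsmall hUe hUB h hR y hy
  have hn' : (0 : ℝ) < n := by positivity
  obtain ⟨s, hsd⟩ : ∃ s, s = scale k n := ⟨_, rfl⟩
  have hs0 : 0 < s := by rw [hsd]; linarith [one_le_scale k hn]
  have hsk : s ^ k = √n := by rw [hsd, scale_pow_half hk]
  have hsk' : s ^ (k - 1) * s = √n := by rw [pow_sub_one_mul (by omega), hsk]
  have hns : (n : ℝ) = √n * √n := (Real.mul_self_sqrt hn'.le).symm
  rw [← hsd] at hy hUe hUB hsmall ⊢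
  obtain ⟨z, hz⟩ : ∃ z, z = y - x₁ := ⟨_, rfl⟩
  rw [← hz] at hy ⊢
  have hzU : |z| ≤ U / s := by
    rw [le_div_iff₀ hs0, mul_comm]
    rwa [abs_mul, abs_of_pos hs0] at hy
  have h1 := hball (y := y) (by rw [Real.dist_eq, ← hz]; linarith)
  rw [Real.norm_eq_abs, Real.norm_eq_abs, ← hz, abs_pow] at h1
  have h2 := abs_empH_dev_linear_le (B := B) (h := h) (y := y) P.integrable hn P.theta_pos
    (by rw [← hz]; exact hzU.trans hUB)
  rw [← hz] at h2
  have hfl := sqrt_mul_fluct_le hR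
  obtain ⟨N, hN⟩ : ∃ N, N = s ^ (k - 1) := ⟨_, rfl⟩
  rw [← hN] at hsk' ⊢
  have hN0 : 0 < N := by rw [hN]; positivity
  have e1 : (n : ℝ) * (b * z ^ (k + 1)) = N * (b * (s * z) ^ (k + 1)) := by
    rw [mul_pow, pow_succ s, hsk, show N * (b * (√n * s * z ^ (k + 1))) =
      (N * s) * √n * (b * z ^ (k + 1)) by ring, hsk', ← hns]
  have e2 : (n : ℝ) * (devSlope μ θ h x₁ * z) = N * (√n * devSlope μ θ h x₁ * (s * z)) := by
    rw [show N * (√n * devSlope μ θ h x₁ * (s * z)) = (N * s) * √n * (devSlope μ θ h x₁ * z) by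
      ring, hsk', ← hns]
  have e3 : (n : ℝ) * (C * |z| ^ (k + 2)) ≤ N * (C * U ^ (k + 2) / s) := by
    have h3 : |z| ^ (k + 2) ≤ (U / s) ^ (k + 2) := pow_le_pow_left₀ (abs_nonneg _) hzU _
    calc (n : ℝ) * (C * |z| ^ (k + 2)) ≤ n * (C * (U / s) ^ (k + 2)) := by gcongr
      _ = √n * √n * (C * (U ^ (k + 2) / (s ^ k * s ^ 2))) := by
          rw [← hns, div_pow, pow_add s]
      _ = N * (C * U ^ (k + 2) / s) := by
          rw [hsk]
          nth_rw 1 [← hsk']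
          have : 0 < √(n : ℝ) := by positivity
          field_simp
  have e4 : (n : ℝ) * (fluct μ θ x₁ B h * (√|z| * |z|)) ≤ N * (√R * U * √(U / s)) := by
    calc (n : ℝ) * (fluct μ θ x₁ B h * (√|z| * |z|)) =
          N * ((√n * fluct μ θ x₁ B h) * (s * |z|) * √|z|) := by
          nth_rw 1 [hns]
          nth_rw 1 [← hsk']
          ring
      _ ≤ _ := by
          have h4 : s * |z| ≤ U := by rwa [abs_mul, abs_of_pos hs0] at hy
          have h5 := fluct_nonneg (μ := μ) (θ := θ) (x := x₁) (B := B) (h := h)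
          gcongr
  have h3 : |n * (empH θ h y - empH θ h x₁) - N * (b * (s * z) ^ (k + 1) +
      √n * devSlope μ θ h x₁ * (s * z))| ≤ n * (C * |z| ^ (k + 2)) +
        n * (fluct μ θ x₁ B h * (√|z| * |z|)) := by
    rw [mul_add N, ← e1, ← e2]
    calc _ = |n * (empH θ h y - empH θ h x₁ - (H μ θ y - H μ θ x₁) - devSlope μ θ h x₁ * z) +
          n * (H μ θ y - H μ θ x₁ - b * z ^ (k + 1))| := by congr 1; ring
      _ ≤ _ := by
        refine (abs_add_le _ _).trans ?_
        rw [abs_mul, abs_mul, Nat.abs_cast, add_comm]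
        gcongr
  calc _ ≤ _ := h3
    _ ≤ N * (C * U ^ (k + 2) / s) + N * (√R * U * √(U / s)) := add_le_add e3 e4
    _ = N * (C * U ^ (k + 2) / s + √R * U * √(U / s)) := by ring
    _ ≤ N * η := by gcongr

end Phase

end CriticalScale

section Concentration

variable {μ : Measure ℝ} {θ x₁ ρ B r c ω b : ℝ} {k : ℕ}
  {A : ∀ n : ℕ, Finset (Config n)} {D D' : Set ℝ} [IsProbabilityMeasure μ]

lemma tilted_pow_sub_ge (hk : Odd k) (hb : 0 < b) {w v : ℝ} (hv : (k + 1) * b * v ^ k = -w)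
    {δ u : ℝ} (hδ : 0 ≤ δ) (hu : δ ≤ |u - v|) :
    (b * v ^ (k + 1) + w * v) + b * (2 * (δ / 2) ^ (k + 1)) ≤ b * u ^ (k + 1) + w * u := by
  have hp : Even (k + 1) := hk.add_one
  have h1 := even_pow_sub_tangent_ge hp (by omega) u v
  rw [Nat.add_sub_cancel] at h1
  have h2 : (δ / 2) ^ (k + 1) ≤ ((u - v) / 2) ^ (k + 1) := by
    rw [← hp.pow_abs ((u - v) / 2), abs_div, abs_of_pos (two_pos : (0 : ℝ) < 2)]
    gcongr
  have h3 : b * (2 * (δ / 2) ^ (k + 1)) ≤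
      b * (u ^ (k + 1) - v ^ (k + 1) - (k + 1 : ℕ) * v ^ k * (u - v)) := by
    refine mul_le_mul_of_nonneg_left ?_ hb.le
    linarith
  have h4 : b * ((k + 1 : ℕ) * v ^ k * (u - v)) = -w * (u - v) := by
    rw [← hv]; push_cast; ring
  nlinarith

lemma tilted_pow_sub_le (hb : 0 < b) {w W U u v δ : ℝ} (hw : |w| ≤ W) (hu : |u| ≤ U) (hv : |v| ≤ U)
    (huv : |u - v| ≤ δ) : b * u ^ (k + 1) + w * u ≤ (b * v ^ (k + 1) + w * v) +
      (b * ((k + 1) * U ^ k) + W) * δ := by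
  have h1 := abs_pow_sub_pow_le u v (k + 1)
  rw [Nat.add_sub_cancel] at h1
  have hU : 0 ≤ U := (abs_nonneg _).trans hu
  have hW : 0 ≤ W := (abs_nonneg _).trans hw
  have h2 : |u ^ (k + 1) - v ^ (k + 1)| ≤ δ * ((k + 1) * U ^ k) := by
    refine h1.trans ?_
    rw [mul_assoc]
    push_cast
    have h3 : max |u| |v| ≤ U := max_le hu hv
    gcongr
    exact (abs_nonneg _).trans huv
  have h3 : w * (u - v) ≤ W * δ := by
    refine (le_abs_self _).trans ?_
    rw [abs_mul]
    gcongr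
  have h4 := mul_le_mul_of_nonneg_left ((le_abs_self _).trans h2) hb.le
  nlinarith

/-- The limit of the rescaled magnetization given the field. -/
noncomputable def critCenter (μ : Measure ℝ) (θ x₁ b : ℝ) {k : ℕ} (hk : Odd k) {n : ℕ}
    (h : Fin n → ℝ) : ℝ :=
  oddRoot hk (-(√n * devSlope μ θ h x₁) / ((k + 1) * b)) / √θ

namespace Phase

lemma gibbs_large_le (P : Phase μ θ x₁ k A D D' ρ B r c ω) (R : ℝ) {ε : ℝ} (hε : 0 < ε) :
    ∃ M : ℝ, 0 < M ∧ ∀ n : ℕ, 0 < n → ∀ h : Fin n → ℝ, n * fluct μ θ x₁ B h ^ 2 ≤ R →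
      gibbs θ h (A n) ({σ | M < |magScaled k (meanTanh μ θ x₁) σ|}.indicator 1) ≤ ε := by
  obtain ⟨κ, l, C, C', hκ, hl, hC, hC', ht⟩ := P.exists_tight
  have hk := P.one_le_k
  obtain ⟨M, hM1, hM⟩ : ∃ M : ℝ, 1 ≤ M ∧ Real.exp (-(κ * M)) * (C * Real.exp (l * R)) ≤ ε := by
    have h1 : Tendsto (fun M => κ * M) atTop atTop := tendsto_id.const_mul_atTop hκ
    have h2 := (Real.tendsto_exp_neg_atTop_nhds_zero.comp h1).mul_const (C * Real.exp (l * R))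
    rw [zero_mul] at h2
    exact ((eventually_ge_atTop 1).and (h2.eventually (ge_mem_nhds hε))).exists
  refine ⟨M, by linarith, fun n hn h hR => ?_⟩
  calc _ ≤ gibbs θ h (A n) (fun σ => Real.exp (-(κ * M)) *
        Real.exp (κ * (n * |totalSpin σ / n - meanTanh μ θ x₁| ^ (2 * k)))) := by
        refine gibbs_mono fun σ _ => ?_
        rw [← abs_magScaled_pow hk, ← Real.exp_add]
        by_cases hσ : M < |magScaled k (meanTanh μ θ x₁) σ|
        · rw [Set.indicator, if_pos (by exact hσ), Pi.one_apply]
          apply Real.one_le_exp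
          have : |magScaled k (meanTanh μ θ x₁) σ| ≤ |magScaled k (meanTanh μ θ x₁) σ| ^ (2 * k) :=
            le_self_pow₀ (by linarith) (by omega)
          nlinarith
        · rw [Set.indicator, if_neg (by exact hσ)]
          exact (Real.exp_pos _).le
    _ ≤ Real.exp (-(κ * M)) * (C * Real.exp (l * R)) := by
        rw [gibbs_const_mul]
        gcongr
        refine ((ht n hn).1 h).trans ?_
        gcongr
    _ ≤ ε := hM

/-- Given the field, the rescaled magnetization concentrates, uniformly over fields with bounded
rescaled fluctuations. -/
lemma eventually_concentrated (P : Phase μ θ x₁ k A D D' ρ B r c ω) (hk : Odd k) (hk2 : 2 ≤ k)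
    (hb : 0 < b) (hloc : (fun x => H μ θ x - H μ θ x₁ - b * (x - x₁) ^ (k + 1)) =O[𝓝 x₁]
      fun x => (x - x₁) ^ (k + 2)) (R : ℝ) {δ ε : ℝ} (hδ : 0 < δ) (hε : 0 < ε) :
    ∀ᶠ n : ℕ in atTop, ∀ h : Fin n → ℝ, n * fluct μ θ x₁ B h ^ 2 ≤ R →
      gibbs θ h (A n) ({σ | δ < |magScaled k (meanTanh μ θ x₁) σ -
        critCenter μ θ x₁ b hk h|}.indicator 1) ≤ ε := by
  have hk1 := P.one_le_k
  have hθ := P.theta_pos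
  have hr := P.r_pos
  have hω := P.omega_pos
  have hsθ : 0 < √θ := by positivity
  obtain ⟨M, hM0, hM⟩ := P.gibbs_large_le R (half_pos hε)
  obtain ⟨a₀, ha₀, n₀, hpart⟩ := P.exists_partition_ge
  obtain ⟨V, hV⟩ : ∃ V, V = 1 + √R / ((k + 1) * b) := ⟨_, rfl⟩
  have hV0 : 0 < V := by rw [hV]; positivity
  obtain ⟨U, hU⟩ : ∃ U, U = √θ * M + V + 1 := ⟨_, rfl⟩
  have hU0 : 0 < U := by rw [hU]; positivity
  obtain ⟨δ₁, hδ₁⟩ : ∃ δ₁, δ₁ = √θ * δ / 2 := ⟨_, rfl⟩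
  have hδ₁0 : 0 < δ₁ := by rw [hδ₁]; positivity
  obtain ⟨γ, hγ⟩ : ∃ γ, γ = b * (2 * (δ₁ / 2) ^ (k + 1)) := ⟨_, rfl⟩
  have hγ0 : 0 < γ := by rw [hγ]; positivity
  obtain ⟨L, hL⟩ : ∃ L, L = b * ((k + 1) * U ^ k) + √R := ⟨_, rfl⟩
  have hL0 : 0 < L := by rw [hL]; positivity
  obtain ⟨δ₂, hδ₂⟩ : ∃ δ₂, δ₂ = min 1 (γ / (4 * L)) := ⟨_, rfl⟩
  have hδ₂0 : 0 < δ₂ := by rw [hδ₂]; positivity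
  have hδ₂1 : δ₂ ≤ 1 := hδ₂.trans_le (min_le_left _ _)
  have hLδ : L * δ₂ ≤ γ / 4 := by
    have : δ₂ ≤ γ / (4 * L) := hδ₂.trans_le (min_le_right _ _)
    rw [le_div_iff₀ (by positivity)] at this
    linarith
  have hs := tendsto_scale hk1
  have hlim : Tendsto (fun n => (windowMass ω)⁻¹ * (2 * U / δ₂) *
      Real.exp (-(γ / 2 * scale k n))) atTop (𝓝 0) := by
    have h1 : Tendsto (fun n => γ / 2 * scale k n) atTop atTop :=
      hs.const_mul_atTop (by positivity)
    simpa using (Real.tendsto_exp_neg_atTop_nhds_zero.comp h1).const_mul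
      ((windowMass ω)⁻¹ * (2 * U / δ₂))
  have hfl0 : Tendsto (fun n : ℕ => √R / √(n : ℝ)) atTop (𝓝 0) :=
    (Real.tendsto_sqrt_atTop.comp tendsto_natCast_atTop_atTop).const_div_atTop _
  filter_upwards [eventually_gt_atTop 0, eventually_ge_atTop n₀,
    P.eventually_empH_scaled hloc R hU0 (show 0 < γ / 8 by positivity),
    (hs.const_div_atTop 1).eventually (ge_mem_nhds (lt_min one_pos hδ₁0)),
    (hs.const_div_atTop U).eventually (ge_mem_nhds hr),
    hfl0.eventually (ge_mem_nhds ha₀), hlim.eventually (ge_mem_nhds (half_pos hε))]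
    with n hn hn0 happ hs1 hsr hfa hsmall h hR
  specialize happ h hR
  have hn' : (0 : ℝ) < n := by positivity
  obtain ⟨s, hsd⟩ : ∃ s, s = scale k n := ⟨_, rfl⟩
  have hs1' : 1 ≤ s := by rw [hsd]; exact one_le_scale k hn
  have hs0 : 0 < s := by linarith
  have hsk : s ^ k = √n := by rw [hsd, scale_pow_half hk1]
  have hsN : s ≤ s ^ (k - 1) := le_self_pow₀ hs1' (by omega)
  rw [← hsd] at happ hs1 hsr hsmall
  obtain ⟨w, hw⟩ : ∃ w, w = √n * devSlope μ θ h x₁ := ⟨_, rfl⟩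
  rw [← hw] at happ
  have hfl := sqrt_mul_fluct_le hR
  have hwR : |w| ≤ √R := by
    rw [hw, abs_mul, abs_of_nonneg (Real.sqrt_nonneg _)]
    exact (mul_le_mul_of_nonneg_left abs_devSlope_center_le (Real.sqrt_nonneg _)).trans hfl
  obtain ⟨v, hv⟩ : ∃ v, v = oddRoot hk (-w / ((k + 1) * b)) := ⟨_, rfl⟩
  have hvk : (k + 1) * b * v ^ k = -w := by
    rw [hv, oddRoot_pow]; field_simp
  have hvV : |v| ≤ V := by
    rw [hv, hV]
    refine (abs_oddRoot_le hk _).trans ?_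
    rw [abs_div, abs_neg, abs_of_pos (show (0 : ℝ) < (k + 1) * b by positivity)]
    gcongr
  have hcen : critCenter μ θ x₁ b hk h = v / √θ := by rw [critCenter, ← hw, ← hv]
  rw [hcen]
  have hfle : fluct μ θ x₁ B h ≤ a₀ := by
    refine le_trans ?_ hfa
    rw [le_div_iff₀ (by positivity), mul_comm]
    exact hfl
  have hZ := hpart n hn hn0 h hfle
  obtain ⟨N, hN⟩ : ∃ N, N = s ^ (k - 1) := ⟨_, rfl⟩
  rw [← hN] at happ hsN
  have hN0 : 0 < N := by linarith
  obtain ⟨F, hF⟩ : ∃ F, F = b * v ^ (k + 1) + w * v := ⟨_, rfl⟩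
  have hcont : Continuous fun y => Real.exp (-n * (empH θ h y - empH θ h x₁)) := by
    have := continuous_empH θ h
    fun_prop
  -- lower bound for the partition function
  have hlow : 2 * (δ₂ / s) * Real.exp (-(N * (F + γ / 4 + γ / 8))) ≤
      ∫ y in Metric.closedBall x₁ r, Real.exp (-n * (empH θ h y - empH θ h x₁)) := by
    have hballU : ∀ y ∈ Metric.closedBall (x₁ + v / s) (δ₂ / s),
        |s * (y - x₁) - v| ≤ δ₂ ∧ |s * (y - x₁)| ≤ U := by
      intro y hy
      rw [Metric.mem_closedBall, Real.dist_eq, le_div_iff₀ hs0] at hy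
      have h1 : |s * (y - x₁) - v| ≤ δ₂ := by
        refine le_trans (le_of_eq ?_) hy
        nth_rw 3 [← abs_of_pos hs0]
        rw [← abs_mul]
        congr 1
        field_simp
        ring
      refine ⟨h1, ?_⟩
      have h2 := abs_sub_abs_le_abs_sub (s * (y - x₁)) v
      have : 0 ≤ √θ * M := by positivity
      linarith
    have hsub : Metric.closedBall (x₁ + v / s) (δ₂ / s) ⊆ Metric.closedBall x₁ r := by
      intro y hy
      have h1 := (hballU y hy).2
      rw [Metric.mem_closedBall, Real.dist_eq]
      refine le_trans ?_ hsr
      rw [le_div_iff₀ hs0, mul_comm]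
      rwa [abs_mul, abs_of_pos hs0] at h1
    have hI := hcont.continuousOn.integrableOn_compact (μ := volume) (isCompact_closedBall x₁ r)
    calc _ = ∫ y in Metric.closedBall (x₁ + v / s) (δ₂ / s),
          Real.exp (-(N * (F + γ / 4 + γ / 8))) := by
          rw [setIntegral_const, Real.volume_real_closedBall (by positivity), smul_eq_mul]
      _ ≤ ∫ y in Metric.closedBall (x₁ + v / s) (δ₂ / s),
          Real.exp (-n * (empH θ h y - empH θ h x₁)) := by
          refine setIntegral_mono_on
            (integrableOn_const (isCompact_closedBall _ _).measure_lt_top.ne) (hI.mono_set hsub)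
            Metric.isClosed_closedBall.measurableSet fun y hy => ?_
          obtain ⟨h1, h2⟩ := hballU y hy
          have h3 := (abs_le.1 (happ y h2)).2
          have h4 := tilted_pow_sub_le (k := k) hb hwR h2 (hvV.trans (by
            have : 0 ≤ √θ * M := by positivity
            linarith)) h1
          rw [← hL, ← hF] at h4
          have h5 := mul_le_mul_of_nonneg_left (h4.trans (add_le_add_right hLδ F)) hN0.le
          rw [Real.exp_le_exp]
          linarith
      _ ≤ _ := setIntegral_mono_set hI (Eventually.of_forall fun y => (Real.exp_pos _).le)
          (Eventually.of_forall hsub)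
  -- upper bound for the mass away from the centre
  obtain ⟨E, hE⟩ : ∃ E : Set ℝ, E = {y | |s * (y - x₁)| ≤ U ∧ δ₁ ≤ |s * (y - x₁) - v|} := ⟨_, rfl⟩
  have hEm : MeasurableSet E := by
    rw [hE]
    have h1 : IsClosed {y : ℝ | |s * (y - x₁)| ≤ U} := isClosed_le (by fun_prop) (by fun_prop)
    have h2 : IsClosed {y : ℝ | δ₁ ≤ |s * (y - x₁) - v|} := isClosed_le (by fun_prop) (by fun_prop)
    exact (h1.inter h2).measurableSet
  have hEb : E ⊆ Metric.closedBall x₁ (U / s) := by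
    rw [hE]
    intro y hy
    rw [Metric.mem_closedBall, Real.dist_eq, le_div_iff₀ hs0, mul_comm]
    have := hy.1
    rwa [abs_mul, abs_of_pos hs0] at this
  have hup : ∫ y in E, Real.exp (-n * (empH θ h y - empH θ h x₁)) ≤
      2 * (U / s) * Real.exp (-(N * (F + γ - γ / 8))) := by
    have hIc : IntegrableOn (fun _ : ℝ => Real.exp (-(N * (F + γ - γ / 8))))
        (Metric.closedBall x₁ (U / s)) :=
      integrableOn_const (isCompact_closedBall _ _).measure_lt_top.ne
    calc _ ≤ ∫ y in E, Real.exp (-(N * (F + γ - γ / 8))) := by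
          refine setIntegral_mono_on ((hcont.continuousOn.integrableOn_compact
            (isCompact_closedBall x₁ (U / s))).mono_set hEb) (hIc.mono_set hEb) hEm fun y hy => ?_
          rw [hE] at hy
          have h3 := (abs_le.1 (happ y hy.1)).1
          have h4 := tilted_pow_sub_ge hk hb hvk hδ₁0.le hy.2
          rw [← hγ, ← hF] at h4
          have h5 := mul_le_mul_of_nonneg_left h4 hN0.le
          rw [Real.exp_le_exp]
          linarith
      _ ≤ ∫ y in Metric.closedBall x₁ (U / s), Real.exp (-(N * (F + γ - γ / 8))) :=
          setIntegral_mono_set hIc (Eventually.of_forall fun y => (Real.exp_pos _).le)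
            (Eventually.of_forall hEb)
      _ = _ := by
          rw [setIntegral_const, Real.volume_real_closedBall (by positivity), smul_eq_mul]
  obtain ⟨X, hX⟩ : ∃ X : Config n → ℝ, X = magScaled k (meanTanh μ θ x₁) := ⟨_, rfl⟩
  have hwin : ∀ σ ∈ A n, ∀ y, |y - √θ * totalSpin σ / n| ≤ ω / √n →
      {σ | |X σ| ≤ M ∧ δ < |X σ - v / √θ|}.indicator (1 : Config n → ℝ) σ ≤
        E.indicator (1 : ℝ → ℝ) y := by
    intro σ _ y hy
    by_cases hσ : |X σ| ≤ M ∧ δ < |X σ - v / √θ|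
    swap
    · rw [Set.indicator, if_neg (by exact hσ)]
      exact Set.indicator_nonneg (fun _ _ => zero_le_one) _
    have h1 := P.window_dist hy
    have h2 : |s * (y - x₁) - √θ * X σ| ≤ 1 / s := by
      have e : s * (y - x₁) - √θ * X σ =
          s * ((y - x₁) - √θ * (totalSpin σ / n - meanTanh μ θ x₁)) := by
        rw [hX, magScaled, ← hsd]; ring
      rw [e, abs_mul, abs_of_pos hs0]
      calc _ ≤ s * (1 / √n) := by
            gcongr
            exact h1.trans (by gcongr; exact P.omega_le)
        _ ≤ 1 / s := by
            rw [← hsk, mul_one_div, div_le_div_iff₀ (by positivity) hs0, one_mul, ← sq]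
            exact pow_le_pow_right₀ hs1' hk2
    have h3 : 1 / s ≤ 1 := hs1.trans (min_le_left _ _)
    have h4 : 1 / s ≤ δ₁ := hs1.trans (min_le_right _ _)
    have hyE : y ∈ E := by
      rw [hE]
      constructor
      · have h5 := abs_sub_abs_le_abs_sub (s * (y - x₁)) (√θ * X σ)
        have h6 : |√θ * X σ| ≤ √θ * M := by
          rw [abs_mul, abs_of_pos hsθ]; gcongr; exact hσ.1
        linarith
      · have h5 : √θ * δ < |√θ * X σ - v| := by
          have e : √θ * X σ - v = √θ * (X σ - v / √θ) := by field_simp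
          rw [e, abs_mul, abs_of_pos hsθ]
          exact mul_lt_mul_of_pos_left hσ.2 hsθ
        have h6 := abs_sub_le (√θ * X σ) (s * (y - x₁)) v
        rw [abs_sub_comm (√θ * X σ) (s * (y - x₁))] at h6
        linarith
    rw [Set.indicator, if_pos (by exact hσ), Set.indicator_of_mem hyE]
    simp
  have hnum := sum_weight_le_window hθ hn h x₁ hω (A := A n)
    (φ := {σ | |X σ| ≤ M ∧ δ < |X σ - v / √θ|}.indicator 1) (Φ := E.indicator 1)
    (fun σ => Set.indicator_nonneg (fun _ _ => zero_le_one) _)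
    (fun y => Set.indicator_nonneg (fun _ _ => zero_le_one) _)
    (fun σ => by
      refine ((integrable_joint hθ hn h σ).indicator hEm).congr (Eventually.of_forall fun y => ?_)
      simp only [Set.indicator]
      split_ifs <;> simp) hwin
  have hΦ : ∫ y, E.indicator (1 : ℝ → ℝ) y * Real.exp (-n * (empH θ h y - empH θ h x₁)) =
      ∫ y in E, Real.exp (-n * (empH θ h y - empH θ h x₁)) := by
    rw [← integral_indicator hEm]
    congr 1
    ext y
    simp only [Set.indicator]
    split_ifs <;> simp
  rw [hΦ] at hnum
  have hN1 := normConst_pos hn θ h x₁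
  have hW := windowMass_pos hω
  have hZ0 : 0 < ∑ σ ∈ A n, weight θ h σ :=
    Finset.sum_pos (fun σ _ => weight_pos θ h σ) (P.nonempty n hn)
  have hmid : gibbs θ h (A n) ({σ | |X σ| ≤ M ∧ δ < |X σ - v / √θ|}.indicator 1) ≤ ε / 2 := by
    rw [gibbs, div_le_iff₀ hZ0]
    refine hnum.trans ?_
    have hkey : (windowMass ω)⁻¹ * (2 * (U / s) * Real.exp (-(N * (F + γ - γ / 8)))) ≤
        ε / 2 * (1 / 2 * (2 * (δ₂ / s) * Real.exp (-(N * (F + γ / 4 + γ / 8))))) := by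
      have e : Real.exp (-(N * (F + γ - γ / 8))) =
          Real.exp (-(γ / 2 * N)) * Real.exp (-(N * (F + γ / 4 + γ / 8))) := by
        rw [← Real.exp_add]; congr 1; ring
      have h1 : Real.exp (-(γ / 2 * N)) ≤ Real.exp (-(γ / 2 * s)) := by gcongr
      rw [e]
      calc _ ≤ (windowMass ω)⁻¹ * (2 * (U / s) * (Real.exp (-(γ / 2 * s)) *
            Real.exp (-(N * (F + γ / 4 + γ / 8))))) := by gcongr
        _ = ((windowMass ω)⁻¹ * (2 * U / δ₂) * Real.exp (-(γ / 2 * s))) *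
            (1 / 2 * (2 * (δ₂ / s) * Real.exp (-(N * (F + γ / 4 + γ / 8))))) := by
            field_simp
        _ ≤ _ := by gcongr
    calc _ ≤ (windowMass ω)⁻¹ * (normConst θ h x₁ *
          (2 * (U / s) * Real.exp (-(N * (F + γ - γ / 8))))) := by gcongr
      _ = normConst θ h x₁ *
          ((windowMass ω)⁻¹ * (2 * (U / s) * Real.exp (-(N * (F + γ - γ / 8))))) := by ring
      _ ≤ normConst θ h x₁ *
          (ε / 2 * (1 / 2 * (2 * (δ₂ / s) * Real.exp (-(N * (F + γ / 4 + γ / 8)))))) := by gcongr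
      _ ≤ normConst θ h x₁ * (ε / 2 * (1 / 2 * ∫ y in Metric.closedBall x₁ r,
          Real.exp (-n * (empH θ h y - empH θ h x₁)))) := by gcongr
      _ = ε / 2 * (normConst θ h x₁ * (1 / 2 * ∫ y in Metric.closedBall x₁ r,
          Real.exp (-n * (empH θ h y - empH θ h x₁)))) := by ring
      _ ≤ _ := by gcongr
  have htail := hM n hn h hR
  rw [← hX] at htail ⊢
  calc _ ≤ gibbs θ h (A n) (fun σ => {σ | M < |X σ|}.indicator (1 : Config n → ℝ) σ +
        {σ | |X σ| ≤ M ∧ δ < |X σ - v / √θ|}.indicator (1 : Config n → ℝ) σ) := by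
        refine gibbs_mono fun σ _ => ?_
        simp only [Set.indicator, Set.mem_ofPred_eq, Pi.one_apply]
        by_cases h1 : M < |X σ|
        · rw [if_pos h1]; split_ifs <;> norm_num
        · rw [if_neg h1]; split_ifs with h2 h3 <;> norm_num
          exact h3 ⟨not_lt.1 h1, h2⟩
    _ ≤ ε / 2 + ε / 2 := by rw [gibbs_add]; exact add_le_add htail hmid
    _ = ε := by ring

end Phase

end Concentration

/-! ### The limit law at criticality -/

section LimitLaw

open ProbabilityTheory

/-- Central limit theorem for bounded i.i.d. variables, on the finite product spaces. -/
lemma tendsto_integral_normalized_sum {μ : Measure ℝ} [IsProbabilityMeasure μ] {ξ : ℝ → ℝ}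
    (hξ : Continuous ξ) (h0 : ∫ x, ξ x ∂μ = 0) {v : ℝ} (hv : ∫ x, ξ x ^ 2 ∂μ = v) (hv0 : 0 < v)
    (g : BoundedContinuousFunction ℝ ℝ) :
    Tendsto (fun n : ℕ => ∫ h, g ((√n)⁻¹ * ∑ i, ξ (h i)) ∂(Measure.pi fun _ : Fin n => μ)) atTop
      (𝓝 (∫ x, g x ∂(gaussianReal 0 v.toNNReal))) := by
  have hmeas : ∀ n : ℕ, Measurable fun h : Fin n → ℝ => (√n)⁻¹ * ∑ i, ξ (h i) := fun n =>
    Continuous.measurable (by fun_prop)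
  have hP : ∀ n : ℕ, IsProbabilityMeasure
      ((Measure.pi fun _ : Fin n => μ).map fun h => (√n)⁻¹ * ∑ i, ξ (h i)) := fun n =>
    Measure.isProbabilityMeasure_map (hmeas n).aemeasurable
  have hchar : ∀ (n : ℕ) (t : ℝ),
      charFun ((Measure.pi fun _ : Fin n => μ).map fun h => (√n)⁻¹ * ∑ i, ξ (h i)) t =
        (charFun (μ.map fun x => (√v)⁻¹ * ξ x) ((√n)⁻¹ * (√v * t))) ^ n := by
    intro n t
    have hind : iIndepFun (fun (i : Fin n) (h : Fin n → ℝ) => ξ (h i))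
        (Measure.pi fun _ : Fin n => μ) := iIndepFun_pi fun i => hξ.measurable.aemeasurable
    have hmap : ∀ i : Fin n, (Measure.pi fun _ : Fin n => μ).map (fun h => ξ (h i)) = μ.map ξ := by
      intro i
      have h1 := (measurePreserving_eval (fun _ : Fin n => μ) i).map_eq
      have h2 := Measure.map_map (μ := Measure.pi fun _ : Fin n => μ) hξ.measurable
        (measurable_pi_apply i)
      rw [show (fun h : Fin n → ℝ => h i) = Function.eval i from rfl, h1] at h2
      exact h2.symm
    have hmi : ∀ i : Fin n, AEMeasurable (fun h : Fin n → ℝ => ξ (h i))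
        (Measure.pi fun _ : Fin n => μ) := fun i =>
      (hξ.measurable.comp (measurable_pi_apply i)).aemeasurable
    have hm2 : Measurable fun h : Fin n → ℝ => ∑ i, ξ (h i) := Continuous.measurable (by fun_prop)
    rw [charFun_map_mul_comp hm2.aemeasurable,
      hind.charFun_map_fun_sum_eq_prod hmi,
      Finset.prod_apply, charFun_map_mul_comp hξ.measurable.aemeasurable]
    simp only [hmap, Finset.prod_const, Finset.card_univ, Fintype.card_fin]
    have : 0 < √v := by positivity
    congr 2
    field_simp
  have hlim : Tendsto (β := ProbabilityMeasure ℝ)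
      (fun n : ℕ => ⟨(Measure.pi fun _ : Fin n => μ).map fun h => (√n)⁻¹ * ∑ i, ξ (h i), hP n⟩) atTop
      (𝓝 (⟨gaussianReal 0 v.toNNReal, inferInstance⟩ : ProbabilityMeasure ℝ)) := by
    refine ProbabilityMeasure.tendsto_iff_tendsto_charFun.2 fun t => ?_
    simp only [ProbabilityMeasure.coe_mk, hchar, charFun_gaussianReal]
    have hsv : √v ^ 2 = v := Real.sq_sqrt hv0.le
    have h1 : ∫ x, (√v)⁻¹ * ξ x ∂μ = 0 := by rw [integral_const_mul, h0, mul_zero]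
    have h2 : ∫ x, ((fun x => (√v)⁻¹ * ξ x) ^ 2) x ∂μ = 1 := by
      simp only [Pi.pow_apply, mul_pow]
      rw [integral_const_mul, hv, inv_pow, hsv, inv_mul_cancel₀ hv0.ne']
    have := tendsto_charFun_inv_sqrt_mul_pow (P := μ) (X := fun x => (√v)⁻¹ * ξ x)
      (hξ.measurable.const_mul _).aemeasurable h1 h2 (√v * t)
    convert this using 2
    rw [Real.coe_toNNReal _ hv0.le]
    push_cast
    rw [mul_pow, ← Complex.ofReal_pow √v, hsv]
    congr 1
    ring
  have := (ProbabilityMeasure.tendsto_iff_forall_integral_tendsto.1 hlim) g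
  simp only [ProbabilityMeasure.coe_mk] at this
  refine this.congr fun n => ?_
  exact integral_map (hmeas n).aemeasurable g.continuous.aestronglyMeasurable

variable {k : ℕ} (hk : Odd k)

lemma integral_oddRoot_gaussianReal (f : ℝ → ℝ) {v : ℝ} (hv : 0 < v) :
    ∫ y, f (oddRoot hk y) ∂(gaussianReal 0 v.toNNReal) =
      ∫ x, f x * (k * x ^ (k - 1) / √(2 * Real.pi * v) * Real.exp (-x ^ (2 * k) / (2 * v))) := by
  rw [integral_gaussianReal_eq_integral_smul (by simpa using hv)]
  have h := integral_image_eq_integral_abs_deriv_smul (s := Set.univ) MeasurableSet.univ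
    (fun x _ => (hasDerivAt_pow k x).hasDerivWithinAt) hk.strictMono_pow.injective.injOn
    (fun y => gaussianPDFReal 0 v.toNNReal y • f (oddRoot hk y))
  rw [Set.image_univ, (surjective_odd_pow hk).range_eq, setIntegral_univ, setIntegral_univ] at h
  rw [h]
  congr 1
  ext x
  have hev : Even (k - 1) := Nat.Odd.sub_odd hk odd_one
  rw [oddRoot_of_pow, gaussianPDFReal, Real.coe_toNNReal _ hv.le, sub_zero,
    abs_of_nonneg (mul_nonneg (by positivity) (hev.pow_nonneg x)), ← pow_mul, mul_comm k 2]
  simp only [smul_eq_mul]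
  ring

lemma integrable_exp_oddRoot (t : ℝ) (v : NNReal) :
    Integrable (fun y => Real.exp (t * oddRoot hk y)) (gaussianReal 0 v) := by
  have h1 := ((integrable_exp_mul_gaussianReal (μ := 0) (v := v) |t|).add
    (integrable_exp_mul_gaussianReal (μ := 0) (v := v) (-|t|))).const_mul (Real.exp |t|)
  have hc := continuous_oddRoot hk
  have hc' : Continuous fun y => Real.exp (t * oddRoot hk y) := by fun_prop
  refine h1.mono' hc'.aestronglyMeasurable (Eventually.of_forall fun y => ?_)
  rw [Real.norm_eq_abs, Real.abs_exp]
  have h2 : t * oddRoot hk y ≤ |t| + |t| * |y| := by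
    refine (le_abs_self _).trans ?_
    rw [abs_mul]
    nlinarith [abs_oddRoot_le hk y, abs_nonneg t]
  calc Real.exp (t * oddRoot hk y) ≤ Real.exp |t| * Real.exp (|t| * |y|) := by
        rw [← Real.exp_add]; gcongr
    _ ≤ _ := by
        simp only [Pi.add_apply]
        gcongr
        rcases abs_cases y with ⟨h, _⟩ | ⟨h, _⟩
        · rw [h]; exact le_add_of_nonneg_right (Real.exp_pos _).le
        · rw [h, mul_neg, ← neg_mul]; exact le_add_of_nonneg_left (Real.exp_pos _).le

lemma integral_odd_oddRoot {f : ℝ → ℝ} (hf : ∀ x, f (-x) = -f x) (v : NNReal) :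
    ∫ y, f (oddRoot hk y) ∂(gaussianReal 0 v) = 0 := by
  have h1 : ∫ y, f (oddRoot hk y) ∂(gaussianReal 0 v) =
      ∫ y, f (oddRoot hk (-y)) ∂(gaussianReal 0 v) := by
    have h2 := gaussianReal_map_neg (μ := 0) (v := v)
    rw [neg_zero] at h2
    have h3 := integral_map_equiv (μ := gaussianReal 0 v) (MeasurableEquiv.neg ℝ)
      (fun y => f (oddRoot hk y))
    rw [show (⇑(MeasurableEquiv.neg ℝ)) = fun x : ℝ => -x from rfl, h2] at h3
    exact h3
  simp_rw [oddRoot_neg, hf] at h1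
  rw [integral_neg] at h1
  linarith

/-- Convergence of expectations follows from convergence of truncated expectations. -/
lemma tendsto_of_truncation {a : ℕ → ℝ} {a' : ℝ → ℕ → ℝ} {l C : ℝ} {l' : ℝ → ℝ}
    (h1 : ∀ M, 0 < M → Tendsto (a' M) atTop (𝓝 (l' M)))
    (h2 : ∀ M, 0 < M → ∀ n, 0 < n → |a n - a' M n| ≤ C / M)
    (h3 : ∀ M, 0 < M → |l - l' M| ≤ C / M) : Tendsto a atTop (𝓝 l) := by
  rw [Metric.tendsto_nhds]
  intro ε hε
  have hM : Tendsto (fun M : ℝ => C / M) atTop (𝓝 0) := tendsto_id.const_div_atTop C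
  obtain ⟨M, hM0, hMε⟩ := ((eventually_gt_atTop 0).and
    (hM.eventually (gt_mem_nhds (show 0 < ε / 3 by positivity)))).exists
  filter_upwards [eventually_gt_atTop 0, Metric.tendsto_nhds.1 (h1 M hM0) (ε / 3) (by positivity)]
    with n hn hd
  have h4 := h2 M hM0 n hn
  have h5 := h3 M hM0
  rw [Real.dist_eq] at hd ⊢
  rw [abs_le] at h4 h5
  rw [abs_lt] at hd ⊢
  constructor <;> linarith [h4.1, h4.2, h5.1, h5.2, hd.1, hd.2]

end LimitLaw

section CriticalExpectation

open ProbabilityTheory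

variable {μ : Measure ℝ} {θ x₁ ρ B r c ω b : ℝ} {k : ℕ}
  {A : ∀ n : ℕ, Finset (Config n)} {D D' : Set ℝ} [IsProbabilityMeasure μ]

lemma critCenter_eq (hk : Odd k) {n : ℕ} (hn : 0 < n) (hθ : 0 < θ) (hb : 0 < b) (h : Fin n → ℝ) :
    critCenter μ θ x₁ b hk h = oddRoot hk (√θ / ((k + 1) * b * √θ ^ k) *
      ((√n)⁻¹ * ∑ i, (Real.tanh (√θ * x₁ + h i) - meanTanh μ θ x₁))) := by
  have hsθ : 0 < √θ := by positivity
  have hn' : (0 : ℝ) < √(n : ℝ) := by positivity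
  rw [critCenter, eq_comm]
  apply oddRoot_eq_of_pow_eq
  rw [div_pow, oddRoot_pow, sqrt_mul_devSlope_eq hn]
  field_simp

lemma continuous_critCenter (hk : Odd k) (n : ℕ) :
    Continuous fun h : Fin n → ℝ => critCenter μ θ x₁ b hk h := by
  have h1 := continuous_devSlope_left (n := n) (μ := μ) (θ := θ) x₁
  have h2 := continuous_oddRoot hk
  unfold critCenter
  fun_prop

lemma integral_sq_tanh_sub_mean (x : ℝ) :
    ∫ h, (Real.tanh (√θ * x + h) - meanTanh μ θ x) ^ 2 ∂μ =
      variance (fun h => Real.tanh (√θ * x + h)) μ := by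
  have hc : Continuous fun h => Real.tanh (√θ * x + h) := continuous_tanh.comp (by fun_prop)
  rw [variance_eq_integral hc.measurable.aemeasurable]
  rfl

namespace Phase

/-- **Non-Gaussian limit.** At a degenerate minimum the rescaled magnetization converges in
distribution to an odd root of a Gaussian variable. -/
theorem tendsto_expect_critical (P : Phase μ θ x₁ k A D D' ρ B r c ω) (hk : Odd k) (hk2 : 2 ≤ k)
    (hb : 0 < b) (hloc : (fun x => H μ θ x - H μ θ x₁ - b * (x - x₁) ^ (k + 1)) =O[𝓝 x₁]
      fun x => (x - x₁) ^ (k + 2)) {v : ℝ}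
    (hvar : 0 < variance (fun h => Real.tanh (√θ * x₁ + h)) μ)
    (hv : v = (√θ / ((k + 1) * b * √θ ^ k)) ^ 2 *
      variance (fun h => Real.tanh (√θ * x₁ + h)) μ)
    {β : ℕ → ℝ} (hβ : Tendsto β atTop (𝓝 0)) (f : BoundedContinuousFunction ℝ ℝ) :
    Tendsto (fun n : ℕ => expect μ θ (A n) fun σ => f (magScaled k (meanTanh μ θ x₁) σ - β n))
      atTop (𝓝 (∫ y, f (oddRoot hk y) ∂(gaussianReal 0 v.toNNReal))) := by
  have hθ := P.theta_pos
  have hsθ : 0 < √θ := by positivity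
  obtain ⟨κ, l, C, C', hκ, hl, hC, hC', ht⟩ := P.exists_tight
  have hbound : ∀ (n : ℕ) (h : Fin n → ℝ) {x : ℝ}, |x| ≤ ‖f‖ →
      |x| ≤ ‖f‖ * Real.exp (l * (n * fluct μ θ x₁ B h ^ 2)) := fun n h x hx =>
    hx.trans (le_mul_of_one_le_right (norm_nonneg _) (Real.one_le_exp (by positivity)))
  have hdiff := tendsto_integral_sub_of_uniform (Q := fun n => Measure.pi fun _ : Fin n => μ)
    (F := fun n h => gibbs θ h (A n) (fun σ => f (magScaled k (meanTanh μ θ x₁) σ - β n)))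
    (G := fun n h => f (critCenter μ θ x₁ b hk h))
    (X := fun n h => n * fluct μ θ x₁ B h ^ 2) (κ := l) (C := ‖f‖) (C' := C') hl
    (fun n hn => integrable_gibbs μ (P.nonempty n hn))
    (fun n hn => integrable_of_continuous_bounded (C := ‖f‖)
      (f.continuous.comp (continuous_critCenter hk n)) fun h => f.norm_coe_le_norm _)
    (fun n hn => integrable_exp_fluct hθ x₁ P.B_pos _) (fun n hn => (ht n hn).2)
    (fun n hn h => hbound n h (abs_gibbs_le.trans
      (gibbs_le_of_le (P.nonempty n hn) fun σ _ => f.norm_coe_le_norm _)))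
    (fun n hn h => hbound n h (f.norm_coe_le_norm _))
    (fun R ε hε => by
      obtain ⟨Ψ, hΨ⟩ : ∃ Ψ, Ψ = (1 + √R / ((k + 1) * b)) / √θ := ⟨_, rfl⟩
      have hΨ0 : 0 ≤ Ψ := by rw [hΨ]; positivity
      have huc := (isCompact_closedBall (0 : ℝ) (Ψ + 1)).uniformContinuousOn_of_continuous
        f.continuous.continuousOn
      rw [Metric.uniformContinuousOn_iff] at huc
      obtain ⟨d, hd0, hd⟩ := huc (ε / 2) (half_pos hε)
      obtain ⟨δ, hδ⟩ : ∃ δ, δ = min (1 / 2) (d / 3) := ⟨_, rfl⟩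
      have hδ0 : 0 < δ := by rw [hδ]; positivity
      have hδ1 : δ ≤ 1 / 2 := hδ.trans_le (min_le_left _ _)
      have hδd : δ ≤ d / 3 := hδ.trans_le (min_le_right _ _)
      have hβ' : Tendsto (fun n => |β n|) atTop (𝓝 0) := by simpa using hβ.abs
      filter_upwards [eventually_gt_atTop 0, hβ'.eventually (ge_mem_nhds hδ0),
        P.eventually_concentrated hk hk2 hb hloc R hδ0
          (show 0 < ε / (4 * (‖f‖ + 1)) by positivity)] with n hn hβn hcon h hR
      specialize hcon h hR
      obtain ⟨ψ, hψ⟩ : ∃ ψ, ψ = critCenter μ θ x₁ b hk h := ⟨_, rfl⟩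
      rw [← hψ] at hcon ⊢
      have hψΨ : |ψ| ≤ Ψ := by
        rw [hψ, hΨ, critCenter, abs_div, abs_of_pos hsθ]
        gcongr
        refine (abs_oddRoot_le hk _).trans ?_
        rw [abs_div, abs_neg, abs_of_pos (show (0 : ℝ) < (k + 1) * b by positivity), abs_mul,
          abs_of_nonneg (Real.sqrt_nonneg _)]
        gcongr
        exact (mul_le_mul_of_nonneg_left abs_devSlope_center_le (Real.sqrt_nonneg _)).trans
          (sqrt_mul_fluct_le hR)
      rw [← gibbs_const (θ := θ) (h := h) (P.nonempty n hn) (f ψ), ← gibbs_sub]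
      refine abs_gibbs_le.trans ?_
      have hf2 : ∀ x y, |f x - f y| ≤ 2 * ‖f‖ := fun x y => f.dist_le_two_norm x y
      calc _ ≤ gibbs θ h (A n) (fun σ => ε / 2 + 2 * ‖f‖ *
            {σ | δ < |magScaled k (meanTanh μ θ x₁) σ - ψ|}.indicator (1 : Config n → ℝ) σ) := by
            refine gibbs_mono fun σ _ => ?_
            by_cases hσ : δ < |magScaled k (meanTanh μ θ x₁) σ - ψ|
            · rw [Set.indicator, if_pos (by exact hσ), Pi.one_apply, mul_one]
              linarith [hf2 (magScaled k (meanTanh μ θ x₁) σ - β n) ψ]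
            · rw [Set.indicator, if_neg (by exact hσ), mul_zero, add_zero]
              have h1 : |magScaled k (meanTanh μ θ x₁) σ - β n - ψ| ≤ 2 * δ := by
                have := abs_sub (magScaled k (meanTanh μ θ x₁) σ - ψ) (β n)
                rw [show magScaled k (meanTanh μ θ x₁) σ - ψ - β n =
                  magScaled k (meanTanh μ θ x₁) σ - β n - ψ by ring] at this
                linarith [not_lt.1 hσ]
              have h2 := abs_sub_abs_le_abs_sub (magScaled k (meanTanh μ θ x₁) σ - β n) ψ
              refine (hd _ ?_ ψ ?_ ?_).le
              · rw [mem_closedBall_zero_iff, Real.norm_eq_abs]; linarith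
              · rw [mem_closedBall_zero_iff, Real.norm_eq_abs]; linarith
              · rw [Real.dist_eq]; linarith
        _ ≤ ε / 2 + 2 * ‖f‖ * (ε / (4 * (‖f‖ + 1))) := by
            rw [gibbs_add, gibbs_const (P.nonempty n hn), gibbs_const_mul]
            have := norm_nonneg f
            gcongr
        _ ≤ ε := by
            have := norm_nonneg f
            have h1 : 2 * ‖f‖ * (ε / (4 * (‖f‖ + 1))) = ε / 2 * (‖f‖ / (‖f‖ + 1)) := by
              field_simp; ring
            have h2 : ‖f‖ / (‖f‖ + 1) ≤ 1 := by rw [div_le_one (by positivity)]; linarith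
            rw [h1]
            nlinarith)
  obtain ⟨q, hq⟩ : ∃ q, q = √θ / ((k + 1) * b * √θ ^ k) := ⟨_, rfl⟩
  have hG : Tendsto (fun n : ℕ => ∫ h, f (critCenter μ θ x₁ b hk h)
      ∂(Measure.pi fun _ : Fin n => μ)) atTop
      (𝓝 (∫ y, f (oddRoot hk y) ∂(gaussianReal 0 v.toNNReal))) := by
    have hroot := continuous_oddRoot hk
    have hgc : Continuous fun x => oddRoot hk (q * x) := by fun_prop
    have h1 := tendsto_integral_normalized_sum (μ := μ)
      (ξ := fun x => Real.tanh (√θ * x₁ + x) - meanTanh μ θ x₁)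
      ((continuous_tanh.comp (by fun_prop)).sub continuous_const)
      (integral_tanh_sub_mean x₁) (integral_sq_tanh_sub_mean x₁) hvar
      (f.compContinuous ⟨_, hgc⟩)
    have h2 : ∫ x, f (oddRoot hk (q * x)) ∂(gaussianReal 0
        (variance (fun h => Real.tanh (√θ * x₁ + h)) μ).toNNReal) =
        ∫ y, f (oddRoot hk y) ∂(gaussianReal 0 v.toNNReal) := by
      have h3 := gaussianReal_map_const_mul (μ := 0)
        (v := (variance (fun h => Real.tanh (√θ * x₁ + h)) μ).toNNReal) q
      have h4 : (.mk (q ^ 2) (sq_nonneg _) : NNReal) *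
          (variance (fun h => Real.tanh (√θ * x₁ + h)) μ).toNNReal = v.toNNReal := by
        rw [hv, ← hq, Real.toNNReal_mul (sq_nonneg _), Real.toNNReal_of_nonneg (sq_nonneg q)]
      rw [mul_zero, h4] at h3
      have hfr : Continuous fun y => f (oddRoot hk y) := f.continuous.comp hroot
      rw [← h3, integral_map (by fun_prop) hfr.aestronglyMeasurable]
    simp only [BoundedContinuousFunction.compContinuous_apply, ContinuousMap.coe_mk] at h1
    rw [h2] at h1
    refine h1.congr' ?_
    filter_upwards [eventually_gt_atTop 0] with n hn
    simp_rw [critCenter_eq hk hn hθ hb, hq]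
  have := hdiff.add hG
  simpa [expect] using this

/-- All exponential moments of the rescaled magnetization are bounded. -/
lemma exists_expect_exp_abs_le (P : Phase μ θ x₁ k A D D' ρ B r c ω) (t : ℝ) :
    ∃ C : ℝ, ∀ n : ℕ, 0 < n →
      expect μ θ (A n) (fun σ => Real.exp (t * |magScaled k (meanTanh μ θ x₁) σ|)) ≤ C := by
  have hk1 := P.one_le_k
  obtain ⟨κ, C, hκ, hC⟩ := P.exists_expect_exp_le
  refine ⟨Real.exp (t ^ 2 / (4 * κ) + κ) * C, fun n hn => ?_⟩
  calc _ ≤ expect μ θ (A n) (fun σ => Real.exp (t ^ 2 / (4 * κ) + κ) *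
        Real.exp (κ * (n * |totalSpin σ / n - meanTanh μ θ x₁| ^ (2 * k)))) := by
        refine expect_mono (P.nonempty n hn) fun σ _ => ?_
        rw [← abs_magScaled_pow hk1, ← Real.exp_add, Real.exp_le_exp]
        obtain ⟨x, hx⟩ : ∃ x, x = |magScaled k (meanTanh μ θ x₁) σ| := ⟨_, rfl⟩
        have hx0 : 0 ≤ x := by rw [hx]; exact abs_nonneg _
        rw [← hx]
        have h1 : x ^ 2 ≤ 1 + x ^ (2 * k) := by
          rcases le_total x 1 with h | h
          · have : 0 ≤ x ^ (2 * k) := by positivity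
            nlinarith
          · have : x ^ 2 ≤ x ^ (2 * k) := pow_le_pow_right₀ h (by omega)
            linarith
        have h2 : 0 ≤ (2 * κ * x - t) ^ 2 / (4 * κ) := by positivity
        have h3 : (2 * κ * x - t) ^ 2 / (4 * κ) = κ * x ^ 2 - t * x + t ^ 2 / (4 * κ) := by
          field_simp; ring
        nlinarith
    _ ≤ _ := by
        rw [expect_const_mul]
        gcongr
        exact hC n hn

lemma tendsto_expect_magScaled (P : Phase μ θ x₁ k A D D' ρ B r c ω) (hk : Odd k) (hk2 : 2 ≤ k)
    (hb : 0 < b) (hloc : (fun x => H μ θ x - H μ θ x₁ - b * (x - x₁) ^ (k + 1)) =O[𝓝 x₁]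
      fun x => (x - x₁) ^ (k + 2))
    (hvar : 0 < variance (fun h => Real.tanh (√θ * x₁ + h)) μ) :
    Tendsto (fun n : ℕ => expect μ θ (A n) (magScaled k (meanTanh μ θ x₁))) atTop (𝓝 0) := by
  obtain ⟨C, hC⟩ := P.exists_expect_exp_abs_le 1
  have hC0 : 0 ≤ C := by
    refine le_trans ?_ (hC 1 one_pos)
    exact integral_nonneg fun h => gibbs_nonneg fun σ _ => (Real.exp_pos _).le
  obtain ⟨v, hv⟩ : ∃ v, v = (√θ / ((k + 1) * b * √θ ^ k)) ^ 2 *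
      variance (fun h => Real.tanh (√θ * x₁ + h)) μ := ⟨_, rfl⟩
  refine tendsto_of_truncation (C := 2 * C) (l' := fun _ => 0)
    (a' := fun M n => expect μ θ (A n) fun σ =>
      max (-M) (min (magScaled k (meanTanh μ θ x₁) σ) M)) (fun M hM => ?_) (fun M hM n hn => ?_)
    (fun M hM => by simp; positivity)
  · have hcl : ∀ x : ℝ, |max (-M) (min x M)| ≤ M := fun x =>
      abs_le.2 ⟨le_max_left _ _, max_le (by linarith) (min_le_right _ _)⟩
    have := P.tendsto_expect_critical hk hk2 hb hloc hvar hv tendsto_const_nhds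
      (BoundedContinuousFunction.ofNormedAddCommGroup (fun x : ℝ => max (-M) (min x M))
        (by fun_prop) M hcl)
    simp only [BoundedContinuousFunction.coe_ofNormedAddCommGroup, sub_zero] at this
    rwa [integral_odd_oddRoot hk (f := fun x => max (-M) (min x M))] at this
    intro x
    rcases le_total x M with h1 | h1 <;> rcases le_total (-M) x with h2 | h2 <;>
      simp [max_def, min_def] <;> split_ifs <;> linarith
  · have hA := P.nonempty n hn
    rw [← expect_sub hA]
    refine (abs_expect_le hA).trans ?_
    calc _ ≤ expect μ θ (A n) (fun σ => 2 / M *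
          Real.exp (1 * |magScaled k (meanTanh μ θ x₁) σ|)) := by
          refine expect_mono hA fun σ _ => ?_
          generalize magScaled k (meanTanh μ θ x₁) σ = x
          have h1 := Real.quadratic_le_exp_of_nonneg (abs_nonneg x)
          rw [one_mul]
          have h2 : |x - max (-M) (min x M)| * M ≤ |x| ^ 2 := by
            rcases le_total |x| M with h | h
            · rw [abs_le] at h
              rw [min_eq_left h.2, max_eq_right h.1]
              simp; positivity
            · have h3 : |x - max (-M) (min x M)| ≤ |x| := by
                rcases le_total 0 x with hx | hx
                · rw [abs_of_nonneg hx] at h ⊢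
                  rw [min_eq_right h, max_eq_right (by linarith), abs_of_nonneg (by linarith)]
                  linarith
                · rw [abs_of_nonpos hx] at h ⊢
                  rw [min_eq_left (by linarith), max_eq_left (by linarith),
                    abs_of_nonpos (by linarith)]
                  linarith
              nlinarith [abs_nonneg x]
          rw [div_mul_eq_mul_div, le_div_iff₀ hM]
          nlinarith [abs_nonneg x]
      _ ≤ 2 * C / M := by
          rw [expect_const_mul, div_mul_eq_mul_div]
          gcongr
          exact hC n hn

/-- Convergence of the moment generating function at a degenerate minimum. -/
theorem tendsto_expect_mgf_critical (P : Phase μ θ x₁ k A D D' ρ B r c ω) (hk : Odd k)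
    (hk2 : 2 ≤ k) (hb : 0 < b)
    (hloc : (fun x => H μ θ x - H μ θ x₁ - b * (x - x₁) ^ (k + 1)) =O[𝓝 x₁]
      fun x => (x - x₁) ^ (k + 2)) {v : ℝ}
    (hvar : 0 < variance (fun h => Real.tanh (√θ * x₁ + h)) μ)
    (hv : v = (√θ / ((k + 1) * b * √θ ^ k)) ^ 2 *
      variance (fun h => Real.tanh (√θ * x₁ + h)) μ)
    {β : ℕ → ℝ} (hβ : Tendsto β atTop (𝓝 0)) (t : ℝ) :
    Tendsto (fun n : ℕ => expect μ θ (A n) fun σ =>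
      Real.exp (t * (magScaled k (meanTanh μ θ x₁) σ - β n)))
      atTop (𝓝 (∫ y, Real.exp (t * oddRoot hk y) ∂(gaussianReal 0 v.toNNReal))) := by
  obtain ⟨C, hC⟩ := P.exists_expect_exp_abs_le (2 * |t|)
  obtain ⟨β₀, hβ₀⟩ := hβ.abs.bddAbove_range
  have hβ₁ : ∀ n, |β n| ≤ β₀ := fun n => hβ₀ ⟨n, rfl⟩
  obtain ⟨I, hI⟩ : ∃ I, I = ∫ y, Real.exp (2 * t * oddRoot hk y) ∂(gaussianReal 0 v.toNNReal) :=
    ⟨_, rfl⟩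
  have htrunc : ∀ x M : ℝ, 0 < M → |Real.exp x - min (Real.exp x) M| ≤ Real.exp (2 * x) / M := by
    intro x M hM
    have h0 := Real.exp_pos x
    rw [abs_of_nonneg (sub_nonneg.2 (min_le_left _ _)), le_div_iff₀ hM, two_mul, Real.exp_add]
    rcases le_total (Real.exp x) M with h | h
    · rw [min_eq_left h, sub_self, zero_mul]; positivity
    · rw [min_eq_right h]; nlinarith
  obtain ⟨C₁, hC₁⟩ : ∃ C₁, C₁ = max (Real.exp (2 * |t| * β₀) * C) I := ⟨_, rfl⟩
  refine tendsto_of_truncation (C := C₁)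
    (l' := fun M => ∫ y, min (Real.exp (t * oddRoot hk y)) M ∂(gaussianReal 0 v.toNNReal))
    (a' := fun M n => expect μ θ (A n) fun σ =>
      min (Real.exp (t * (magScaled k (meanTanh μ θ x₁) σ - β n))) M)
    (fun M hM => ?_) (fun M hM n hn => ?_) (fun M hM => ?_)
  · exact P.tendsto_expect_critical hk hk2 hb hloc hvar hv hβ
      (BoundedContinuousFunction.ofNormedAddCommGroup (fun x : ℝ => min (Real.exp (t * x)) M)
        (by fun_prop) M fun x => by
          rw [Real.norm_eq_abs, abs_of_nonneg (le_min (Real.exp_pos _).le hM.le)]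
          exact min_le_right _ _)
  · have hA := P.nonempty n hn
    rw [← expect_sub hA]
    refine (abs_expect_le hA).trans ?_
    calc _ ≤ expect μ θ (A n) (fun σ => Real.exp (2 * |t| * β₀) / M *
          Real.exp (2 * |t| * |magScaled k (meanTanh μ θ x₁) σ|)) := by
          refine expect_mono hA fun σ _ => (htrunc _ M hM).trans ?_
          rw [div_mul_eq_mul_div, ← Real.exp_add]
          gcongr
          have h1 := le_abs_self (t * (magScaled k (meanTanh μ θ x₁) σ - β n))
          rw [abs_mul] at h1
          have h2 := mul_le_mul_of_nonneg_left ((abs_sub (magScaled k (meanTanh μ θ x₁) σ)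
            (β n)).trans (add_le_add_right (hβ₁ n) _)) (abs_nonneg t)
          linarith
      _ = Real.exp (2 * |t| * β₀) * expect μ θ (A n) (fun σ =>
          Real.exp (2 * |t| * |magScaled k (meanTanh μ θ x₁) σ|)) / M := by
          rw [expect_const_mul]; ring
      _ ≤ C₁ / M := by
          gcongr
          rw [hC₁]
          refine le_trans ?_ (le_max_left _ _)
          gcongr
          exact hC n hn
  · have hroot := continuous_oddRoot hk
    have hi1 := integrable_exp_oddRoot hk t v.toNNReal
    have hi2 := integrable_exp_oddRoot hk (2 * t) v.toNNReal
    have hi3 : Integrable (fun y => min (Real.exp (t * oddRoot hk y)) M)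
        (gaussianReal 0 v.toNNReal) :=
      integrable_of_continuous_bounded (C := M) (by fun_prop) fun y => by
        rw [abs_of_nonneg (le_min (Real.exp_pos _).le hM.le)]
        exact min_le_right _ _
    rw [← integral_sub hi1 hi3, ← Real.norm_eq_abs]
    calc _ ≤ ∫ y, Real.exp (2 * t * oddRoot hk y) / M ∂(gaussianReal 0 v.toNNReal) := by
          refine norm_integral_le_of_norm_le (hi2.div_const M) (Eventually.of_forall fun y => ?_)
          rw [mul_assoc 2 t]
          exact htrunc _ M hM
      _ = I / M := by rw [integral_div, hI]
      _ ≤ C₁ / M := by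
          gcongr
          rw [hC₁]
          exact le_max_right _ _

/-- Uniform stretched exponential bound at a minimum of order `k + 1`. -/
theorem exists_expect_exp_pow_le_two (P : Phase μ θ x₁ k A D D' ρ B r c ω) {β : ℕ → ℝ} {β₀ : ℝ}
    (hβ : ∀ n, 0 < n → |β n| ≤ β₀) :
    ∃ K : ℝ, 0 < K ∧ ∀ n : ℕ, 0 < n → expect μ θ (A n) (fun σ =>
      Real.exp ((|magScaled k (meanTanh μ θ x₁) σ - β n| / K) ^ (2 * k))) ≤ 2 := by
  have hk1 := P.one_le_k
  obtain ⟨κ, C, hκ, hC⟩ := P.exists_expect_exp_le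
  obtain ⟨M, hM⟩ : ∃ M, M = max 1 (Real.exp (κ * β₀ ^ (2 * k)) * C) := ⟨_, rfl⟩
  have hM1 : 1 ≤ M := by rw [hM]; exact le_max_left _ _
  obtain ⟨L, hL⟩ : ∃ L, L = 2 ^ (2 * k - 1) * M / κ := ⟨_, rfl⟩
  have hL0 : 0 < L := by rw [hL]; positivity
  refine ⟨L ^ (((2 * k : ℕ) : ℝ)⁻¹), by positivity, fun n hn => ?_⟩
  have hA := P.nonempty n hn
  have hKpow : (L ^ (((2 * k : ℕ) : ℝ)⁻¹)) ^ (2 * k) = L :=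
    Real.rpow_inv_natCast_pow hL0.le (by omega)
  refine le_trans (expect_mono hA fun σ _ => ?_)
    (expect_exp_div_le_two (f := fun σ => κ * β₀ ^ (2 * k) +
      κ * (n * |totalSpin σ / n - meanTanh μ θ x₁| ^ (2 * k))) hA hM1 (hM ▸ le_max_right _ _) ?_)
  · rw [Real.exp_le_exp, div_pow, hKpow, ← abs_magScaled_pow hk1]
    obtain ⟨x, hx⟩ : ∃ x, x = magScaled k (meanTanh μ θ x₁) σ := ⟨_, rfl⟩
    rw [← hx]
    have h1 : |x - β n| ^ (2 * k) ≤ 2 ^ (2 * k - 1) * (|x| ^ (2 * k) + β₀ ^ (2 * k)) := by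
      have hβ0 : 0 ≤ β₀ := (abs_nonneg _).trans (hβ n hn)
      refine le_trans (pow_le_pow_left₀ (abs_nonneg _) ((abs_sub x (β n)).trans
        (add_le_add_right (hβ n hn) _)) _) (add_pow_le (abs_nonneg _) hβ0 _)
    calc _ ≤ 2 ^ (2 * k - 1) * (|x| ^ (2 * k) + β₀ ^ (2 * k)) / L := by gcongr
      _ = _ := by rw [hL]; field_simp; ring
  · simp only [Real.exp_add]
    rw [expect_const_mul]
    gcongr
    exact hC n hn

end Phase

end CriticalExpectation

/-! ### Phases from the minima of `H` -/

section Phases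

open ProbabilityTheory

variable {μ : Measure ℝ} {θ : ℝ} [IsProbabilityMeasure μ]

/-- A unique global minimum dominates all configurations. -/
lemma exists_phase_of_unique_min (hμ : Integrable (fun h : ℝ => h) μ) (hθ : 0 < θ) {x₀ b : ℝ}
    {τ k : ℕ} (hk : k + 1 = 2 * τ) (hk1 : 1 ≤ k) (hmin : ∀ x, x ≠ x₀ → H μ θ x₀ < H μ θ x)
    (hb : 0 < b) (hloc : (fun x => H μ θ x - H μ θ x₀ - b * (x - x₀) ^ (2 * τ)) =O[𝓝 x₀]
      fun x => (x - x₀) ^ (2 * τ + 1)) :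
    ∃ B c : ℝ, Phase μ θ x₀ k (fun _ => Finset.univ) Set.univ Set.univ 0 B 1 c 1 := by
  obtain ⟨c, hc, hlow⟩ := exists_pow_le_sub_of_expansion (continuous_H hμ) hb hloc isClosed_univ
    (fun x _ hx => hmin x hx) (4 * (|x₀| + √θ) + 1)
  refine ⟨4 * (|x₀| + √θ) + 1, c, ?_⟩
  exact
  { integrable := hμ
    theta_pos := hθ
    crit := slope_eq_zero_of_isMin hμ fun x => by
      rcases eq_or_ne x x₀ with rfl | h
      · exact le_rfl
      · exact (hmin x h).le
    one_le_k := hk1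
    le_B := le_rfl
    r_pos := one_pos
    r_le := by
      have : 0 ≤ 4 * (|x₀| + √θ) := by positivity
      linarith
    c_pos := hc
    omega_pos := one_pos
    omega_le := le_rfl
    ball_subset := Set.subset_univ _
    measurable' := MeasurableSet.univ
    thick := fun _ _ _ _ => Set.mem_univ _
    nonempty := fun _ _ => Finset.univ_nonempty
    mem_D := fun _ _ _ _ => Set.mem_univ _
    approx := fun n hn h => regionApprox_univ hθ hn h
    lower := fun y hy hyB => by rw [hk]; exact hlow y hy hyB
    gap := Or.inl rfl }

lemma integral_comp_neg_of_symmetric (hsym : μ.map (fun h => -h) = μ) (f : ℝ → ℝ) :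
    ∫ h, f (-h) ∂μ = ∫ h, f h ∂μ := by
  have h1 := integral_map_equiv (μ := μ) (MeasurableEquiv.neg ℝ) f
  rw [show (⇑(MeasurableEquiv.neg ℝ)) = fun x : ℝ => -x from rfl, hsym] at h1
  exact h1.symm

lemma H_neg (hsym : μ.map (fun h => -h) = μ) (x : ℝ) : H μ θ (-x) = H μ θ x := by
  rw [H, H, ← integral_comp_neg_of_symmetric hsym fun h => Real.log (Real.cosh (√θ * x + h)), neg_sq]
  congr 2
  ext h
  rw [← Real.cosh_neg]
  ring_nf

lemma meanSechSq_neg (hsym : μ.map (fun h => -h) = μ) (x : ℝ) :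
    meanSechSq μ θ (-x) = meanSechSq μ θ x := by
  rw [meanSechSq, meanSechSq,
    ← integral_comp_neg_of_symmetric hsym fun h => (Real.cosh (√θ * x + h) ^ 2)⁻¹]
  congr 1
  ext h
  rw [← Real.cosh_neg]
  ring_nf

lemma signRegion_nonempty {n : ℕ} (hn : 0 < n) {ε : ℝ} (hε : ε = 1 ∨ ε = -1) :
    (signRegion n ε).Nonempty := by
  have hn' : (0 : ℝ) < n := by positivity
  rcases hε with rfl | rfl
  · refine ⟨fun _ => 1, ?_⟩
    simp [signRegion, totalSpin, spin, hn]
  · refine ⟨fun _ => -1, ?_⟩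
    simp [signRegion, totalSpin, spin, hn]

/-- If the global minima are `± x₀`, the minimum `ε x₀` dominates the configurations whose
magnetization has the sign of `ε`. -/
lemma exists_phase_of_symmetric (hμ : Integrable (fun h : ℝ => h) μ) (hθ : 0 < θ) {x₀ ε : ℝ}
    (hsym : μ.map (fun h => -h) = μ) (hx₀ : 0 < x₀)
    (hmin : ∀ x, x ≠ x₀ → x ≠ -x₀ → H μ θ x₀ < H μ θ x) (hε : ε = 1 ∨ ε = -1)
    (hs : θ * meanSechSq μ θ x₀ < 1) :
    θ * meanSechSq μ θ (ε * x₀) < 1 ∧ ∃ D D' : Set ℝ, ∃ B r c ω : ℝ,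
      Phase μ θ (ε * x₀) 1 (fun n => signRegion n ε) D D' 1 B r c ω := by
  have hεε : ε * ε = 1 := by rcases hε with rfl | rfl <;> norm_num
  have hεabs : |ε| = 1 := by rcases hε with rfl | rfl <;> norm_num
  have hsε : meanSechSq μ θ (ε * x₀) = meanSechSq μ θ x₀ := by
    rcases hε with rfl | rfl
    · rw [one_mul]
    · rw [neg_one_mul, meanSechSq_neg hsym]
  have hHε : H μ θ (ε * x₀) = H μ θ x₀ := by
    rcases hε with rfl | rfl
    · rw [one_mul]
    · rw [neg_one_mul, H_neg hsym]
  have hs' : θ * meanSechSq μ θ (ε * x₀) < 1 := by rw [hsε]; exact hs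
  have hcrit : ε * x₀ = √θ * meanTanh μ θ (ε * x₀) := slope_eq_zero_of_isMin hμ fun x => by
    rw [hHε]
    by_cases h1 : x = x₀
    · rw [h1]
    by_cases h2 : x = -x₀
    · rw [h2, H_neg hsym]
    exact (hmin x h1 h2).le
  have hxne : ∀ y, -(x₀ / 2) ≤ ε * y → y ≠ ε * x₀ → H μ θ (ε * x₀) < H μ θ y := by
    intro y hy hne
    rw [hHε]
    refine hmin y ?_ ?_
    · rintro rfl
      rcases hε with rfl | rfl
      · exact hne (one_mul _).symm
      · linarith
    · rintro rfl
      rcases hε with rfl | rfl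
      · linarith
      · exact hne (neg_one_mul _).symm
  have hclosed : IsClosed {y : ℝ | -(x₀ / 2) ≤ ε * y} := isClosed_le continuous_const (by fun_prop)
  obtain ⟨c, hc, hlow⟩ := exists_pow_le_sub_of_expansion (continuous_H hμ)
    (by linarith : 0 < (1 - θ * meanSechSq μ θ (ε * x₀)) / 2)
    (H_expansion_of_nondegenerate hμ hθ hcrit) hclosed hxne (4 * (|ε * x₀| + √θ) + 1)
  have habs : |ε * x₀| = x₀ := by rw [abs_mul, hεabs, one_mul, abs_of_pos hx₀]
  have hmul : ∀ y z : ℝ, -|y - z| ≤ ε * y - ε * z := fun y z => by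
    rw [← mul_sub]
    have := neg_abs_le (ε * (y - z))
    rwa [abs_mul, hεabs, one_mul] at this
  refine ⟨hs', {y | 0 < ε * y}, {y | -(x₀ / 2) ≤ ε * y}, 4 * (|ε * x₀| + √θ) + 1, x₀ / 2, c,
    min 1 (x₀ / 2), ?_⟩
  exact
  { integrable := hμ
    theta_pos := hθ
    crit := hcrit
    one_le_k := le_rfl
    le_B := le_rfl
    r_pos := half_pos hx₀
    r_le := by
      rw [habs]
      have : 0 ≤ √θ := Real.sqrt_nonneg _
      linarith
    c_pos := hc
    omega_pos := by positivity
    omega_le := min_le_left _ _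
    ball_subset := by
      intro y hy
      rw [Metric.mem_closedBall, Real.dist_eq] at hy
      have h1 := hmul y (ε * x₀)
      rw [← mul_assoc, hεε, one_mul] at h1
      show 0 < ε * y
      linarith
    measurable' := hclosed.measurableSet
    thick := by
      intro y hy z hz
      have h1 := hmul z y
      have h2 : 0 < ε * y := hy
      have h3 := hz.trans (min_le_right _ _)
      show -(x₀ / 2) ≤ ε * z
      linarith
    nonempty := fun n hn => signRegion_nonempty hn hε
    mem_D := by
      intro n hn σ hσ
      have h1 : 0 < ε * totalSpin σ := by simpa [signRegion] using hσ
      have hn' : (0 : ℝ) < n := by positivity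
      show 0 < ε * (√θ * totalSpin σ / n)
      rw [show ε * (√θ * totalSpin σ / n) = √θ * (ε * totalSpin σ) / n by ring]
      positivity
    approx := fun n hn h => regionApprox_sign hθ hn h ε
    lower := fun y hy hyB => hlow y hy hyB
    gap := Or.inr ⟨rfl, hxne 0 (by simp; linarith) (by
      rcases hε with rfl | rfl
      · rw [one_mul]; exact hx₀.ne
      · rw [neg_one_mul]; exact (neg_neg_of_pos hx₀).ne')⟩ }

lemma magScaled_one {n : ℕ} (hn : 0 < n) (a : ℝ) (σ : Config n) :
    magScaled 1 a σ = gaussScaled a σ := by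
  rw [gaussScaled_eq hn, magScaled, ← scale_pow_half le_rfl, pow_one]

lemma Phase.exists_subgaussian {x₁ ρ B r c ω : ℝ} {A : ∀ n : ℕ, Finset (Config n)} {D D' : Set ℝ}
    (P : Phase μ θ x₁ 1 A D D' ρ B r c ω) :
    ∃ K : ℝ, 0 < K ∧ ∀ n : ℕ, 0 < n → expect μ θ (A n) (fun σ =>
      Real.exp ((|gaussScaled (meanTanh μ θ x₁) σ| / K) ^ 2)) ≤ 2 := by
  obtain ⟨K, hK, h⟩ := P.exists_expect_exp_pow_le_two (β := fun _ => 0) (β₀ := 0) (fun n _ => by simp)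
  refine ⟨K, hK, fun n hn => ?_⟩
  have := h n hn
  simpa only [magScaled_one hn, sub_zero, mul_one] using this

lemma critScaled_eq {τ n : ℕ} (hτ : 2 ≤ τ) (hn : 0 < n) (a : ℝ) (σ : Config n) :
    critScaled μ θ τ σ = magScaled (2 * τ - 1) a σ -
      expect μ θ Finset.univ (magScaled (n := n) (2 * τ - 1) a) := by
  have hn' : (0 : ℝ) < n := by positivity
  have hA : (Finset.univ : Finset (Config n)).Nonempty := Finset.univ_nonempty
  obtain ⟨S, hS⟩ : ∃ S, S = expect μ θ (Finset.univ : Finset (Config n)) totalSpin := ⟨_, rfl⟩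
  have h1 : expect μ θ Finset.univ (magScaled (n := n) (2 * τ - 1) a) =
      scale (2 * τ - 1) n * (S / n - a) := by
    have : (magScaled (n := n) (2 * τ - 1) a) = fun σ : Config n =>
        scale (2 * τ - 1) n * ((n : ℝ)⁻¹ * totalSpin σ - a) := by
      ext σ; rw [magScaled, div_eq_inv_mul]
    rw [this, expect_const_mul, expect_sub hA, expect_const_mul, expect_const hA, ← hS,
      div_eq_inv_mul]
  have h2 : ∑ i, (spin σ i - expect μ θ Finset.univ fun σ' : Config n => spin σ' i) =
      totalSpin σ - S := by
    rw [Finset.sum_sub_distrib, hS]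
    congr 1
    exact (expect_finsetSum Finset.univ hA fun i σ' => spin σ' i).symm
  have h3 : (n : ℝ) ^ (-((4 * τ - 3) / (4 * τ - 2)) : ℝ) = scale (2 * τ - 1) n / n := by
    rw [scale, ← Real.rpow_sub_one hn'.ne']
    congr 1
    have hτ' : (2 : ℝ) ≤ τ := by exact_mod_cast hτ
    have h4 : ((2 * (2 * τ - 1) : ℕ) : ℝ) = 4 * τ - 2 := by
      rw [Nat.cast_mul, Nat.cast_sub (by omega)]; push_cast; ring
    have h5 : (4 * τ - 2 : ℝ) ≠ 0 := by linarith
    rw [h4]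
    field_simp
    ring
  rw [critScaled, h2, h3, h1, magScaled]
  field_simp
  ring

lemma variance_tanh_pos (hμ : ∀ c : ℝ, μ ≠ Measure.dirac c) (x : ℝ) :
    0 < variance (fun h => Real.tanh (√θ * x + h)) μ := by
  have hc : Continuous fun h => Real.tanh (√θ * x + h) := continuous_tanh.comp (by fun_prop)
  refine lt_of_le_of_ne (variance_nonneg _ _) fun h0 => ?_
  have hm : MemLp (fun h => Real.tanh (√θ * x + h)) 2 μ :=
    MemLp.of_bound hc.aestronglyMeasurable 1 (Eventually.of_forall fun h => abs_tanh_le_one _)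
  have hae := ae_eq_integral_of_variance_eq_zero hm h0.symm
  obtain ⟨h₀, hh₀⟩ := hae.exists
  refine hμ h₀ ?_
  have h1 : (fun h : ℝ => h) =ᵐ[μ] fun _ => h₀ := by
    filter_upwards [hae] with h hh
    have := Real.tanh_injective (hh.trans hh₀.symm)
    linarith
  have h2 : μ.map (fun h : ℝ => h) = μ.map fun _ => h₀ := Measure.map_congr h1
  rw [Measure.map_id', Measure.map_const, measure_univ, one_smul] at h2
  exact h2

lemma critVar_eq {x₀ b : ℝ} {τ k : ℕ} (hτ : 2 ≤ τ) (hk : k + 1 = 2 * τ) (hθ : 0 < θ)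
    (hs : θ * meanSechSq μ θ x₀ = 1)
    (hD : 0 < iteratedDeriv (2 * τ) (H μ θ) x₀)
    (hb : b = iteratedDeriv (2 * τ) (H μ θ) x₀ / (Nat.factorial (2 * τ))) :
    critVar μ θ x₀ τ = (√θ / ((k + 1) * b * √θ ^ k)) ^ 2 *
      variance (fun h => Real.tanh (√θ * x₀ + h)) μ := by
  have hse : meanSechSq μ θ x₀ = θ⁻¹ := by
    rw [← one_div, eq_div_iff hθ.ne']; linarith
  have hfac : (Nat.factorial (2 * τ) : ℝ) = (k + 1) * Nat.factorial (2 * τ - 1) := by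
    rw [← hk, Nat.factorial_succ]; push_cast; simp
  have hsq : √θ ^ 2 = θ := Real.sq_sqrt hθ.le
  have h1 : (√θ ^ k) ^ 2 = θ ^ k := by rw [← pow_mul, mul_comm, pow_mul, hsq]
  have hpow : θ ^ (4 * τ - 2) * θ = θ ^ (2 * τ) * θ ^ k := by
    rw [← pow_succ, ← pow_add]; congr 1; omega
  rw [critVar, hb, hse, hfac, div_pow, mul_pow, mul_pow, div_pow, h1, hsq, inv_pow]
  have h2 : (0 : ℝ) < Nat.factorial (2 * τ - 1) := by positivity
  have h3 : (0 : ℝ) < (k : ℝ) + 1 := by positivity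
  field_simp
  linear_combination (-variance (fun h => Real.tanh (√θ * x₀ + h)) μ) * hpow

end Phases

end RFCW

theorem mainTheorem1 (μ : Measure ℝ) [IsProbabilityMeasure μ]
    (hμ : Integrable (fun h : ℝ => h) μ) (θ : ℝ) (hθ : 0 < θ) :
    -- high temperature: a unique, nondegenerate global minimum of `H`
    (∀ x₀ : ℝ, (∀ x, x ≠ x₀ → RFCW.H μ θ x₀ < RFCW.H μ θ x) →
      θ * RFCW.meanSechSq μ θ x₀ < 1 →
      x₀ = √θ * RFCW.meanTanh μ θ x₀ ∧
      (∀ t : ℝ, Tendsto (fun n : ℕ =>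
          RFCW.expect μ θ (Finset.univ : Finset (RFCW.Config n)) fun σ =>
            Real.exp (t * RFCW.gaussScaled (RFCW.meanTanh μ θ x₀) σ))
        atTop (𝓝 (Real.exp (RFCW.gaussVar μ θ x₀ * t ^ 2 / 2)))) ∧
      ∃ K : ℝ, 0 < K ∧ ∀ n : ℕ, 0 < n →
        RFCW.expect μ θ (Finset.univ : Finset (RFCW.Config n)) (fun σ =>
          Real.exp ((|RFCW.gaussScaled (RFCW.meanTanh μ θ x₀) σ| / K) ^ 2)) ≤ 2) ∧
    -- low temperature: symmetric field, the global minima of `H` are exactly `± x₀`,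
    -- and they are nondegenerate
    (∀ x₀ : ℝ, μ.map (fun h => -h) = μ → 0 < x₀ →
      (∀ x, x ≠ x₀ → x ≠ -x₀ → RFCW.H μ θ x₀ < RFCW.H μ θ x) →
      θ * RFCW.meanSechSq μ θ x₀ < 1 →
      ∀ ε : ℝ, (ε = 1 ∨ ε = -1) →
        ε * x₀ = √θ * RFCW.meanTanh μ θ (ε * x₀) ∧
        (∀ t : ℝ, Tendsto (fun n : ℕ =>
            RFCW.expect μ θ (RFCW.signRegion n ε) fun σ =>
              Real.exp (t * RFCW.gaussScaled (RFCW.meanTanh μ θ (ε * x₀)) σ))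
          atTop (𝓝 (Real.exp (RFCW.gaussVar μ θ (ε * x₀) * t ^ 2 / 2)))) ∧
        ∃ K : ℝ, 0 < K ∧ ∀ n : ℕ, 0 < n →
          RFCW.expect μ θ (RFCW.signRegion n ε) (fun σ =>
            Real.exp ((|RFCW.gaussScaled (RFCW.meanTanh μ θ (ε * x₀)) σ| / K) ^ 2)) ≤ 2) ∧
    -- critical temperature: a unique global minimum of `H`, of flatness `τ ≥ 2`
    (∀ (x₀ : ℝ) (τ : ℕ), 2 ≤ τ → (∀ c : ℝ, μ ≠ Measure.dirac c) →
      (∀ x, x ≠ x₀ → RFCW.H μ θ x₀ < RFCW.H μ θ x) →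
      RFCW.HasFlatness μ θ x₀ τ →
      iteratedDeriv (2 * τ) (RFCW.H μ θ) x₀ =
        2 ^ (2 * τ - 1) * θ ^ τ * ∫ h, (1 + Real.tanh (√θ * x₀ + h)) *
          ∑ k ∈ Finset.range (2 * τ), (Nat.factorial k : ℝ) / 2 ^ k *
            (Nat.stirlingSecond (2 * τ - 1) k : ℝ) * (Real.tanh (√θ * x₀ + h) - 1) ^ k ∂μ ∧
      (∀ f : BoundedContinuousFunction ℝ ℝ, Tendsto (fun n : ℕ =>
          RFCW.expect μ θ (Finset.univ : Finset (RFCW.Config n)) fun σ =>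
            f (RFCW.critScaled μ θ τ σ))
        atTop (𝓝 (∫ x, f x * RFCW.critDensity τ (RFCW.critVar μ θ x₀ τ) x))) ∧
      (∀ t : ℝ, Tendsto (fun n : ℕ =>
          RFCW.expect μ θ (Finset.univ : Finset (RFCW.Config n)) fun σ =>
            Real.exp (t * RFCW.critScaled μ θ τ σ))
        atTop (𝓝 (∫ x, Real.exp (t * x) * RFCW.critDensity τ (RFCW.critVar μ θ x₀ τ) x))) ∧
      ∃ K : ℝ, 0 < K ∧ ∀ n : ℕ, 0 < n →
        RFCW.expect μ θ (Finset.univ : Finset (RFCW.Config n)) (fun σ =>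
          Real.exp ((|RFCW.critScaled μ θ τ σ| / K) ^ (4 * τ - 2))) ≤ 2) := by
  refine ⟨fun x₀ hmin hs => ?_, fun x₀ hsym hx₀ hmin hs ε hε => ?_, fun x₀ τ hτ hdirac hmin hflat => ?_⟩
  · have hcrit : x₀ = √θ * RFCW.meanTanh μ θ x₀ := RFCW.slope_eq_zero_of_isMin hμ fun x => by
      rcases eq_or_ne x x₀ with rfl | h
      · exact le_rfl
      · exact (hmin x h).le
    obtain ⟨B, c, P⟩ := RFCW.exists_phase_of_unique_min (τ := 1) (k := 1) hμ hθ rfl le_rfl hmin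
      (by linarith : 0 < (1 - θ * RFCW.meanSechSq μ θ x₀) / 2)
      (RFCW.H_expansion_of_nondegenerate hμ hθ hcrit)
    exact ⟨hcrit, P.tendsto_expect_mgf hs, P.exists_subgaussian⟩
  · obtain ⟨hs', D, D', B, r, c, ω, P⟩ := RFCW.exists_phase_of_symmetric hμ hθ hsym hx₀ hmin hε hs
    exact ⟨P.crit, P.tendsto_expect_mgf hs', P.exists_subgaussian⟩
  · obtain ⟨k, hk⟩ : ∃ k, k = 2 * τ - 1 := ⟨_, rfl⟩
    have hk1 : k + 1 = 2 * τ := by omega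
    have hodd : Odd k := ⟨τ - 1, by omega⟩
    have hD := hflat.1
    obtain ⟨b, hb⟩ : ∃ b, b = iteratedDeriv (2 * τ) (RFCW.H μ θ) x₀ / (Nat.factorial (2 * τ)) :=
      ⟨_, rfl⟩
    have hb0 : 0 < b := by rw [hb]; positivity
    have hloc := hflat.2
    rw [← hb] at hloc
    obtain ⟨B, c, P⟩ := RFCW.exists_phase_of_unique_min hμ hθ hk1 (by omega) hmin hb0 hloc
    have hs := RFCW.theta_mul_meanSechSq_eq_one hμ hθ P.crit hτ hflat
    have hvar := RFCW.variance_tanh_pos (θ := θ) hdirac x₀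
    have hv := RFCW.critVar_eq hτ hk1 hθ hs hD hb
    obtain ⟨v, hvd⟩ : ∃ v, v = RFCW.critVar μ θ x₀ τ := ⟨_, rfl⟩
    rw [← hvd] at hv ⊢
    have hv0 : 0 < v := by rw [hv]; positivity
    rw [← hk1] at hloc
    have hβ := P.tendsto_expect_magScaled hodd (by omega) hb0 hloc hvar
    have hscaled : ∀ n : ℕ, 0 < n → ∀ σ : RFCW.Config n, RFCW.critScaled μ θ τ σ =
        RFCW.magScaled k (RFCW.meanTanh μ θ x₀) σ -
          RFCW.expect μ θ Finset.univ (RFCW.magScaled (n := n) k (RFCW.meanTanh μ θ x₀)) :=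
      fun n hn σ => by rw [hk]; exact RFCW.critScaled_eq hτ hn _ σ
    have hdens : ∀ f : ℝ → ℝ,
        ∫ y, f (RFCW.oddRoot hodd y) ∂(ProbabilityTheory.gaussianReal 0 v.toNNReal) =
          ∫ x, f x * RFCW.critDensity τ v x := by
      intro f
      rw [RFCW.integral_oddRoot_gaussianReal hodd f hv0]
      have hkc : (k : ℝ) = 2 * τ - 1 := by
        have : ((k + 1 : ℕ) : ℝ) = ((2 * τ : ℕ) : ℝ) := by rw [hk1]
        push_cast at this
        linarith
      rw [hkc, show k - 1 = 2 * τ - 2 by omega, show 2 * k = 4 * τ - 2 by omega]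
      rfl
    refine ⟨RFCW.iteratedDeriv_H_stirling hμ hθ x₀ hτ, fun f => ?_, fun t => ?_, ?_⟩
    · rw [← hdens f]
      refine (P.tendsto_expect_critical hodd (by omega) hb0 hloc hvar hv hβ f).congr' ?_
      filter_upwards [eventually_gt_atTop 0] with n hn
      simp only [hscaled n hn]
    · rw [← hdens fun x => Real.exp (t * x)]
      refine (P.tendsto_expect_mgf_critical hodd (by omega) hb0 hloc hvar hv hβ t).congr' ?_
      filter_upwards [eventually_gt_atTop 0] with n hn
      simp only [hscaled n hn]
    · obtain ⟨β₀, hβ₀⟩ := hβ.abs.bddAbove_range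
      obtain ⟨K, hK, h⟩ := P.exists_expect_exp_pow_le_two fun n _ => hβ₀ ⟨n, rfl⟩
      refine ⟨K, hK, fun n hn => ?_⟩
      have := h n hn
      rw [show 2 * k = 4 * τ - 2 by omega] at this
      simpa only [hscaled n hn] using this
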